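/- Let $k$ be a field and $A$ a Hopf algebra over $k$ with antipode $S$ and counit $\varepsilon$ (Sweedler notation throughout), and let $\mathbf r:A\otimes A\to k$ be a co-quasitriangular structure: $\mathbf r(1,a)=\varepsilon(a)=\mathbf r(a,1)$, $\mathbf r(ab,c)=\mathbf r(a,c_{(1)})\mathbf r(b,c_{(2)})$, $\mathbf r(a,bc)=\mathbf r(a_{(1)},c)\mathbf r(a_{(2)},b)$, $b_{(1)}a_{(1)}\mathbf r(a_{(2)},b_{(2)})=\mathbf r(a_{(1)},b_{(1)})a_{(2)}b_{(2)}$. Left (right) $A$-comodules, with coactions $v\mapsto v^{(-1)}\otimes v^{(0)}$ (resp. $v\mapsto v^{(0)}\otimes v^{(1)}$), form a braided category with $\Psi(v\otimes w)=\mathbf r(w^{(-1)},v^{(-1)})\,w^{(0)}\otimes v^{(0)}$ (resp. $\Psi(v\otimes w)=w^{(0)}\otimes v^{(0)}\,\mathbf r(v^{(1)},w^{(1)})$). *Braided Lie (co)algebras.* A (left) braided Lie algebra in right $A$-comodules is a coalgebra $(L,\Delta,\varepsilon)$ in the category with a colinear bracket $[\,,]:L\otimes L\to L$ such that, with $\Upsilon=([\,,]\otimes\mathrm{id})(\mathrm{id}\otimes\Psi)(\Delta\otimes\mathrm{id})$: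 $[\,,](\mathrm{id}\otimes[\,,])=[\,,]([\,,]\otimes[\,,])(\mathrm{id}\otimes\Psi\otimes\mathrm{id})(\Delta\otimes\mathrm{id}\otimes\mathrm{id})$; $\Psi\Upsilon=(\mathrm{id}\otimes[\,,])(\Delta\otimes\mathrm{id})$; and $[\,,]$ is a coalgebra map from the braided tensor square. It is unital with unit $\gamma\in L$ if $\gamma$ is coinvariant and grouplike, $[\gamma,z]=z$ and $[z,\gamma]=\varepsilon(z)\gamma$. Its braided enveloping algebra is $B(L)=T(L)/\langle\mathrm{im}(\mathrm{id}-\Upsilon)\rangle$. A (left) braided Lie coalgebra in left $A$-comodules is a unital algebra $(V,\mu,1)$ in the category with a colinear $\delta:V\to V\otimes V$ satisfying the transposed axioms: $(\mathrm{id}\otimes\delta)\delta=(\mu\otimes\mathrm{id}\otimes\mathrm{id})(\mathrm{id}\otimes\Psi\otimes\mathrm{id})(\delta\otimes\delta)\delta$; $(\mu\otimes\mathrm{id})(\mathrm{id}\otimes\Psi)(\delta\otimes\mathrm{id})\Psi=(\mu\otimes\mathrm{id})(\mathrm{id}\otimes\delta)$; $\delta$ is a unital algebra map to the braided tensor square.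 A counit is a morphism $e:V\to k$ of braided Lie coalgebras with $(e\otimes\mathrm{id})\delta=\mathrm{id}$, $(\mathrm{id}\otimes e)\delta=1\cdot e$. *Calculi.* Let $(\Gamma,d)$ be a bicovariant first order differential calculus over $A$: a Hopf bimodule $\Gamma$ (coactions $\Delta_L,\Delta_R$) with a derivation and bicomodule map $d:A\to\Gamma$ such that $a\otimes b\mapsto a\,db$ is onto. Let $\widetilde\Gamma=\Gamma\oplus\Theta A$ be its extended bimodule, with $\Theta$ biinvariant and $a\Theta=da+\Theta a$. Let $\Gamma_R,\widetilde\Gamma_R$ be the right invariants ($\Delta_R\eta=\eta\otimes1$), with coaction $\Delta_L$ and action $a\triangleright v=a_{(1)}vS(a_{(2)})$. Put $\tilde\omega_R(a)=a\triangleright\Theta$, $\mathcal I_\Gamma=\ker\tilde\omega_R$, $\mathrm{ad}_L(a)=a_{(1)}S(a_{(3)})\otimes a_{(2)}$, and let $\underline A$ be $A$ with coaction $\mathrm{ad}_L$ and product $a\,\underline\cdot\,b=a_{(1)}b_{(2)}\,\mathbf r\big(b_{(1)}S(b_{(3)}),S(a_{(2)})\big)$. The extended tangent space is $\tilde{\mathfrak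 g}_\Gamma=\{X\in A^*:X(\mathcal I_\Gamma)=0\}$ and the tangent space is $\mathfrak g_\Gamma=\{x\in\tilde{\mathfrak g}_\Gamma:x(1)=0\}$. If $\dim\Gamma_R<\infty$, $\mathfrak g_\Gamma$ carries the bracket and braiding determined by $[x,y](a)=x(a_{(1)}S(a_{(3)}))\,y(a_{(2)})$ and $\langle a\otimes b,\sigma(x\otimes y)\rangle=x(a_{(1)}S(a_{(3)})b)\,y(a_{(2)})-[x,y](a)\,\varepsilon(b)$, where $\langle a\otimes b,x\otimes y\rangle=x(a)y(b)$; and $U(\mathfrak g_\Gamma)=T(\mathfrak g_\Gamma)/\langle\mathrm{im}(\mathrm{id}-\sigma-[\,,])\rangle$. **Theorem.** (i) $\tilde\omega_R$ induces an isomorphism $A/\mathcal I_\Gamma\simeq\widetilde\Gamma_R$ of left modules (regular action on $A/\mathcal I_\Gamma$, action $\triangleright$ on $\widetilde\Gamma_R$) and left comodules (coaction induced by $\mathrm{ad}_L$), and $\widetilde\Gamma_R\simeq\underline A/\mathcal I_\Gamma$ is a counital braided Lie coalgebra in left $A$-comodules, with product and unit induced from $\underline A$, cobracket induced by $\mathrm{ad}_L$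 and counit induced by $\varepsilon$. (ii) If $\dim\Gamma_R<\infty$, then $\tilde{\mathfrak g}_\Gamma$ is a unital braided Lie algebra in right $A$-comodules, with structure dual to (i): $\langle a\otimes b,\Delta X\rangle=X(a\,\underline\cdot\,b)$, $[X,Y](a)=X(a_{(1)}S(a_{(3)}))\,Y(a_{(2)})$, counit $X\mapsto X(1)$, coaction $X^{(0)}(a)\,X^{(1)}=a_{(1)}S(a_{(3)})\,X(a_{(2)})$, and unit $\gamma=1_{A^\circ}=\varepsilon$. Moreover $\sigma$ and $[\,,]$ are well defined on $\mathfrak g_\Gamma$, the algebra $B(\tilde{\mathfrak g}_\Gamma)$ has a bialgebra structure in the braided category of right $A$-comodules extending the coalgebra and comodule structure of $\tilde{\mathfrak g}_\Gamma$, this structure descends to $B(\tilde{\mathfrak g}_\Gamma)/\langle\gamma-1\rangle$, and the inclusion $\mathfrak g_\Gamma\subset\tilde{\mathfrak g}_\Gamma$ induces an isomorphism $U(\mathfrak g_\Gamma)\simeq B(\tilde{\mathfrak g}_\Gamma)/\langle\gamma-1\rangle$ of algebras, by which $U(\mathfrak g_\Gamma)$ is a bialgebra in that category. (iii) If moreover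 $\theta\in\Gamma$ is biinvariant ($\Delta_L\theta=1\otimes\theta$, $\Delta_R\theta=\theta\otimes1$) and $da=a\theta-\theta a$ for all $a\in A$, let $\mathcal L=(\Theta-\theta)^\perp\subset\tilde{\mathfrak g}_\Gamma$ be the orthogonal for the bilinear form on $\widetilde\Gamma\times\tilde{\mathfrak g}_\Gamma$ determined by $(\tilde\omega_R(a)b,X)=X(a)\,\varepsilon(b)$. This form exists, $\mathcal L$ is a braided Lie subalgebra of $\tilde{\mathfrak g}_\Gamma$, and $B(\mathcal L)$ has a bialgebra structure in right $A$-comodules extending the coalgebra and comodule structure of $\mathcal L$. The inclusion $\mathcal L\subset\tilde{\mathfrak g}_\Gamma$ induces an isomorphism of bialgebras $B(\mathcal L)\simeq B(\tilde{\mathfrak g}_\Gamma)/\langle\gamma-1\rangle\simeq U(\mathfrak g_\Gamma)$. -/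

import Mathlib

open scoped TensorProduct

noncomputable section

namespace BraidedLie

universe u v w

/-! ### Multilinear plumbing -/

section Plumbing

variable {k : Type*} [Field k]
variable {V P Q Q' P' W : Type*} [AddCommGroup V] [Module k V] [AddCommGroup P] [Module k P]
  [AddCommGroup Q] [Module k Q] [AddCommGroup Q'] [Module k Q'] [AddCommGroup P'] [Module k P']
  [AddCommGroup W] [Module k W]

/-- `id ⊗ f ⊗ id` acting on the two middle factors of `(V ⊗ P) ⊗ (Q ⊗ W)`. -/
def mid (f : P ⊗[k] Q →ₗ[k] Q' ⊗[k] P') :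
    (V ⊗[k] P) ⊗[k] (Q ⊗[k] W) →ₗ[k] (V ⊗[k] Q') ⊗[k] (P' ⊗[k] W) :=
  (TensorProduct.assoc k V Q' (P' ⊗[k] W)).symm.toLinearMap ∘ₗ
    LinearMap.lTensor V ((TensorProduct.assoc k Q' P' W).toLinearMap ∘ₗ
      LinearMap.rTensor W f ∘ₗ (TensorProduct.assoc k P Q W).symm.toLinearMap) ∘ₗ
    (TensorProduct.assoc k V P (Q ⊗[k] W)).toLinearMap

/-- The flip of the two middle factors, `(a ⊗ b) ⊗ (c ⊗ d) ↦ (a ⊗ c) ⊗ (b ⊗ d)`. -/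
def swapMid : (V ⊗[k] P) ⊗[k] (Q ⊗[k] W) →ₗ[k] (V ⊗[k] Q) ⊗[k] (P ⊗[k] W) :=
  (TensorProduct.tensorTensorTensorComm k V P Q W).toLinearMap

/-- The evaluation pairing `⟨a ⊗ b, x ⊗ y⟩ = ⟨a, x⟩ ⟨b, y⟩` between `A ⊗ A` and `L ⊗ L`, for a
subspace `L` of the full linear dual of `A`. -/
def pair₂ {A : Type*} [AddCommGroup A] [Module k A] (L : Submodule k (Module.Dual k A)) :
    L ⊗[k] L →ₗ[k] Module.Dual k (A ⊗[k] A) :=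
  TensorProduct.dualDistrib k A A ∘ₗ TensorProduct.map L.subtype L.subtype

end Plumbing

/-! ### Co-quasitriangular Hopf algebras -/

section Hopf

variable {k : Type u} {A : Type v} [Field k] [Ring A] [HopfAlgebra k A]

/-- A co-quasitriangular structure `r : A ⊗ A → k` on `A`. -/
structure IsCoquasitriangular (r : A ⊗[k] A →ₗ[k] k) : Prop where
  /-- `r(1, a) = ε(a)` -/
  one_left : ∀ a : A, r (1 ⊗ₜ a) = Coalgebra.counit (R := k) a
  /-- `r(a, 1) = ε(a)` -/
  one_right : ∀ a : A, r (a ⊗ₜ 1) = Coalgebra.counit (R := k) a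
  /-- `r(ab, c) = r(a, c₁) r(b, c₂)` -/
  mul_left : ∀ a b c : A, r ((a * b) ⊗ₜ c) =
    LinearMap.mul' k k (TensorProduct.map r r
      (swapMid ((a ⊗ₜ[k] b) ⊗ₜ[k] Coalgebra.comul (R := k) c)))
  /-- `r(a, bc) = r(a₁, c) r(a₂, b)` -/
  mul_right : ∀ a b c : A, r (a ⊗ₜ (b * c)) =
    LinearMap.mul' k k (TensorProduct.map r r
      (swapMid (Coalgebra.comul (R := k) a ⊗ₜ[k] (c ⊗ₜ[k] b))))
  /-- `b₁ a₁ r(a₂, b₂) = r(a₁, b₁) a₂ b₂` -/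
  quasicomm : ∀ a b : A,
    TensorProduct.rid k A (TensorProduct.map
        (LinearMap.mul' k A ∘ₗ (TensorProduct.comm k A A).toLinearMap) r
        (swapMid (Coalgebra.comul (R := k) a ⊗ₜ[k] Coalgebra.comul (R := k) b))) =
      TensorProduct.lid k A (TensorProduct.map r (LinearMap.mul' k A)
        (swapMid (Coalgebra.comul (R := k) a ⊗ₜ[k] Coalgebra.comul (R := k) b)))

/-- The left adjoint coaction `ad_L(a) = a₁ S(a₃) ⊗ a₂`. -/
def adL : A →ₗ[k] A ⊗[k] A :=
  LinearMap.rTensor A (LinearMap.mul' k A ∘ₗ LinearMap.lTensor A (HopfAlgebra.antipode k)) ∘ₗ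
    (TensorProduct.assoc k A A A).symm.toLinearMap ∘ₗ
    LinearMap.lTensor A ((TensorProduct.comm k A A).toLinearMap ∘ₗ Coalgebra.comul) ∘ₗ
    Coalgebra.comul

/-- For a left coaction `δ` on `V`, the map `a ⊗ v ↦ r(v⁽⁻¹⁾, a) v⁽⁰⁾`. -/
def cqtAct {V : Type*} [AddCommGroup V] [Module k V] (r : A ⊗[k] A →ₗ[k] k)
    (δ : V →ₗ[k] A ⊗[k] V) : A ⊗[k] V →ₗ[k] V :=
  (TensorProduct.lid k V).toLinearMap ∘ₗ
    LinearMap.rTensor V (r ∘ₗ (TensorProduct.comm k A A).toLinearMap) ∘ₗ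
    (TensorProduct.assoc k A A V).symm.toLinearMap ∘ₗ LinearMap.lTensor A δ

/-- The covariantised product of the braided group of `A`,
`a ⊗ b ↦ a₁ (S(a₂) ▷ b)` where `c ▷ b = r(b⁽⁻¹⁾, c) b⁽⁰⁾` and `b⁽⁻¹⁾ ⊗ b⁽⁰⁾ = ad_L(b)`. -/
def uMul (r : A ⊗[k] A →ₗ[k] k) : A ⊗[k] A →ₗ[k] A :=
  LinearMap.mul' k A ∘ₗ
    LinearMap.lTensor A (cqtAct r adL ∘ₗ LinearMap.rTensor A (HopfAlgebra.antipode k)) ∘ₗ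
    (TensorProduct.assoc k A A A).toLinearMap ∘ₗ
    LinearMap.rTensor A (Coalgebra.comul (R := k) (A := A))

/-! ### Comodules, tensor products, braidings -/

variable (k A) in
/-- A left `A`-comodule structure on `V`. -/
structure LeftComodule (V : Type w) [AddCommGroup V] [Module k V] where
  coact : V →ₗ[k] A ⊗[k] V
  coact_coassoc : (TensorProduct.assoc k A A V).toLinearMap ∘ₗ
    LinearMap.rTensor V Coalgebra.comul ∘ₗ coact = LinearMap.lTensor A coact ∘ₗ coact
  coact_counit : ∀ v, LinearMap.rTensor V Coalgebra.counit (coact v) = (1 : k) ⊗ₜ[k] v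

variable (k A) in
/-- A right `A`-comodule structure on `V`. -/
structure RightComodule (V : Type w) [AddCommGroup V] [Module k V] where
  coact : V →ₗ[k] V ⊗[k] A
  coact_coassoc : (TensorProduct.assoc k V A A).toLinearMap ∘ₗ
    LinearMap.rTensor A coact ∘ₗ coact = LinearMap.lTensor V Coalgebra.comul ∘ₗ coact
  coact_counit : ∀ v, LinearMap.lTensor V Coalgebra.counit (coact v) = v ⊗ₜ[k] (1 : k)

section Coactions

variable {V W : Type*} [AddCommGroup V] [Module k V] [AddCommGroup W] [Module k W]

/-- Left coaction on a tensor product: `v ⊗ w ↦ v⁽⁻¹⁾ w⁽⁻¹⁾ ⊗ (v⁽⁰⁾ ⊗ w⁽⁰⁾)`. -/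
def tensorCoactL (δV : V →ₗ[k] A ⊗[k] V) (δW : W →ₗ[k] A ⊗[k] W) :
    V ⊗[k] W →ₗ[k] A ⊗[k] (V ⊗[k] W) :=
  LinearMap.rTensor (V ⊗[k] W) (LinearMap.mul' k A) ∘ₗ swapMid ∘ₗ TensorProduct.map δV δW

/-- Right coaction on a tensor product: `v ⊗ w ↦ (v⁽⁰⁾ ⊗ w⁽⁰⁾) ⊗ v⁽¹⁾ w⁽¹⁾`. -/
def tensorCoactR (δV : V →ₗ[k] V ⊗[k] A) (δW : W →ₗ[k] W ⊗[k] A) :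
    V ⊗[k] W →ₗ[k] (V ⊗[k] W) ⊗[k] A :=
  LinearMap.lTensor (V ⊗[k] W) (LinearMap.mul' k A) ∘ₗ swapMid ∘ₗ TensorProduct.map δV δW

/-- The braiding of left comodules: `v ⊗ w ↦ r(w⁽⁻¹⁾, v⁽⁻¹⁾) w⁽⁰⁾ ⊗ v⁽⁰⁾`. -/
def braidL (r : A ⊗[k] A →ₗ[k] k) (δV : V →ₗ[k] A ⊗[k] V) (δW : W →ₗ[k] A ⊗[k] W) :
    V ⊗[k] W →ₗ[k] W ⊗[k] V :=
  (TensorProduct.lid k (W ⊗[k] V)).toLinearMap ∘ₗ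
    TensorProduct.map (r ∘ₗ (TensorProduct.comm k A A).toLinearMap)
      (TensorProduct.comm k V W).toLinearMap ∘ₗ
    swapMid ∘ₗ TensorProduct.map δV δW

/-- The braiding of right comodules: `v ⊗ w ↦ w⁽⁰⁾ ⊗ v⁽⁰⁾ r(v⁽¹⁾, w⁽¹⁾)`. -/
def braidR (r : A ⊗[k] A →ₗ[k] k) (δV : V →ₗ[k] V ⊗[k] A) (δW : W →ₗ[k] W ⊗[k] A) :
    V ⊗[k] W →ₗ[k] W ⊗[k] V :=
  (TensorProduct.rid k (W ⊗[k] V)).toLinearMap ∘ₗ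
    TensorProduct.map (TensorProduct.comm k V W).toLinearMap r ∘ₗ
    swapMid ∘ₗ TensorProduct.map δV δW

end Coactions

/-! ### Braided Lie coalgebras in left comodules -/

/-- A (left) braided Lie coalgebra in the braided category of left `A`-comodules: a unital
associative algebra in the category with a cobracket, all structure maps being colinear. -/
structure BraidedLieCoalgebra (r : A ⊗[k] A →ₗ[k] k) (V : Type w) [AddCommGroup V] [Module k V]
    extends LeftComodule k A V where
  mul : V ⊗[k] V →ₗ[k] V
  one : V
  cobracket : V →ₗ[k] V ⊗[k] V
  mul_assoc : mul ∘ₗ LinearMap.rTensor V mul =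
    mul ∘ₗ LinearMap.lTensor V mul ∘ₗ (TensorProduct.assoc k V V V).toLinearMap
  one_mul : ∀ v, mul (one ⊗ₜ v) = v
  mul_one : ∀ v, mul (v ⊗ₜ one) = v
  mul_colinear : coact ∘ₗ mul = LinearMap.lTensor A mul ∘ₗ tensorCoactL coact coact
  one_colinear : coact one = 1 ⊗ₜ one
  cobracket_colinear :
    tensorCoactL coact coact ∘ₗ cobracket = LinearMap.lTensor A cobracket ∘ₗ coact
  /-- Braided co-Jacobi identity
  `(id ⊗ δ) δ = (μ ⊗ id ⊗ id)(id ⊗ Ψ ⊗ id)(δ ⊗ δ) δ`. -/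
  co_jacobi : LinearMap.lTensor V cobracket ∘ₗ cobracket =
    LinearMap.rTensor (V ⊗[k] V) mul ∘ₗ mid (braidL r coact coact) ∘ₗ
      TensorProduct.map cobracket cobracket ∘ₗ cobracket
  /-- Weak braided commutativity
  `(μ ⊗ id)(id ⊗ Ψ)(δ ⊗ id) Ψ = (μ ⊗ id)(id ⊗ δ)`. -/
  weak_comm :
    (LinearMap.rTensor V mul ∘ₗ (TensorProduct.assoc k V V V).symm.toLinearMap ∘ₗ
      LinearMap.lTensor V (braidL r coact coact) ∘ₗ (TensorProduct.assoc k V V V).toLinearMap ∘ₗ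
      LinearMap.rTensor V cobracket) ∘ₗ braidL r coact coact =
    LinearMap.rTensor V mul ∘ₗ (TensorProduct.assoc k V V V).symm.toLinearMap ∘ₗ
      LinearMap.lTensor V cobracket
  /-- The cobracket is an algebra map into the braided tensor square. -/
  cobracket_mul : cobracket ∘ₗ mul =
    TensorProduct.map mul mul ∘ₗ mid (braidL r coact coact) ∘ₗ
      TensorProduct.map cobracket cobracket
  cobracket_one : cobracket one = one ⊗ₜ one

/-- A counit on a braided Lie coalgebra: a morphism of braided Lie coalgebras `e : V → k` with
`(e ⊗ id) δ = id` and `(id ⊗ e) δ = 1 · e`. -/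
structure BraidedLieCoalgebra.IsCounit {r : A ⊗[k] A →ₗ[k] k} {V : Type w} [AddCommGroup V]
    [Module k V] (C : BraidedLieCoalgebra r V) (e : V →ₗ[k] k) : Prop where
  colinear : ∀ v, LinearMap.lTensor A e (C.coact v) = 1 ⊗ₜ[k] e v
  map_mul : ∀ v w, e (C.mul (v ⊗ₜ w)) = e v * e w
  map_one : e C.one = 1
  map_cobracket : ∀ v, TensorProduct.map e e (C.cobracket v) = e v ⊗ₜ[k] 1
  left : ∀ v, LinearMap.rTensor V e (C.cobracket v) = 1 ⊗ₜ[k] v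
  right : ∀ v, LinearMap.lTensor V e (C.cobracket v) = C.one ⊗ₜ[k] e v

/-! ### Braided Lie algebras in right comodules -/

/-- For a comultiplication, braiding and bracket on `L`, the map
`Υ = ([ , ] ⊗ id)(id ⊗ Ψ)(Δ ⊗ id)`. -/
def canonicalBraid {L : Type w} [AddCommGroup L] [Module k L] (Δ : L →ₗ[k] L ⊗[k] L)
    (Ψ : L ⊗[k] L →ₗ[k] L ⊗[k] L) (br : L ⊗[k] L →ₗ[k] L) : L ⊗[k] L →ₗ[k] L ⊗[k] L :=
  LinearMap.rTensor L br ∘ₗ (TensorProduct.assoc k L L L).symm.toLinearMap ∘ₗ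
    LinearMap.lTensor L Ψ ∘ₗ (TensorProduct.assoc k L L L).toLinearMap ∘ₗ
    LinearMap.rTensor L Δ

/-- A (left) braided Lie algebra in the braided category of right `A`-comodules: a coalgebra in
the category with a bracket, all structure maps being colinear. -/
structure BraidedLieAlgebra (r : A ⊗[k] A →ₗ[k] k) (L : Type w) [AddCommGroup L] [Module k L]
    extends RightComodule k A L, Coalgebra k L where
  bracket : L ⊗[k] L →ₗ[k] L
  comul_colinear :
    tensorCoactR coact coact ∘ₗ comul = LinearMap.rTensor A comul ∘ₗ coact
  counit_colinear : ∀ x, LinearMap.rTensor A counit (coact x) = counit x ⊗ₜ[k] 1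
  bracket_colinear :
    coact ∘ₗ bracket = LinearMap.rTensor A bracket ∘ₗ tensorCoactR coact coact
  /-- Braided Jacobi identity
  `[ , ](id ⊗ [ , ]) = [ , ]([ , ] ⊗ [ , ])(id ⊗ Ψ ⊗ id)(Δ ⊗ id ⊗ id)`. -/
  jacobi : bracket ∘ₗ LinearMap.lTensor L bracket =
    bracket ∘ₗ TensorProduct.map bracket bracket ∘ₗ mid (braidR r coact coact) ∘ₗ
      LinearMap.rTensor (L ⊗[k] L) comul
  /-- Weak braided cocommutativity
  `Ψ ([ , ] ⊗ id)(id ⊗ Ψ)(Δ ⊗ id) = (id ⊗ [ , ])(Δ ⊗ id)`. -/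
  weak_cocomm :
    braidR r coact coact ∘ₗ canonicalBraid comul (braidR r coact coact) bracket =
    LinearMap.lTensor L bracket ∘ₗ (TensorProduct.assoc k L L L).toLinearMap ∘ₗ
      LinearMap.rTensor L comul
  /-- The bracket is a coalgebra map from the braided tensor square. -/
  bracket_comul : comul ∘ₗ bracket =
    TensorProduct.map bracket bracket ∘ₗ mid (braidR r coact coact) ∘ₗ
      TensorProduct.map comul comul
  bracket_counit : ∀ x y, counit (bracket (x ⊗ₜ y)) = counit x * counit y

namespace BraidedLieAlgebra

variable {r : A ⊗[k] A →ₗ[k] k} {L M : Type*} [AddCommGroup L] [Module k L]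
  [AddCommGroup M] [Module k M]

/-- `c = η(1)` for a unit `η : k → L`, a morphism of braided Lie algebras with
`[c, z] = z` and `[z, c] = ε(z) c`. -/
structure IsUnit (𝓛 : BraidedLieAlgebra r L) (c : L) : Prop where
  colinear : 𝓛.coact c = c ⊗ₜ 1
  comul : 𝓛.comul c = c ⊗ₜ c
  counit : 𝓛.counit c = 1
  bracket_left : ∀ z, 𝓛.bracket (c ⊗ₜ z) = z
  bracket_right : ∀ z, 𝓛.bracket (z ⊗ₜ c) = 𝓛.counit z • c

/-- Morphisms of braided Lie algebras in right comodules. -/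
structure IsHom (𝓜 : BraidedLieAlgebra r M) (𝓛 : BraidedLieAlgebra r L) (f : M →ₗ[k] L) :
    Prop where
  colinear : 𝓛.coact ∘ₗ f = LinearMap.rTensor A f ∘ₗ 𝓜.coact
  comul : 𝓛.comul ∘ₗ f = TensorProduct.map f f ∘ₗ 𝓜.comul
  counit : 𝓛.counit ∘ₗ f = 𝓜.counit
  bracket : 𝓛.bracket ∘ₗ TensorProduct.map f f = f ∘ₗ 𝓜.bracket

/-- The canonical braiding `Υ` of a braided Lie algebra. -/
def upsilon (𝓛 : BraidedLieAlgebra r L) : L ⊗[k] L →ₗ[k] L ⊗[k] L :=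
  canonicalBraid 𝓛.comul (braidR r 𝓛.coact 𝓛.coact) 𝓛.bracket

end BraidedLieAlgebra

/-! ### Enveloping algebras -/

/-- The embedding of `V ⊗ V` as the degree two part of the tensor algebra of `V`. -/
def deg2 (V : Type w) [AddCommGroup V] [Module k V] : V ⊗[k] V →ₗ[k] TensorAlgebra k V :=
  LinearMap.mul' k (TensorAlgebra k V) ∘ₗ
    TensorProduct.map (TensorAlgebra.ι k) (TensorAlgebra.ι k)

/-- Defining relations `t = Υ(t)` of the braided enveloping algebra. -/
inductive BraidedLieAlgebra.EnvRel {r : A ⊗[k] A →ₗ[k] k} {L : Type w} [AddCommGroup L]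
    [Module k L] (𝓛 : BraidedLieAlgebra r L) : TensorAlgebra k L → TensorAlgebra k L → Prop
  | mk (t : L ⊗[k] L) : EnvRel 𝓛 (deg2 L t) (deg2 L (𝓛.upsilon t))

/-- The braided enveloping algebra `B(L) = T(L)/⟨im(id - Υ)⟩`. -/
abbrev BraidedLieAlgebra.Env {r : A ⊗[k] A →ₗ[k] k} {L : Type w} [AddCommGroup L]
    [Module k L] (𝓛 : BraidedLieAlgebra r L) : Type (max u w) :=
  RingQuot 𝓛.EnvRel

/-- The canonical map `L → B(L)`. -/
def BraidedLieAlgebra.envι {r : A ⊗[k] A →ₗ[k] k} {L : Type w} [AddCommGroup L]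
    [Module k L] (𝓛 : BraidedLieAlgebra r L) : L →ₗ[k] 𝓛.Env :=
  (RingQuot.mkAlgHom k 𝓛.EnvRel).toLinearMap ∘ₗ TensorAlgebra.ι k

/-- The single relation `c = 1` in `B(L)`. -/
inductive BraidedLieAlgebra.UnitRel {r : A ⊗[k] A →ₗ[k] k} {L : Type w} [AddCommGroup L]
    [Module k L] (𝓛 : BraidedLieAlgebra r L) (c : L) : 𝓛.Env → 𝓛.Env → Prop
  | mk : UnitRel 𝓛 c (𝓛.envι c) 1

/-- The quotient `B(L)/⟨c - 1⟩`. -/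
abbrev BraidedLieAlgebra.EnvUnit {r : A ⊗[k] A →ₗ[k] k} {L : Type w} [AddCommGroup L]
    [Module k L] (𝓛 : BraidedLieAlgebra r L) (c : L) : Type (max u w) :=
  RingQuot (𝓛.UnitRel c)

/-- Defining relations `t = σ(t) + [t]` of the enveloping algebra of a quantum Lie algebra. -/
inductive QEnvRel {g : Type w} [AddCommGroup g] [Module k g] (σ : g ⊗[k] g →ₗ[k] g ⊗[k] g)
    (br : g ⊗[k] g →ₗ[k] g) : TensorAlgebra k g → TensorAlgebra k g → Prop
  | mk (t : g ⊗[k] g) : QEnvRel σ br (deg2 g t) (deg2 g (σ t) + TensorAlgebra.ι k (br t))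

/-- The universal enveloping algebra `U(g) = T(g)/⟨im(id - σ - [ , ])⟩` of a quantum Lie algebra
`(g, σ, [ , ])`. -/
abbrev QEnv {g : Type w} [AddCommGroup g] [Module k g] (σ : g ⊗[k] g →ₗ[k] g ⊗[k] g)
    (br : g ⊗[k] g →ₗ[k] g) : Type (max u w) :=
  RingQuot (QEnvRel σ br)

/-- The canonical map `g → U(g)`. -/
def qenvι {g : Type w} [AddCommGroup g] [Module k g] (σ : g ⊗[k] g →ₗ[k] g ⊗[k] g)
    (br : g ⊗[k] g →ₗ[k] g) : g →ₗ[k] QEnv σ br :=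
  (RingQuot.mkAlgHom k (QEnvRel σ br)).toLinearMap ∘ₗ TensorAlgebra.ι k

/-! ### Bialgebras in the braided category of right comodules -/

/-- A bialgebra structure, in the braided category of right `A`-comodules, on the `k`-algebra
`B`. -/
structure BraidedBialgebra (r : A ⊗[k] A →ₗ[k] k) (B : Type w) [Ring B] [Algebra k B]
    extends RightComodule k A B, Coalgebra k B where
  mul_colinear : coact ∘ₗ LinearMap.mul' k B =
    LinearMap.rTensor A (LinearMap.mul' k B) ∘ₗ tensorCoactR coact coact
  one_colinear : coact 1 = 1 ⊗ₜ 1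
  comul_colinear :
    tensorCoactR coact coact ∘ₗ comul = LinearMap.rTensor A comul ∘ₗ coact
  counit_colinear : ∀ x, LinearMap.rTensor A counit (coact x) = counit x ⊗ₜ[k] 1
  /-- The comultiplication is multiplicative for the braided product on `B ⊗ B`. -/
  comul_mul : comul ∘ₗ LinearMap.mul' k B =
    TensorProduct.map (LinearMap.mul' k B) (LinearMap.mul' k B) ∘ₗ
      mid (braidR r coact coact) ∘ₗ TensorProduct.map comul comul
  comul_one : comul 1 = 1 ⊗ₜ 1
  counit_mul : ∀ x y, counit (x * y) = counit x * counit y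
  counit_one : counit 1 = 1

namespace BraidedBialgebra

variable {r : A ⊗[k] A →ₗ[k] k} {B B' : Type*} [Ring B] [Algebra k B] [Ring B'] [Algebra k B']

/-- `f : L → B` is a morphism of coalgebras in right comodules; in particular the bialgebra
structure of `B` extends the coalgebra structure of `L` along `f`. -/
structure Extends (𝓑 : BraidedBialgebra r B) {L : Type*} [AddCommGroup L] [Module k L]
    (𝓛 : BraidedLieAlgebra r L) (f : L →ₗ[k] B) : Prop where
  colinear : 𝓑.coact ∘ₗ f = LinearMap.rTensor A f ∘ₗ 𝓛.coact
  comul : 𝓑.comul ∘ₗ f = TensorProduct.map f f ∘ₗ 𝓛.comul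
  counit : 𝓑.counit ∘ₗ f = 𝓛.counit

/-- The algebra map `f` is a morphism of bialgebras in right comodules. -/
structure IsHom (𝓑 : BraidedBialgebra r B) (𝓑' : BraidedBialgebra r B') (f : B →ₐ[k] B') :
    Prop where
  colinear : 𝓑'.coact ∘ₗ f.toLinearMap = LinearMap.rTensor A f.toLinearMap ∘ₗ 𝓑.coact
  comul : 𝓑'.comul ∘ₗ f.toLinearMap =
    TensorProduct.map f.toLinearMap f.toLinearMap ∘ₗ 𝓑.comul
  counit : 𝓑'.counit ∘ₗ f.toLinearMap = 𝓑.counit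

end BraidedBialgebra

/-! ### Hopf bimodules and bicovariant first order differential calculi -/

variable (k A) in
/-- Two-sided actions and coactions of `A` on `Γ` (no axioms). -/
structure BiData (Γ : Type w) [AddCommGroup Γ] [Module k Γ] where
  /-- left action -/
  lact : A ⊗[k] Γ →ₗ[k] Γ
  /-- right action -/
  ract : Γ ⊗[k] A →ₗ[k] Γ
  /-- left coaction -/
  lco : Γ →ₗ[k] A ⊗[k] Γ
  /-- right coaction -/
  rco : Γ →ₗ[k] Γ ⊗[k] A

namespace BiData

variable {Γ : Type w} [AddCommGroup Γ] [Module k Γ] (X : BiData k A Γ)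

/-- The axioms of a Hopf bimodule. -/
structure IsHopfBimodule : Prop where
  one_lact : ∀ v, X.lact (1 ⊗ₜ v) = v
  mul_lact : ∀ a b v, X.lact ((a * b) ⊗ₜ v) = X.lact (a ⊗ₜ X.lact (b ⊗ₜ v))
  ract_one : ∀ v, X.ract (v ⊗ₜ 1) = v
  ract_mul : ∀ v a b, X.ract (v ⊗ₜ (a * b)) = X.ract (X.ract (v ⊗ₜ a) ⊗ₜ b)
  lact_ract : ∀ a v b, X.ract (X.lact (a ⊗ₜ v) ⊗ₜ b) = X.lact (a ⊗ₜ X.ract (v ⊗ₜ b))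
  lco_coassoc : (TensorProduct.assoc k A A Γ).toLinearMap ∘ₗ
    LinearMap.rTensor Γ Coalgebra.comul ∘ₗ X.lco = LinearMap.lTensor A X.lco ∘ₗ X.lco
  lco_counit : ∀ v, LinearMap.rTensor Γ Coalgebra.counit (X.lco v) = (1 : k) ⊗ₜ[k] v
  rco_coassoc : (TensorProduct.assoc k Γ A A).toLinearMap ∘ₗ
    LinearMap.rTensor A X.rco ∘ₗ X.rco = LinearMap.lTensor Γ Coalgebra.comul ∘ₗ X.rco
  rco_counit : ∀ v, LinearMap.lTensor Γ Coalgebra.counit (X.rco v) = v ⊗ₜ[k] (1 : k)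
  lco_rco : (TensorProduct.assoc k A Γ A).toLinearMap ∘ₗ LinearMap.rTensor A X.lco ∘ₗ X.rco =
    LinearMap.lTensor A X.rco ∘ₗ X.lco
  /-- `Δ_L(a v) = Δ(a) Δ_L(v)` -/
  lco_lact : X.lco ∘ₗ X.lact = TensorProduct.map (LinearMap.mul' k A) X.lact ∘ₗ swapMid ∘ₗ
    TensorProduct.map Coalgebra.comul X.lco
  /-- `Δ_L(v a) = Δ_L(v) Δ(a)` -/
  lco_ract : X.lco ∘ₗ X.ract = TensorProduct.map (LinearMap.mul' k A) X.ract ∘ₗ swapMid ∘ₗ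
    TensorProduct.map X.lco Coalgebra.comul
  /-- `Δ_R(a v) = Δ(a) Δ_R(v)` -/
  rco_lact : X.rco ∘ₗ X.lact = TensorProduct.map X.lact (LinearMap.mul' k A) ∘ₗ swapMid ∘ₗ
    TensorProduct.map Coalgebra.comul X.rco
  /-- `Δ_R(v a) = Δ_R(v) Δ(a)` -/
  rco_ract : X.rco ∘ₗ X.ract = TensorProduct.map X.ract (LinearMap.mul' k A) ∘ₗ swapMid ∘ₗ
    TensorProduct.map X.rco Coalgebra.comul

/-- A bicovariant first order differential calculus `(Γ, d)` over `A`. -/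
structure IsBicovariantFODC (d : A →ₗ[k] Γ) : Prop extends X.IsHopfBimodule where
  leibniz : ∀ a b, d (a * b) = X.ract (d a ⊗ₜ b) + X.lact (a ⊗ₜ d b)
  d_lco : X.lco ∘ₗ d = LinearMap.lTensor A d ∘ₗ Coalgebra.comul
  d_rco : X.rco ∘ₗ d = LinearMap.rTensor A d ∘ₗ Coalgebra.comul
  surj : Function.Surjective (X.lact ∘ₗ LinearMap.lTensor A d)

/-- The right invariants `Γ_R = {η | Δ_R(η) = η ⊗ 1}`. -/
def rightInv : Submodule k Γ :=
  LinearMap.eqLocus X.rco ((TensorProduct.mk k Γ A).flip 1)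

/-- `θ` is biinvariant: `Δ_L(θ) = 1 ⊗ θ` and `Δ_R(θ) = θ ⊗ 1`. -/
def IsBiinvariant (θ : Γ) : Prop :=
  X.lco θ = 1 ⊗ₜ θ ∧ X.rco θ = θ ⊗ₜ 1

/-- The adjoint action `a ⊗ v ↦ a ▷ v = a₁ v S(a₂)`. -/
def adAct : A ⊗[k] Γ →ₗ[k] Γ :=
  X.ract ∘ₗ TensorProduct.map X.lact (HopfAlgebra.antipode k) ∘ₗ
    (TensorProduct.assoc k A Γ A).symm.toLinearMap ∘ₗ
    LinearMap.lTensor A (TensorProduct.comm k A Γ).toLinearMap ∘ₗ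
    (TensorProduct.assoc k A A Γ).toLinearMap ∘ₗ
    LinearMap.rTensor Γ Coalgebra.comul

/-- The extended bimodule `Γ ⊕ Θ·A` of `(Γ, d)`, with `(v, c)` standing for `v + Θ c`: it is the
direct sum as a right module, `Θ` is biinvariant and `a Θ = da + Θ a`. -/
def ext (d : A →ₗ[k] Γ) : BiData k A (Γ × A) where
  lact := TensorProduct.lift
    { toFun := fun a =>
        LinearMap.prod
          (LinearMap.coprod (TensorProduct.curry X.lact a) (TensorProduct.curry X.ract (d a)))
          (LinearMap.mul k A a ∘ₗ LinearMap.snd k Γ A)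
      map_add' := by
        intro a b
        ext <;> simp
      map_smul' := by
        intro t a
        ext <;> simp }
  ract := LinearMap.prod
    (X.ract ∘ₗ LinearMap.rTensor A (LinearMap.fst k Γ A))
    (LinearMap.mul' k A ∘ₗ LinearMap.rTensor A (LinearMap.snd k Γ A))
  lco := LinearMap.coprod
    (LinearMap.lTensor A (LinearMap.inl k Γ A) ∘ₗ X.lco)
    (LinearMap.lTensor A (LinearMap.inr k Γ A) ∘ₗ Coalgebra.comul)
  rco := LinearMap.coprod
    (LinearMap.rTensor A (LinearMap.inl k Γ A) ∘ₗ X.rco)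
    (LinearMap.rTensor A (LinearMap.inr k Γ A) ∘ₗ Coalgebra.comul)

/-- The extended Maurer-Cartan map `ω̃_R(a) = a ▷ Θ`. -/
def extOmega (d : A →ₗ[k] Γ) : A →ₗ[k] Γ × A :=
  (X.ext d).adAct ∘ₗ (TensorProduct.mk k A (Γ × A)).flip ((0 : Γ), (1 : A))

/-- The extended cotangent space: the right invariants of the extended bimodule. -/
abbrev extCotangent (d : A →ₗ[k] Γ) : Submodule k (Γ × A) :=
  (X.ext d).rightInv

/-- The ideal `I_Γ = ker ω̃_R` associated to the calculus. -/
def ideal (d : A →ₗ[k] Γ) : Submodule k A :=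
  LinearMap.ker (X.extOmega d)

/-- The extended tangent space `{X ∈ A^* | X(I_Γ) = 0}`. -/
def extTangent (d : A →ₗ[k] Γ) : Submodule k (Module.Dual k A) :=
  (X.ideal d).dualAnnihilator

/-- The tangent space `{x ∈ A^* | x(I_Γ) = 0, x(1) = 0}`. -/
def tangent (d : A →ₗ[k] Γ) : Submodule k (Module.Dual k A) :=
  X.extTangent d ⊓ LinearMap.ker (LinearMap.applyₗ (1 : A))

/-- The inclusion of the tangent space in the extended tangent space. -/
def tangentIncl (d : A →ₗ[k] Γ) : X.tangent d →ₗ[k] X.extTangent d :=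
  Submodule.inclusion inf_le_left

/-- The orthogonal `v^⊥ ⊆ A^*` of `v` in the extended tangent space with respect to a bilinear
form on (extended bimodule) × (extended tangent space). -/
def orth {d : A →ₗ[k] Γ} (β : (Γ × A) →ₗ[k] X.extTangent d →ₗ[k] k) (v : Γ × A) :
    Submodule k (Module.Dual k A) :=
  (LinearMap.ker (β v)).map (X.extTangent d).subtype

theorem orth_le {d : A →ₗ[k] Γ} (β : (Γ × A) →ₗ[k] X.extTangent d →ₗ[k] k) (v : Γ × A) :
    X.orth β v ≤ X.extTangent d :=
  Submodule.map_subtype_le _ _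

/-- The inclusion of `v^⊥` in the extended tangent space. -/
def orthIncl {d : A →ₗ[k] Γ} (β : (Γ × A) →ₗ[k] X.extTangent d →ₗ[k] k) (v : Γ × A) :
    X.orth β v →ₗ[k] X.extTangent d :=
  Submodule.inclusion (X.orth_le β v)

/-- `br` is the quantum Lie bracket of the tangent space, `[x, y] = x₁ y S(x₂)`, that is
`[x, y](a) = x(a₁ S(a₃)) y(a₂)`. -/
def IsTangentBracket (d : A →ₗ[k] Γ) (br : X.tangent d ⊗[k] X.tangent d →ₗ[k] X.tangent d) :
    Prop :=
  ∀ (t : X.tangent d ⊗[k] X.tangent d) (a : A),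
    (br t : Module.Dual k A) a = pair₂ (X.tangent d) t (adL a)

/-- `σ` is the crossed module braiding of the tangent space,
`σ(x ⊗ y) = [x₁, y] ⊗ x₂ - [x, y] ⊗ ε`, that is
`⟨a ⊗ b, σ(x ⊗ y)⟩ = x(a₁ S(a₃) b) y(a₂) - x(a₁ S(a₃)) y(a₂) ε(b)`. -/
def IsTangentBraiding (d : A →ₗ[k] Γ)
    (σ : X.tangent d ⊗[k] X.tangent d →ₗ[k] X.tangent d ⊗[k] X.tangent d) : Prop :=
  ∀ (t : X.tangent d ⊗[k] X.tangent d) (a b : A),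
    pair₂ (X.tangent d) (σ t) (a ⊗ₜ b) =
      pair₂ (X.tangent d) t (LinearMap.rTensor A (LinearMap.mulRight k b) (adL a)) -
        pair₂ (X.tangent d) t (adL a) * Coalgebra.counit (R := k) b

/-- The structure maps of the extended tangent space obtained by transposing those of the
braided group of `A`: the coaction is dual to `ad_L`, the comultiplication to the covariantised
product, the bracket to `ad_L` seen as a cobracket (so `[X, Y] = X₁ Y S(X₂)`), and the counit is
evaluation at `1`. -/
structure IsDualStructure (r : A ⊗[k] A →ₗ[k] k) (d : A →ₗ[k] Γ)
    (𝓛 : BraidedLieAlgebra r (X.extTangent d)) : Prop where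
  coact : ∀ (x : X.extTangent d) (a : A),
    TensorProduct.lid k A (LinearMap.rTensor A
        (LinearMap.applyₗ a ∘ₗ (X.extTangent d).subtype) (𝓛.coact x)) =
      TensorProduct.rid k A (LinearMap.lTensor A (x : Module.Dual k A) (adL a))
  comul : ∀ (x : X.extTangent d) (t : A ⊗[k] A),
    pair₂ (X.extTangent d) (𝓛.comul x) t = (x : Module.Dual k A) (uMul r t)
  counit : ∀ x : X.extTangent d, 𝓛.counit x = (x : Module.Dual k A) 1
  bracket : ∀ (t : X.extTangent d ⊗[k] X.extTangent d) (a : A),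
    (𝓛.bracket t : Module.Dual k A) a = pair₂ (X.extTangent d) t (adL a)

end BiData

end Hopf

end BraidedLie

end

noncomputable section

set_option linter.unusedSectionVars false
set_option linter.unusedSimpArgs false

namespace BraidedLie

/-! ### Sweedler calculus -/

/-! The work is done on `A` itself, with the adjoint coaction b ↦ b⁽⁻¹⁾ ⊗ b⁽⁰⁾ and the action c ▷ b
= r(b⁽⁻¹⁾, c) b⁽⁰⁾. The covariantised product is a · b = a₁ (S(a₂) ▷ b). One identity drives the
computations: c₁ · (c₂ ▷ w) = c w (`sw_uMul_act`), by which `r` cancels. It makes `A` with this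
product and cobracket ad_L a braided Lie coalgebra (`braidedGroup`), and it reduces (μ ⊗ id)(id ⊗
Ψ)(δ ⊗ id) to a ⊗ b ↦ a⁽⁻¹⁾ b ⊗ a⁽⁰⁾ (`adBraid`), where `r` no longer occurs.

Cotangent space: a db = (ab)Θ − aΘb, and the projection to right invariants sends aΘb to ε(b) a ▷ Θ,
so the Maurer-Cartan map is onto. Its kernel is a left ideal and an adjoint subcomodule. The
defining formula for a · b and the flipped formula r(b₁, a⁽⁻¹⁾) b₂ a⁽⁰⁾ (`uMul_eq`) show that such a
kernel is a two-sided ideal for the covariantised product, so the whole structure descends.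

Tangent space: finite dimensionality provides a finite dual basis, with which the coaction and the
product can be transposed. Functionals are separated by `A`, so every axiom follows from the
transposed axiom on `A`. The canonical braiding Υ is the transpose of `adBraid`, which is a colinear
algebra map of the braided tensor square. Hence Υ is a colinear coalgebra map, and coaction,
coproduct and counit extend from the generators to B(L). They respect γ = 1 because γ is
coinvariant, grouplike and of counit one.

Presentation: Υ(γ ⊗ x) = x ⊗ γ and Υ(x ⊗ γ) = γ ⊗ x, so after γ = 1 only the relations on a
complement N of kγ survive. If Υ = σ + [ , ] ⊗ γ on N ⊗ N, they are the quantum Lie relations of (N,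
σ, [ , ]) (`IsComplement.exists_equiv`). The functionals vanishing at 1 form such a complement,
which gives U(g).

Inner case: Θ − θ is biinvariant and central, hence the class of some u with ε(u) = 1 on which
covariantised multiplication by a, from either side, is multiplication by ε(a). Its orthogonal is
therefore closed under all operations and complementary to γ, with zero bracket term, and the same
presentation argument identifies its enveloping algebra with the quotient. -/

/-- Unbundled linearity, in the form used by `fun_prop`. -/
@[fun_prop]
structure Lin (k : Type*) {M N : Type*} [Semiring k] [AddCommMonoid M] [Module k M]
    [AddCommMonoid N] [Module k N] (f : M → N) : Prop where
  map_add : ∀ x y, f (x + y) = f x + f y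
  map_smul : ∀ (c : k) x, f (c • x) = c • f x

section Lin

variable {k : Type*} [Field k]
variable {M N P Q P' Q' : Type*} [AddCommMonoid M] [Module k M] [AddCommMonoid N] [Module k N]
  [AddCommMonoid P] [Module k P] [AddCommMonoid Q] [Module k Q]
  [AddCommMonoid P'] [Module k P'] [AddCommMonoid Q'] [Module k Q']

@[fun_prop]
theorem Lin.id : Lin k (fun x : M => x) := ⟨fun _ _ => rfl, fun _ _ => rfl⟩

@[fun_prop]
theorem Lin.comp {g : N → P} {f : M → N} (hg : Lin k g) (hf : Lin k f) :
    Lin k (fun x => g (f x)) :=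
  ⟨fun x y => by rw [hf.map_add, hg.map_add], fun x y => by rw [hf.map_smul, hg.map_smul]⟩

@[fun_prop]
theorem Lin.linearMap (g : N →ₗ[k] P) : Lin k (fun x => g x) := ⟨g.map_add, g.map_smul⟩

@[fun_prop]
theorem Lin.tmul_right {f : M → N} (hf : Lin k f) (p : P) : Lin k (fun x => f x ⊗ₜ[k] p) :=
  ⟨fun x y => by rw [hf.map_add, TensorProduct.add_tmul],
    fun x y => by rw [hf.map_smul, TensorProduct.smul_tmul']⟩

@[fun_prop]
theorem Lin.tmul_left {f : M → N} (hf : Lin k f) (p : P) : Lin k (fun x => p ⊗ₜ[k] f x) :=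
  ⟨fun x y => by rw [hf.map_add, TensorProduct.tmul_add],
    fun x y => by rw [hf.map_smul, TensorProduct.tmul_smul]⟩

@[fun_prop]
theorem Lin.mul_right {B : Type*} [Semiring B] [Algebra k B] {f : M → B} (hf : Lin k f) (p : B) :
    Lin k (fun x => f x * p) :=
  ⟨fun x y => by rw [hf.map_add, add_mul], fun x y => by rw [hf.map_smul, smul_mul_assoc]⟩

@[fun_prop]
theorem Lin.mul_left {B : Type*} [Semiring B] [Algebra k B] {f : M → B} (hf : Lin k f) (p : B) :
    Lin k (fun x => p * f x) :=
  ⟨fun x y => by rw [hf.map_add, mul_add], fun x y => by rw [hf.map_smul, mul_smul_comm]⟩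

@[fun_prop]
theorem Lin.smul_right {f : M → k} (hf : Lin k f) (p : P) : Lin k (fun x => f x • p) :=
  ⟨fun x y => by rw [hf.map_add, add_smul], fun x y => by rw [hf.map_smul, smul_assoc]⟩

@[fun_prop]
theorem Lin.smul_left {f : M → N} (hf : Lin k f) (p : k) : Lin k (fun x => p • f x) :=
  ⟨fun x y => by rw [hf.map_add, smul_add], fun x y => by rw [hf.map_smul, smul_comm]⟩

@[fun_prop]
theorem Lin.prod_inl {f : M → N} (hf : Lin k f) : Lin k (fun x => (f x, (0 : P))) :=
  ⟨fun x y => by rw [hf.map_add, Prod.mk_add_mk, add_zero],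
    fun x y => by rw [hf.map_smul, Prod.smul_mk, smul_zero]⟩

@[fun_prop]
theorem Lin.prod_inr {f : M → N} (hf : Lin k f) : Lin k (fun x => ((0 : P), f x)) :=
  ⟨fun x y => by rw [hf.map_add, Prod.mk_add_mk, add_zero],
    fun x y => by rw [hf.map_smul, Prod.smul_mk, smul_zero]⟩

/-- The Sweedler sum `Σ f v₁ v₂` over a decomposition `δ v = Σ v₁ ⊗ v₂`. -/
def sw {V : Type*} [AddCommMonoid V] [Module k V] (δ : V →ₗ[k] P ⊗[k] Q) (v : V)
    (f : P → Q → M) : M :=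
  ∑ p ∈ (TensorProduct.exists_finset (δ v)).choose, f p.1 p.2

variable {V V' : Type*} [AddCommMonoid V] [Module k V] [AddCommMonoid V'] [Module k V']

theorem eq_sw (δ : V →ₗ[k] P ⊗[k] Q) (v : V) : δ v = sw δ v (fun p q => p ⊗ₜ[k] q) :=
  (TensorProduct.exists_finset (δ v)).choose_spec

/-- No linearity is needed: both sides are double sums over the same two chosen finite sets. -/
theorem sw_comm (δ : V →ₗ[k] P ⊗[k] Q) (δ' : V' →ₗ[k] P' ⊗[k] Q') (s : V) (t : V')
    (f : P → Q → P' → Q' → M) :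
    sw δ s (fun p q => sw δ' t (f p q)) = sw δ' t (fun p' q' => sw δ s fun p q => f p q p' q') :=
  Finset.sum_comm

theorem map_sw (δ : V →ₗ[k] P ⊗[k] Q) (v : V) (f : P → Q → M) (g : M →ₗ[k] N) :
    g (sw δ v f) = sw δ v fun p q => g (f p q) := map_sum _ _ _

theorem mapEquiv_sw (δ : V →ₗ[k] P ⊗[k] Q) (v : V) (f : P → Q → M) (g : M ≃ₗ[k] N) :
    g (sw δ v f) = sw δ v fun p q => g (f p q) := map_sum _ _ _

theorem Lin.map_sw {g : M → N} (hg : Lin k g) (δ : V →ₗ[k] P ⊗[k] Q) (v : V) (f : P → Q → M) :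
    g (sw δ v f) = sw δ v fun p q => g (f p q) :=
  BraidedLie.map_sw δ v f { toFun := g, map_add' := hg.map_add, map_smul' := hg.map_smul }

theorem sw_tmul (δ : V →ₗ[k] P ⊗[k] Q) (v : V) (f : P → Q → M) (n : N) :
    sw δ v f ⊗ₜ[k] n = sw δ v fun p q => f p q ⊗ₜ[k] n := TensorProduct.sum_tmul _ _ _

theorem tmul_sw (δ : V →ₗ[k] P ⊗[k] Q) (v : V) (f : P → Q → M) (n : N) :
    n ⊗ₜ[k] sw δ v f = sw δ v fun p q => n ⊗ₜ[k] f p q := TensorProduct.tmul_sum _ _ _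

theorem sw_mul_const {B : Type*} [Semiring B] [Algebra k B] (δ : V →ₗ[k] P ⊗[k] Q) (v : V)
    (f : P → Q → B) (n : B) :
    sw δ v f * n = sw δ v fun p q => f p q * n := Finset.sum_mul _ _ _

theorem const_mul_sw {B : Type*} [Semiring B] [Algebra k B] (δ : V →ₗ[k] P ⊗[k] Q) (v : V)
    (f : P → Q → B) (n : B) :
    n * sw δ v f = sw δ v fun p q => n * f p q := Finset.mul_sum _ _ _

theorem sw_smul (δ : V →ₗ[k] P ⊗[k] Q) (v : V) (f : P → Q → k) (n : N) :
    sw δ v f • n = sw δ v fun p q => f p q • n := Finset.sum_smul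

theorem smul_sw (δ : V →ₗ[k] P ⊗[k] Q) (v : V) (f : P → Q → M) (c : k) :
    c • sw δ v f = sw δ v fun p q => c • f p q := Finset.smul_sum

theorem sw_add (δ : V →ₗ[k] P ⊗[k] Q) (v : V) (f g : P → Q → M) :
    (sw δ v fun p q => f p q + g p q) = sw δ v f + sw δ v g := Finset.sum_add_distrib

theorem sw_congr {δ : V →ₗ[k] P ⊗[k] Q} {v : V} {f g : P → Q → M} (h : ∀ p q, f p q = g p q) :
    sw δ v f = sw δ v g := by
  congr; funext p q; exact h p q

/-- A bilinear function as a linear map on the tensor product. -/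
def liftLin (f : P → Q → M) (h1 : ∀ q, Lin k fun p => f p q) (h2 : ∀ p, Lin k fun q => f p q) :
    P ⊗[k] Q →ₗ[k] M :=
  TensorProduct.lift (LinearMap.mk₂ k f
    (fun x y z => (h1 z).map_add x y) (fun c x z => (h1 z).map_smul c x)
    (fun x y z => (h2 x).map_add y z) (fun c x z => (h2 x).map_smul c z))

theorem liftLin_tmul (f : P → Q → M) (h1 : ∀ q, Lin k fun p => f p q)
    (h2 : ∀ p, Lin k fun q => f p q) (p : P) (q : Q) :
    liftLin f h1 h2 (p ⊗ₜ q) = f p q := rfl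

/-- The decomposition behind `sw` is an arbitrary choice; bilinearity of `f` makes the value depend
on the tensor alone. This is the source of the linearity hypotheses carried by the later `sw`
lemmas. -/
theorem sw_eq_liftLin (δ : V →ₗ[k] P ⊗[k] Q) (v : V) (f : P → Q → M)
    (h1 : ∀ q, Lin k fun p => f p q) (h2 : ∀ p, Lin k fun q => f p q) :
    sw δ v f = liftLin f h1 h2 (δ v) := by
  conv_rhs => rw [eq_sw δ v, map_sw]
  rfl

/-- Sweedler sums only depend on the tensor that is decomposed. -/
theorem sw_eq_of_eq {δ : V →ₗ[k] P ⊗[k] Q} {δ' : V' →ₗ[k] P ⊗[k] Q} {v : V} {v' : V'}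
    (h : δ v = δ' v') (f : P → Q → M)
    (h1 : ∀ q, Lin k fun p => f p q) (h2 : ∀ p, Lin k fun q => f p q) :
    sw δ v f = sw δ' v' f := by
  rw [sw_eq_liftLin δ v f h1 h2, sw_eq_liftLin δ' v' f h1 h2, h]

theorem sw_of_eq_tmul {δ : V →ₗ[k] P ⊗[k] Q} {v : V} {p : P} {q : Q}
    (h : δ v = p ⊗ₜ q) (f : P → Q → M)
    (h1 : ∀ q, Lin k fun p => f p q) (h2 : ∀ p, Lin k fun q => f p q) :
    sw δ v f = f p q := by
  rw [sw_eq_liftLin δ v f h1 h2, h, liftLin_tmul]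

@[fun_prop]
theorem Lin.sw_right (δ : V →ₗ[k] P ⊗[k] Q) (v : V) {f : M → P → Q → N}
    (hf : ∀ p q, Lin k (fun x => f x p q)) : Lin k (fun x => sw δ v (f x)) :=
  ⟨fun x y => by simp only [sw, (hf _ _).map_add, Finset.sum_add_distrib],
    fun x y => by simp only [sw, (hf _ _).map_smul, Finset.smul_sum]⟩

@[fun_prop]
theorem Lin.sw_left (δ : V →ₗ[k] P ⊗[k] Q) {g : M → V} (hg : Lin k g) (f : P → Q → N)
    (h1 : ∀ q, Lin k fun p => f p q) (h2 : ∀ p, Lin k fun q => f p q) :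
    Lin k (fun x => sw δ (g x) f) := by
  simp only [sw_eq_liftLin δ _ f h1 h2]
  fun_prop

theorem sw_sw (δ : V →ₗ[k] P ⊗[k] Q) (δ' : V' →ₗ[k] P' ⊗[k] Q') (v : V') (g : P' → Q' → V)
    (f : P → Q → M) (h1 : ∀ q, Lin k fun p => f p q) (h2 : ∀ p, Lin k fun q => f p q) :
    sw δ (sw δ' v g) f = sw δ' v fun p q => sw δ (g p q) f :=
  Lin.map_sw (g := fun v => sw δ v f) (by fun_prop) _ _ _

theorem sw_smul_arg (δ : V →ₗ[k] P ⊗[k] Q) (v : V) (c : k)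
    (f : P → Q → M) (h1 : ∀ q, Lin k fun p => f p q) (h2 : ∀ p, Lin k fun q => f p q) :
    sw δ (c • v) f = c • sw δ v f :=
  Lin.map_smul (f := fun v => sw δ v f) (by fun_prop) _ _

end Lin

/-! ### Coassociativity, counit and antipode in Sweedler sums. -/

section Coalg

variable {k : Type*} [Field k] {C : Type*} [AddCommMonoid C] [Module k C] [Coalgebra k C]
variable {M N : Type*} [AddCommMonoid M] [Module k M] [AddCommMonoid N] [Module k N]

local notation "Δ" => Coalgebra.comul (R := k)
local notation "ε" => Coalgebra.counit (R := k)

theorem sw_coassoc (a : C) (F : C → C → C → M) (h1 : ∀ y z, Lin k fun x => F x y z)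
    (h2 : ∀ x z, Lin k fun y => F x y z) (h3 : ∀ x y, Lin k fun z => F x y z) :
    (sw Δ a fun x z => sw Δ x fun x1 x2 => F x1 x2 z) =
      sw Δ a fun x1 t => sw Δ t fun x2 z => F x1 x2 z := by
  -- `F` is applied to coassociativity as a linear map. Linearity in the first variable has to be
  -- known at an arbitrary tensor in the other two, hence the induction.
  have h := congrArg (liftLin (fun x t => liftLin (F x) (h2 x) (h3 x) t)
    (fun q => by
      induction q using TensorProduct.induction_on with
      | zero => simp only [map_zero]; exact ⟨fun _ _ => by simp, fun _ _ => by simp⟩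
      | tmul y z => simpa only [liftLin_tmul] using h1 y z
      | add s t hs ht =>
        simp only [map_add]
        exact ⟨fun x y => by rw [hs.map_add, ht.map_add, add_add_add_comm],
          fun c x => by rw [hs.map_smul, ht.map_smul, smul_add]⟩)
    (fun x => by fun_prop)) (Coalgebra.coassoc_apply (R := k) a)
  rw [eq_sw Δ a] at h
  simp only [map_sw, mapEquiv_sw, LinearMap.rTensor_tmul, LinearMap.lTensor_tmul, liftLin_tmul,
    eq_sw Δ, sw_tmul, tmul_sw, TensorProduct.assoc_tmul] at h
  exact h

theorem sw_counit_left (a : C) (G : C → M) (h : Lin k G) :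
    (sw Δ a fun x y => ε x • G y) = G a := by
  have := congrArg (liftLin (fun (c : k) (y : C) => c • G y) (fun q => by fun_prop)
    (fun p => by fun_prop)) (Coalgebra.rTensor_counit_comul (R := k) a)
  rw [eq_sw Δ a] at this
  simpa only [map_sw, LinearMap.rTensor_tmul, liftLin_tmul, one_smul] using this

theorem sw_counit_right (a : C) (G : C → M) (h : Lin k G) :
    (sw Δ a fun x y => ε y • G x) = G a := by
  have := congrArg (liftLin (fun (y : C) (c : k) => c • G y) (fun q => by fun_prop)
    (fun p => by fun_prop)) (Coalgebra.lTensor_counit_comul (R := k) a)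
  rw [eq_sw Δ a] at this
  simpa only [map_sw, LinearMap.lTensor_tmul, liftLin_tmul, one_smul] using this

theorem sw_coassoc₃ (a : C) (F : C → C → C → C → M) (h1 : ∀ y z w, Lin k fun x => F x y z w)
    (h2 : ∀ x z w, Lin k fun y => F x y z w) (h3 : ∀ x y w, Lin k fun z => F x y z w)
    (h4 : ∀ x y z, Lin k fun w => F x y z w) :
    (sw Δ a fun x t => sw Δ t fun z w => sw Δ x fun x1 x2 => F x1 x2 z w) =
      sw Δ a fun x t => sw Δ t fun y t => sw Δ t fun z w => F x y z w := by
  rw [← sw_coassoc a (fun x y t => sw Δ t fun z w => F x y z w)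
    (by fun_prop) (by fun_prop) (by fun_prop)]
  refine sw_congr fun x t => ?_
  rw [sw_comm]

end Coalg

section Hopf

variable {k : Type*} {A : Type*} [Field k] [Ring A] [HopfAlgebra k A]
variable {M N : Type*} [AddCommMonoid M] [Module k M] [AddCommMonoid N] [Module k N]

local notation "Δ" => Coalgebra.comul (R := k)
local notation "ε" => Coalgebra.counit (R := k)
local notation "S" => HopfAlgebra.antipode k

theorem sw_mul (a b : A) (F : A → A → M) (h1 : ∀ y, Lin k fun x => F x y)
    (h2 : ∀ x, Lin k fun y => F x y) :
    sw Δ (a * b) F = sw Δ a fun a1 a2 => sw Δ b fun b1 b2 => F (a1 * b1) (a2 * b2) := by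
  rw [sw_eq_liftLin Δ (a * b) F h1 h2, Bialgebra.comul_mul, eq_sw Δ a, eq_sw Δ b]
  simp only [sw_mul_const, const_mul_sw, map_sw, Algebra.TensorProduct.tmul_mul_tmul, liftLin_tmul]
  rw [sw_comm]

theorem sw_one (F : A → A → M) (h1 : ∀ y, Lin k fun x => F x y)
    (h2 : ∀ x, Lin k fun y => F x y) : sw Δ (1 : A) F = F 1 1 :=
  sw_of_eq_tmul (Bialgebra.comul_one) F h1 h2

theorem sw_antipode_left (a : A) (G : A → M) (h : Lin k G) :
    (sw Δ a fun x y => G (S x * y)) = ε a • G 1 := by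
  have := HopfAlgebra.mul_antipode_rTensor_comul_apply (R := k) a
  rw [eq_sw Δ a] at this
  simp only [map_sw, LinearMap.rTensor_tmul, LinearMap.mul'_apply] at this
  rw [← h.map_sw, this, Algebra.algebraMap_eq_smul_one, h.map_smul]

theorem sw_antipode_right (a : A) (G : A → M) (h : Lin k G) :
    (sw Δ a fun x y => G (x * S y)) = ε a • G 1 := by
  have := HopfAlgebra.mul_antipode_lTensor_comul_apply (R := k) a
  rw [eq_sw Δ a] at this
  simp only [map_sw, LinearMap.lTensor_tmul, LinearMap.mul'_apply] at this
  rw [← h.map_sw, this, Algebra.algebraMap_eq_smul_one, h.map_smul]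

/-- The antipode is an anti-coalgebra map. -/
theorem sw_antipode (a : A) (F : A → A → M) (h1 : ∀ y, Lin k fun x => F x y)
    (h2 : ∀ x, Lin k fun y => F x y) :
    sw Δ (S a) F = sw Δ a fun x y => F (S y) (S x) := by
  -- Uniqueness of convolution inverses in Hom(A, A ⊗ A): `e1` says that a ↦ S(a₂) ⊗ S(a₁) is a left
  -- inverse of Δ, and `key` compares it with the right inverse Δ ∘ S.
  have e1 (c : A) : (sw Δ c fun x y => (sw Δ x fun p q => S q ⊗ₜ[k] S p) * Δ y) =
      ε c • (1 : A ⊗[k] A) := by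
    calc _ = sw Δ c fun p t => sw Δ t fun q y => sw Δ y fun u v =>
          (S q * u) ⊗ₜ[k] (S p * v) := by
          simp only [eq_sw Δ, sw_mul_const, const_mul_sw, Algebra.TensorProduct.tmul_mul_tmul]
          refine (sw_congr fun x y => sw_comm _ _ _ _ _).trans ?_
          rw [sw_coassoc c fun p q y => sw Δ y fun u v => (S q * u) ⊗ₜ[k] (S p * v)] <;> fun_prop
      _ = sw Δ c fun p t => (1 : A) ⊗ₜ[k] (S p * t) := by
          refine sw_congr fun p t => ?_
          rw [← sw_coassoc t fun q u v => (S q * u) ⊗ₜ[k] (S p * v)] <;> try fun_prop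
          simp_rw [fun (w v : A) => sw_antipode_left (k := k) w (fun z => z ⊗ₜ[k] (S p * v)) (by fun_prop)]
          rw [sw_counit_left t fun v => (1 : A) ⊗ₜ[k] (S p * v)]
          fun_prop
      _ = _ := by
          rw [sw_antipode_left c fun z => (1 : A) ⊗ₜ[k] z]
          · rfl
          · fun_prop
  have key : Δ (S a) = sw Δ a fun x y => S y ⊗ₜ[k] S x := by
    calc Δ (S a) = sw Δ a fun x y => ε x • Δ (S y) := by
          rw [sw_counit_left a fun y => Δ (S y)]; fun_prop
      _ = sw Δ a fun x y => sw Δ x fun x1 x2 =>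
            (sw Δ x1 fun p q => S q ⊗ₜ[k] S p) * Δ x2 * Δ (S y) := by
          refine sw_congr fun x y => ?_
          rw [← sw_mul_const, e1, smul_mul_assoc, one_mul]
      _ = sw Δ a fun x1 t => sw Δ t fun x2 y =>
            (sw Δ x1 fun p q => S q ⊗ₜ[k] S p) * Δ (x2 * S y) := by
          rw [sw_coassoc a fun x1 x2 y =>
            (sw Δ x1 fun p q => S q ⊗ₜ[k] S p) * Δ x2 * Δ (S y)] <;> try fun_prop
          simp only [mul_assoc, Bialgebra.comul_mul]
      _ = _ := by
          simp_rw [fun (x1 t : A) => sw_antipode_right (k := k) t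
            (fun z => (sw Δ x1 fun p q => S q ⊗ₜ[k] S p) * Δ z) (by fun_prop)]
          rw [sw_counit_right a fun x => (sw Δ x fun p q => S q ⊗ₜ[k] S p) * Δ 1]
          · rw [Bialgebra.comul_one, mul_one]
          · fun_prop
  rw [sw_eq_liftLin Δ (S a) F h1 h2, key]
  simp only [map_sw, liftLin_tmul]

end Hopf

section Evaluation

variable {k : Type*} [Field k]
variable {V P Q Q' P' W : Type*} [AddCommGroup V] [Module k V] [AddCommGroup P] [Module k P]
  [AddCommGroup Q] [Module k Q] [AddCommGroup Q'] [Module k Q'] [AddCommGroup P'] [Module k P']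
  [AddCommGroup W] [Module k W]

theorem swapMid_tmul (v : V) (p : P) (q : Q) (w : W) :
    swapMid ((v ⊗ₜ[k] p) ⊗ₜ[k] (q ⊗ₜ[k] w)) = (v ⊗ₜ q) ⊗ₜ (p ⊗ₜ w) := rfl

theorem mid_tmul (f : P ⊗[k] Q →ₗ[k] Q' ⊗[k] P') (v : V) (p : P) (q : Q) (w : W) :
    mid f ((v ⊗ₜ[k] p) ⊗ₜ[k] (q ⊗ₜ[k] w)) =
      sw f (p ⊗ₜ q) fun q' p' => (v ⊗ₜ q') ⊗ₜ (p' ⊗ₜ w) := by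
  simp only [mid, LinearMap.comp_apply, LinearEquiv.coe_coe, TensorProduct.assoc_tmul,
    LinearMap.lTensor_tmul, TensorProduct.assoc_symm_tmul, LinearMap.rTensor_tmul]
  rw [eq_sw f]
  simp only [sw_tmul, tmul_sw, map_sw, mapEquiv_sw, TensorProduct.assoc_tmul,
    TensorProduct.assoc_symm_tmul]

end Evaluation

section Hopf

variable {k : Type*} {A : Type*} [Field k] [Ring A] [HopfAlgebra k A]
variable {M N V W : Type*} [AddCommMonoid M] [Module k M] [AddCommMonoid N] [Module k N]
  [AddCommGroup V] [Module k V] [AddCommGroup W] [Module k W]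

local notation "Δ" => Coalgebra.comul (R := k)
local notation "ε" => Coalgebra.counit (R := k)
local notation "S" => HopfAlgebra.antipode k

/-! ### Left comodules -/

theorem LeftComodule.sw_coassoc (X : LeftComodule k A V) (v : V) (F : A → A → V → M)
    (h1 : ∀ y z, Lin k fun x => F x y z) (h2 : ∀ x z, Lin k fun y => F x y z)
    (h3 : ∀ x y, Lin k fun z => F x y z) :
    (sw X.coact v fun c x => sw X.coact x fun e y => F c e y) =
      sw X.coact v fun c y => sw Δ c fun c1 c2 => F c1 c2 y := by
  have h := congrArg (liftLin (fun x t => liftLin (F x) (h2 x) (h3 x) t)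
    (fun q => by
      induction q using TensorProduct.induction_on with
      | zero => simp only [map_zero]; exact ⟨fun _ _ => by simp, fun _ _ => by simp⟩
      | tmul y z => simpa only [liftLin_tmul] using h1 y z
      | add s t hs ht =>
        simp only [map_add]
        exact ⟨fun x y => by rw [hs.map_add, ht.map_add, add_add_add_comm],
          fun c x => by rw [hs.map_smul, ht.map_smul, smul_add]⟩)
    (fun x => by fun_prop)) (LinearMap.congr_fun X.coact_coassoc v)
  simp only [LinearMap.comp_apply, LinearEquiv.coe_coe] at h
  rw [eq_sw X.coact v] at h
  simp only [map_sw, mapEquiv_sw, LinearMap.rTensor_tmul, LinearMap.lTensor_tmul, liftLin_tmul,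
    eq_sw Δ, eq_sw X.coact, sw_tmul, tmul_sw, TensorProduct.assoc_tmul] at h
  exact h.symm

theorem LeftComodule.sw_counit (X : LeftComodule k A V) (v : V) (G : V → M) (h : Lin k G) :
    (sw X.coact v fun x y => ε x • G y) = G v := by
  have := congrArg (liftLin (fun (c : k) (y : V) => c • G y) (fun q => by fun_prop)
    (fun p => by fun_prop)) (X.coact_counit v)
  rw [eq_sw X.coact v] at this
  simpa only [map_sw, LinearMap.rTensor_tmul, liftLin_tmul, one_smul] using this

theorem cqtAct_tmul (r : A ⊗[k] A →ₗ[k] k) (δ : V →ₗ[k] A ⊗[k] V) (c : A) (v : V) :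
    cqtAct r δ (c ⊗ₜ v) = sw δ v fun e y => r (e ⊗ₜ c) • y := by
  simp only [cqtAct, LinearMap.comp_apply, LinearMap.lTensor_tmul, LinearEquiv.coe_coe, eq_sw δ,
    tmul_sw, mapEquiv_sw, map_sw, TensorProduct.assoc_symm_tmul, LinearMap.rTensor_tmul,
    TensorProduct.comm_tmul, TensorProduct.lid_tmul]

theorem braidL_tmul (r : A ⊗[k] A →ₗ[k] k) (δV : V →ₗ[k] A ⊗[k] V) (δW : W →ₗ[k] A ⊗[k] W)
    (v : V) (w : W) : braidL r δV δW (v ⊗ₜ w) =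
      sw δV v fun c x => sw δW w fun e y => r (e ⊗ₜ c) • y ⊗ₜ[k] x := by
  simp only [braidL, LinearMap.comp_apply, TensorProduct.map_tmul, LinearEquiv.coe_coe, eq_sw δV,
    eq_sw δW, tmul_sw, sw_tmul, mapEquiv_sw, map_sw, swapMid_tmul,
    TensorProduct.comm_tmul, TensorProduct.lid_tmul]
  exact sw_comm _ _ _ _ _

theorem braidL_tmul' (r : A ⊗[k] A →ₗ[k] k) (δV : V →ₗ[k] A ⊗[k] V) (δW : W →ₗ[k] A ⊗[k] W)
    (v : V) (w : W) : braidL r δV δW (v ⊗ₜ w) =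
      sw δV v fun c x => cqtAct r δW (c ⊗ₜ w) ⊗ₜ[k] x := by
  simp only [braidL_tmul, cqtAct_tmul, sw_tmul, TensorProduct.smul_tmul']

theorem tensorCoactL_tmul (δV : V →ₗ[k] A ⊗[k] V) (δW : W →ₗ[k] A ⊗[k] W) (v : V) (w : W) :
    tensorCoactL δV δW (v ⊗ₜ w) =
      sw δV v fun c x => sw δW w fun e y => (c * e) ⊗ₜ[k] (x ⊗ₜ[k] y) := by
  simp only [tensorCoactL, LinearMap.comp_apply, TensorProduct.map_tmul, eq_sw δV,
    eq_sw δW, tmul_sw, sw_tmul, map_sw, swapMid_tmul, LinearMap.rTensor_tmul,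
    LinearMap.mul'_apply]
  exact sw_comm _ _ _ _ _

/-! ### Consequences of co-quasitriangularity -/

namespace IsCoquasitriangular

variable {r : A ⊗[k] A →ₗ[k] k} (hr : IsCoquasitriangular r)

include hr

theorem mul_left_sw (a b c : A) :
    r ((a * b) ⊗ₜ c) = sw Δ c fun c1 c2 => r (a ⊗ₜ c1) * r (b ⊗ₜ c2) := by
  rw [hr.mul_left, eq_sw Δ c]
  simp only [tmul_sw, map_sw, swapMid_tmul, TensorProduct.map_tmul, LinearMap.mul'_apply]

theorem mul_right_sw (a b c : A) :
    r (a ⊗ₜ (b * c)) = sw Δ a fun a1 a2 => r (a1 ⊗ₜ c) * r (a2 ⊗ₜ b) := by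
  rw [hr.mul_right, eq_sw Δ a]
  simp only [sw_tmul, map_sw, swapMid_tmul, TensorProduct.map_tmul, LinearMap.mul'_apply]

theorem quasicomm_sw (a b : A) (G : A → M) (hG : Lin k G) :
    (sw Δ a fun a1 a2 => sw Δ b fun b1 b2 => r (a2 ⊗ₜ b2) • G (b1 * a1)) =
      sw Δ a fun a1 a2 => sw Δ b fun b1 b2 => r (a1 ⊗ₜ b1) • G (a2 * b2) := by
  have := hr.quasicomm a b
  rw [eq_sw Δ a, eq_sw Δ b] at this
  simp only [tmul_sw, sw_tmul, mapEquiv_sw, map_sw, swapMid_tmul, TensorProduct.map_tmul,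
    LinearMap.comp_apply, LinearEquiv.coe_coe, TensorProduct.comm_tmul, LinearMap.mul'_apply,
    TensorProduct.rid_tmul, TensorProduct.lid_tmul] at this
  have h := congrArg G this
  simp only [hG.map_sw, hG.map_smul] at h
  rw [sw_comm, h, sw_comm]

/-- `r(S a, S b) = r(a, b)`. -/
theorem antipode_antipode (a b : A) : r (S a ⊗ₜ S b) = r (a ⊗ₜ b) := by
  -- Convolution inverses again, now for forms on A ⊗ A: r(S –, –) is a right inverse of r by `e1`,
  -- and r(S –, S –) is a right inverse of r(S –, –) by `e2`. Hence r and r(S –, S –) coincide.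
  have e1 (a b : A) : (sw Δ b fun b1 b2 => sw Δ a fun a1 a2 =>
      r (a1 ⊗ₜ b1) * r (S a2 ⊗ₜ b2)) = ε a * ε b := by
    rw [sw_comm]
    simp only [← hr.mul_left_sw]
    rw [sw_antipode_right a (fun z => r (z ⊗ₜ b)) (by fun_prop), hr.one_left, smul_eq_mul]
  have e2 (a b : A) : (sw Δ b fun b1 b2 => sw Δ a fun a1 a2 =>
      r (S a1 ⊗ₜ b1) * r (S a2 ⊗ₜ S b2)) = ε a * ε b := by
    calc _ = sw Δ b fun b1 b2 => r (S a ⊗ₜ (b1 * S b2)) := by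
          refine sw_congr fun b1 b2 => ?_
          rw [hr.mul_right_sw, sw_antipode a (fun x y => r (x ⊗ₜ S b2) * r (y ⊗ₜ b1))
            (by fun_prop) (by fun_prop)]
          simp only [mul_comm]
      _ = _ := by
          rw [sw_antipode_right b (fun z => r (S a ⊗ₜ z)) (by fun_prop), hr.one_right,
            HopfAlgebra.counit_antipode, smul_eq_mul, mul_comm]
  calc r (S a ⊗ₜ S b) = sw Δ a fun a1 a2 => ε a1 • sw Δ b fun b1 b2 =>
        ε b1 • r (S a2 ⊗ₜ S b2) := by
        simp_rw [fun a2 : A => sw_counit_left (k := k) b (fun z => r (S a2 ⊗ₜ S z)) (by fun_prop)]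
        rw [sw_counit_left a (fun z => r (S z ⊗ₜ S b)) (by fun_prop)]
    _ = sw Δ b fun b1 b2 => sw Δ a fun a1 a2 => sw Δ b1 fun b1 b2' => sw Δ a1 fun a1 a2' =>
          r (a1 ⊗ₜ b1) * (r (S a2' ⊗ₜ b2') * r (S a2 ⊗ₜ S b2)) := by
        rw [sw_comm]
        refine sw_congr fun a1 a2 => ?_
        rw [smul_sw]
        refine sw_congr fun b1 b2 => ?_
        rw [smul_smul, ← e1, sw_smul]
        simp only [sw_smul, smul_eq_mul, sw_mul_const, mul_assoc]
    _ = sw Δ a fun a1 a2 => sw Δ b fun u s => sw Δ s fun b2' b2 => sw Δ a1 fun a1 a2' =>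
          r (a1 ⊗ₜ u) * (r (S a2' ⊗ₜ b2') * r (S a2 ⊗ₜ S b2)) := by
        rw [sw_comm]
        refine sw_congr fun a1 a2 => ?_
        rw [sw_coassoc b fun u b2' b2 => sw Δ a1 fun a1 a2' =>
          r (a1 ⊗ₜ u) * (r (S a2' ⊗ₜ b2') * r (S a2 ⊗ₜ S b2))] <;> fun_prop
    _ = sw Δ b fun u s => sw Δ s fun b2' b2 => sw Δ a fun a1 t => sw Δ t fun a2' a2 =>
          r (a1 ⊗ₜ u) * (r (S a2' ⊗ₜ b2') * r (S a2 ⊗ₜ S b2)) := by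
        rw [sw_comm]
        refine sw_congr fun u s => ?_
        rw [sw_comm]
        refine sw_congr fun b2' b2 => ?_
        rw [sw_coassoc a fun a1 a2' a2 =>
          r (a1 ⊗ₜ u) * (r (S a2' ⊗ₜ b2') * r (S a2 ⊗ₜ S b2))] <;> fun_prop
    _ = sw Δ b fun u s => sw Δ a fun a1 t => (ε t * ε s) • r (a1 ⊗ₜ u) := by
        refine sw_congr fun u s => ?_
        rw [sw_comm]
        refine sw_congr fun a1 t => ?_
        rw [← e2]
        simp only [sw_smul, smul_eq_mul, mul_comm, const_mul_sw]
    _ = _ := by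
        simp only [mul_smul]
        simp_rw [fun (u s : A) => sw_counit_right (k := k) a (fun z => ε s • r (z ⊗ₜ u))
          (by fun_prop)]
        rw [sw_counit_right b (fun z => r (a ⊗ₜ z)) (by fun_prop)]

theorem cqtAct_one (X : LeftComodule k A V) (v : V) : cqtAct r X.coact (1 ⊗ₜ v) = v := by
  simp only [cqtAct_tmul, hr.one_right]
  exact X.sw_counit v (fun y => y) (by fun_prop)

/-- The reversal in r(a, bc) = r(a₁, c) r(a₂, b) is what makes this a left action. -/
theorem cqtAct_mul (X : LeftComodule k A V) (c d : A) (v : V) :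
    cqtAct r X.coact ((c * d) ⊗ₜ v) = cqtAct r X.coact (c ⊗ₜ cqtAct r X.coact (d ⊗ₜ v)) := by
  simp only [cqtAct_tmul, hr.mul_right_sw, sw_smul]
  rw [← X.sw_coassoc v (fun x y z => (r (x ⊗ₜ d) * r (y ⊗ₜ c)) • z)]
    <;> try fun_prop
  rw [sw_sw] <;> try fun_prop
  refine sw_congr fun x y => ?_
  rw [sw_smul_arg, smul_sw] <;> try fun_prop
  simp only [smul_smul]

/-- The Yetter-Drinfeld condition for the action of `A` on an `A`-comodule. -/
theorem cqtAct_yd (X : LeftComodule k A V) (c : A) (v : V) (F : A → V → M)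
    (h1 : ∀ y, Lin k fun x => F x y) (h2 : ∀ x, Lin k fun y => F x y) :
    (sw Δ c fun c1 c2 => sw X.coact (cqtAct r X.coact (c1 ⊗ₜ v)) fun e y => F (e * c2) y) =
      sw Δ c fun c1 c2 => sw X.coact v fun e y => F (c1 * e) (cqtAct r X.coact (c2 ⊗ₜ y)) := by
  calc _ = sw Δ c fun c1 c2 => sw X.coact v fun d y => sw Δ d fun d1 d2 =>
        r (d1 ⊗ₜ c1) • F (d2 * c2) y := by
        refine sw_congr fun c1 c2 => ?_
        rw [cqtAct_tmul, sw_sw, ← X.sw_coassoc v (fun d1 d2 y => r (d1 ⊗ₜ c1) • F (d2 * c2) y)]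
          <;> try fun_prop
        refine sw_congr fun d y => ?_
        rw [sw_smul_arg, smul_sw] <;> fun_prop
    -- Quasi-commutativity of r exchanges the product d₂ c₂ with c₁ d₁.
    _ = sw Δ c fun c1 c2 => sw X.coact v fun d y => sw Δ d fun d1 d2 =>
        r (d2 ⊗ₜ c2) • F (c1 * d1) y := by
        rw [sw_comm, sw_comm Δ X.coact]
        refine sw_congr fun d y => ?_
        rw [sw_comm, ← hr.quasicomm_sw d c (fun z => F z y) (by fun_prop), sw_comm]
    _ = _ := by
        refine sw_congr fun c1 c2 => ?_
        rw [← X.sw_coassoc v (fun d1 d2 y => r (d2 ⊗ₜ c2) • F (c1 * d1) y)] <;> try fun_prop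
        refine sw_congr fun d y => ?_
        rw [cqtAct_tmul, (h2 _).map_sw]
        exact sw_congr fun _ _ => ((h2 _).map_smul _ _).symm

end IsCoquasitriangular

end Hopf

/-! ### The adjoint coaction and the covariantised product. -/

section Adjoint

variable {k : Type*} {A : Type*} [Field k] [Ring A] [HopfAlgebra k A]
variable {M : Type*} [AddCommMonoid M] [Module k M]

local notation "Δ" => Coalgebra.comul (R := k)
local notation "ε" => Coalgebra.counit (R := k)
local notation "S" => HopfAlgebra.antipode k
local notation "ad" => adL (k := k) (A := A)

theorem adL_apply (a : A) : ad a =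
    sw Δ a fun a1 t => sw Δ t fun a2 a3 => (a1 * S a3) ⊗ₜ[k] a2 := by
  simp only [adL, LinearMap.comp_apply, LinearEquiv.coe_coe, eq_sw Δ, map_sw, mapEquiv_sw,
    LinearMap.lTensor_tmul, LinearMap.rTensor_tmul, TensorProduct.comm_tmul, tmul_sw,
    TensorProduct.assoc_symm_tmul, LinearMap.mul'_apply]

theorem sw_adL (a : A) (F : A → A → M) (h1 : ∀ y, Lin k fun x => F x y)
    (h2 : ∀ x, Lin k fun y => F x y) :
    sw ad a F = sw Δ a fun a1 t => sw Δ t fun a2 a3 => F (a1 * S a3) a2 := by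
  rw [sw_eq_liftLin _ a F h1 h2, adL_apply]
  simp only [map_sw, liftLin_tmul]

theorem sw_adL_coassoc (a : A) (F : A → A → A → M) (h1 : ∀ y z, Lin k fun x => F x y z)
    (h2 : ∀ x z, Lin k fun y => F x y z) (h3 : ∀ x y, Lin k fun z => F x y z) :
    (sw ad a fun c x => sw ad x fun e y => F c e y) =
      sw ad a fun c y => sw Δ c fun c1 c2 => F c1 c2 y := by
  simp (disch := fun_prop) only [sw_adL, sw_mul, sw_antipode, sw_coassoc]
  rw [← sw_coassoc a fun a1 a2 t => sw Δ t fun y z => sw Δ z fun z1 z2 =>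
    F (a1 * S z2) (a2 * S z1) y] <;> try fun_prop
  refine sw_congr fun x t => ?_
  rw [sw_comm]

theorem sw_adL_counit (a : A) (G : A → M) (h : Lin k G) :
    (sw ad a fun c x => ε c • G x) = G a := by
  rw [sw_adL a fun c x => ε c • G x] <;> try fun_prop
  simp only [Bialgebra.counit_mul, HopfAlgebra.counit_antipode, mul_smul, ← smul_sw]
  simp_rw [fun t : A => sw_counit_right (k := k) t G h]
  exact sw_counit_left a G h

theorem sw_adL_counit_right (a : A) (G : A → M) (h : Lin k G) :
    (sw ad a fun c x => ε x • G c) = ε a • G 1 := by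
  rw [sw_adL a fun c x => ε x • G c] <;> try fun_prop
  simp_rw [fun u t : A => sw_counit_left (k := k) t (fun z => G (u * S z)) (by fun_prop)]
  exact sw_antipode_right a G h

theorem sw_adL_one (F : A → A → M) (h1 : ∀ y, Lin k fun x => F x y)
    (h2 : ∀ x, Lin k fun y => F x y) : sw ad (1 : A) F = F 1 1 := by
  simp (disch := fun_prop) only [sw_adL, sw_one, HopfAlgebra.antipode_one, mul_one]

theorem adL_one : ad (1 : A) = 1 ⊗ₜ 1 := by
  rw [eq_sw ad, sw_adL_one] <;> fun_prop

variable (k A) in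
/-- `A` as a left comodule under the adjoint coaction. -/
def adComodule : LeftComodule k A A where
  coact := adL
  coact_coassoc := by
    ext a
    simp only [LinearMap.comp_apply, LinearEquiv.coe_coe]
    rw [eq_sw ad a]
    simp only [map_sw, mapEquiv_sw, LinearMap.rTensor_tmul, LinearMap.lTensor_tmul,
      eq_sw Δ, eq_sw ad, sw_tmul, tmul_sw, TensorProduct.assoc_tmul]
    rw [sw_adL_coassoc a fun x y z => x ⊗ₜ[k] (y ⊗ₜ[k] z)] <;> fun_prop
  coact_counit := by
    intro a
    rw [eq_sw ad a]
    simp only [map_sw, LinearMap.rTensor_tmul]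
    rw [← sw_adL_counit a (fun x => (1 : k) ⊗ₜ[k] x) (by fun_prop)]
    simp only [TensorProduct.smul_tmul', smul_eq_mul, mul_one]

/-- The crossed module condition between left multiplication and the adjoint coaction. -/
theorem sw_adL_mul (a b : A) (F : A → A → M) (h1 : ∀ y, Lin k fun x => F x y)
    (h2 : ∀ x, Lin k fun y => F x y) :
    sw ad (a * b) F = sw Δ a fun a1 t => sw Δ t fun a2 a3 =>
      sw ad b fun e y => F (a1 * e * S a3) (a2 * y) := by
  simp (disch := fun_prop) only [sw_adL, sw_mul, HopfAlgebra.antipode_mul_antidistrib, mul_assoc]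
  refine sw_congr fun a1 t => ?_
  rw [sw_comm]

theorem uMul_tmul (r : A ⊗[k] A →ₗ[k] k) (a b : A) : uMul r (a ⊗ₜ b) =
    sw Δ a fun a1 a2 => a1 * cqtAct r ad (S a2 ⊗ₜ b) := by
  simp only [uMul, LinearMap.comp_apply, LinearEquiv.coe_coe, LinearMap.rTensor_tmul, eq_sw Δ,
    sw_tmul, map_sw, mapEquiv_sw, TensorProduct.assoc_tmul, LinearMap.lTensor_tmul,
    LinearMap.mul'_apply]

namespace IsCoquasitriangular

variable {r : A ⊗[k] A →ₗ[k] k} (hr : IsCoquasitriangular r)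

local notation:70 c " ▹ " b:71 => cqtAct r ad (c ⊗ₜ[k] b)
local notation:70 a " ⊙ " b:71 => uMul r (a ⊗ₜ[k] b)

include hr

theorem act_one (b : A) : 1 ▹ b = b := hr.cqtAct_one (adComodule k A) b

theorem act_mul (c d b : A) : (c * d) ▹ b = c ▹ (d ▹ b) := hr.cqtAct_mul (adComodule k A) c d b

theorem act_yd (c : A) (v : A) (F : A → A → M)
    (h1 : ∀ y, Lin k fun x => F x y) (h2 : ∀ x, Lin k fun y => F x y) :
    (sw Δ c fun c1 c2 => sw ad (c1 ▹ v) fun e y => F (e * c2) y) =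
      sw Δ c fun c1 c2 => sw ad v fun e y => F (c1 * e) (c2 ▹ y) :=
  hr.cqtAct_yd (adComodule k A) c v F h1 h2

/-- The covariantised product is colinear. -/
theorem sw_adL_uMul (a b : A) (F : A → A → M)
    (h1 : ∀ y, Lin k fun x => F x y) (h2 : ∀ x, Lin k fun y => F x y) :
    sw ad (a ⊙ b) F = sw ad a fun c x => sw ad b fun e y => F (c * e) (x ⊙ y) := by
  -- S(a₄) acts on b while S(a₃) multiplies from the right; together they are the two legs of
  -- Δ(S(u)), which is the form required by the crossed module condition.
  calc _ = sw Δ a fun a1 t => sw Δ t fun a2 u => sw Δ (S u) fun c1 c2 =>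
        sw ad (c1 ▹ b) fun e y => F (a1 * (e * c2)) (a2 * y) := by
        rw [uMul_tmul, sw_sw] <;> try fun_prop
        simp (disch := fun_prop) only [sw_adL_mul, sw_antipode]
        rw [sw_coassoc a fun a1 t a4 => sw Δ t fun a2 a3 =>
          sw ad (S a4 ▹ b) fun e y => F (a1 * e * S a3) (a2 * y)] <;> try fun_prop
        refine sw_congr fun a1 t => ?_
        rw [sw_coassoc t fun a2 a3 a4 =>
          sw ad (S a4 ▹ b) fun e y => F (a1 * e * S a3) (a2 * y)] <;> try fun_prop
        simp only [mul_assoc]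
    _ = sw Δ a fun a1 t => sw Δ t fun a2 u => sw Δ (S u) fun c1 c2 =>
        sw ad b fun e y => F (a1 * (c1 * e)) (a2 * (c2 ▹ y)) := by
        refine sw_congr fun a1 t => sw_congr fun a2 u => ?_
        exact hr.act_yd (S u) b (fun e y => F (a1 * e) (a2 * y)) (by fun_prop) (by fun_prop)
    _ = _ := by
        simp only [uMul_tmul]
        simp_rw [fun c e x y : A => (h2 (c * e)).map_sw Δ x fun a1 a2 => a1 * (S a2 ▹ y)]
        rw [sw_adL a fun c x => sw ad b fun e y => sw Δ x fun a1 a2 =>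
          F (c * e) (a1 * (S a2 ▹ y))] <;> try fun_prop
        simp (disch := fun_prop) only [sw_antipode, mul_assoc]
        refine sw_congr fun a1 t => ?_
        rw [← sw_coassoc t fun a2 x y => sw ad b fun e z =>
          F (a1 * (S y * e)) (a2 * (S x ▹ z))] <;> try fun_prop
        refine sw_congr fun p q => ?_
        rw [sw_comm]

/-- `c₁ b · (c₂ ▹ w) = c (b · w)`. -/
theorem sw_mul_uMul_act (c b w : A) :
    (sw Δ c fun c1 c2 => (c1 * b) ⊙ (c2 ▹ w)) = c * (b ⊙ w) := by
  calc _ = sw Δ c fun c1 c2 => sw Δ c1 fun p q => sw Δ b fun b1 b2 =>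
        p * b1 * ((S b2 * (S q * c2)) ▹ w) := by
        refine sw_congr fun c1 c2 => ?_
        rw [uMul_tmul, sw_mul] <;> try fun_prop
        simp only [HopfAlgebra.antipode_mul_antidistrib, hr.act_mul]
    _ = sw Δ c fun p t => ε t • (p * (b ⊙ w)) := by
        rw [sw_coassoc c fun p q c2 => sw Δ b fun b1 b2 => p * b1 * ((S b2 * (S q * c2)) ▹ w)]
          <;> try fun_prop
        refine sw_congr fun p t => ?_
        rw [sw_antipode_left t fun z => sw Δ b fun b1 b2 => p * b1 * ((S b2 * z) ▹ w)]
          <;> try fun_prop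
        simp only [uMul_tmul, const_mul_sw, mul_one, mul_assoc]
    _ = _ := sw_counit_right c _ (by fun_prop)

/-- The case b = 1: the ordinary product is recovered from the covariantised one. In the braided Lie
coalgebra axioms the braiding always enters in this combination, so `r` drops out of them. -/
theorem sw_uMul_act (c w : A) : (sw Δ c fun c1 c2 => c1 ⊙ (c2 ▹ w)) = c * w := by
  have := hr.sw_mul_uMul_act c 1 w
  simp only [mul_one] at this
  rw [this, uMul_tmul, sw_one] <;> try fun_prop
  rw [HopfAlgebra.antipode_one, hr.act_one, one_mul]

/-- Colinearity of the product together with r(ab, c) = r(a, c₁) r(b, c₂) makes `A` a module algebra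
for the action. -/
theorem act_uMul (c b w : A) :
    c ▹ (b ⊙ w) = sw Δ c fun c1 c2 => (c1 ▹ b) ⊙ (c2 ▹ w) := by
  rw [cqtAct_tmul, hr.sw_adL_uMul b w fun e y => r (e ⊗ₜ c) • y] <;> try fun_prop
  simp only [hr.mul_left_sw, cqtAct_tmul, sw_smul, sw_tmul, tmul_sw, map_sw, ← TensorProduct.smul_tmul',
    TensorProduct.tmul_smul, map_smul, smul_smul, mul_comm]
  simp only [smul_sw, smul_smul]
  rw [sw_comm ad ad b w, sw_comm Δ ad c w]
  refine sw_congr fun e y => ?_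
  rw [sw_comm Δ ad c b]
  simp only [mul_comm]

/-- S(a₂) acts diagonally on b · c. By `sw_mul_uMul_act` the factor a₁ enters the first argument at
the cost of an action on c, and that action cancels against the antipode. -/
theorem uMul_assoc (a b c : A) : (a ⊙ b) ⊙ c = a ⊙ (b ⊙ c) := by
  symm
  calc a ⊙ (b ⊙ c) = sw Δ a fun a1 t => sw Δ t fun x y => a1 * ((S y ▹ b) ⊙ (S x ▹ c)) := by
        rw [uMul_tmul]
        refine sw_congr fun a1 a2 => ?_
        rw [hr.act_uMul, sw_antipode] <;> try fun_prop
        rw [const_mul_sw]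
    _ = sw Δ a fun a1 t => sw Δ t fun x y => sw Δ a1 fun p q =>
          (p * (S y ▹ b)) ⊙ ((q * S x) ▹ c) := by
        simp only [hr.act_mul, hr.sw_mul_uMul_act]
    _ = sw Δ a fun p t => sw Δ t fun q t => sw Δ t fun x y =>
          (p * (S y ▹ b)) ⊙ ((q * S x) ▹ c) := by
        rw [sw_coassoc₃ a fun p q x y => (p * (S y ▹ b)) ⊙ ((q * S x) ▹ c)] <;> fun_prop
    _ = sw Δ a fun p t => (p * (S t ▹ b)) ⊙ c := by
        refine sw_congr fun p t => ?_
        rw [← sw_coassoc t fun q x y => (p * (S y ▹ b)) ⊙ ((q * S x) ▹ c)] <;> try fun_prop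
        simp_rw [fun x y : A => sw_antipode_right (k := k) x
          (fun z => (p * (S y ▹ b)) ⊙ (z ▹ c)) (by fun_prop)]
        rw [sw_counit_left t fun y => (p * (S y ▹ b)) ⊙ (1 ▹ c)] <;> try fun_prop
        rw [hr.act_one]
    _ = _ := by
        rw [uMul_tmul r a b, sw_tmul, map_sw]

theorem one_uMul (b : A) : 1 ⊙ b = b := by
  rw [uMul_tmul, sw_one] <;> try fun_prop
  rw [HopfAlgebra.antipode_one, hr.act_one, one_mul]

theorem act_unit (c : A) : c ▹ (1 : A) = ε c • 1 := by
  rw [cqtAct_tmul, sw_adL_one] <;> try fun_prop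
  rw [hr.one_left]

theorem uMul_one (a : A) : a ⊙ (1 : A) = a := by
  simp only [uMul_tmul, hr.act_unit, HopfAlgebra.counit_antipode, mul_smul_comm, mul_one]
  exact sw_counit_right a (fun x => x) (by fun_prop)

/-- `a · b = r(b₁, a⁽⁻¹⁾) b₂ a⁽⁰⁾`. -/
theorem uMul_eq (a b : A) :
    a ⊙ b = sw ad a fun c x => sw Δ b fun b1 b2 => r (b1 ⊗ₜ c) • (b2 * x) := by
  calc a ⊙ b = sw Δ a fun a1 t => sw Δ t fun x y => sw Δ b fun b1 u => sw Δ u fun b2 b3 =>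
        (r (b1 ⊗ₜ S y) * r (b3 ⊗ₜ x)) • (a1 * b2) := by
        rw [uMul_tmul]
        refine sw_congr fun a1 t => ?_
        simp only [cqtAct_tmul, const_mul_sw, mul_smul_comm]
        rw [sw_adL b fun e y => r (e ⊗ₜ S t) • (a1 * y)] <;> try fun_prop
        simp (disch := fun_prop) only [hr.mul_left_sw, sw_antipode, hr.antipode_antipode, sw_smul]
        rw [sw_comm Δ Δ t b]
        refine sw_congr fun b1 u => ?_
        rw [sw_comm]
    _ = sw Δ b fun b1 u => sw Δ a fun w y => r (b1 ⊗ₜ S y) • sw Δ u fun b2 b3 => sw Δ w fun a1 x =>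
        r (b3 ⊗ₜ x) • (a1 * b2) := by
        rw [← sw_coassoc a fun a1 x y => sw Δ b fun b1 u => sw Δ u fun b2 b3 =>
          (r (b1 ⊗ₜ S y) * r (b3 ⊗ₜ x)) • (a1 * b2)] <;> try fun_prop
        rw [sw_comm Δ Δ b a]
        refine sw_congr fun w y => ?_
        rw [sw_comm]
        refine sw_congr fun b1 u => ?_
        rw [sw_comm]
        simp only [mul_smul, smul_sw]
    -- Quasi-commutativity turns a₁ b₂ into b₃ x; this is where the order of the two arguments is
    -- reversed. The remaining factors of `r` then combine into r(b₁, a₁ S(a₃)).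
    _ = sw Δ b fun b1 u => sw Δ a fun w y => r (b1 ⊗ₜ S y) • sw Δ u fun b2 b3 => sw Δ w fun a1 x =>
        r (b2 ⊗ₜ a1) • (b3 * x) := by
        refine sw_congr fun b1 u => sw_congr fun w y => ?_
        rw [hr.quasicomm_sw u w (fun z => z) (by fun_prop)]
    _ = _ := by
        rw [sw_comm Δ Δ b a]
        simp only [smul_sw, smul_smul]
        rw [sw_adL a fun c x => sw Δ b fun b1 b2 => r (b1 ⊗ₜ c) • (b2 * x)] <;> try fun_prop
        rw [← sw_coassoc a fun a1 x y => sw Δ b fun b1 b2 => r (b1 ⊗ₜ (a1 * S y)) • (b2 * x)]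
          <;> try fun_prop
        refine sw_congr fun w y => ?_
        rw [sw_comm Δ Δ w b]
        simp only [hr.mul_right_sw, sw_smul]
        rw [← sw_coassoc b fun b1 b2 b3 => sw Δ w fun a1 x =>
          (r (b1 ⊗ₜ S y) * r (b2 ⊗ₜ a1)) • (b3 * x)] <;> try fun_prop
        refine sw_congr fun b' b3 => ?_
        rw [sw_comm]

end IsCoquasitriangular
end Adjoint

/-! ### The braided group of `A` and the transposed canonical braiding. -/

section BraidedGroup

variable {k : Type*} {A : Type*} [Field k] [Ring A] [HopfAlgebra k A]
variable {M : Type*} [AddCommMonoid M] [Module k M]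

local notation "Δ" => Coalgebra.comul (R := k)
local notation "ε" => Coalgebra.counit (R := k)
local notation "S" => HopfAlgebra.antipode k
local notation "ad" => adL (k := k) (A := A)

/-- Right multiplication by the last leg of c cancels the antipode produced by ad_L, leaving an
antipode-free form of the crossed module condition. -/
theorem sw_adL_mul_left (c b : A) (F : A → A → M) (h1 : ∀ y, Lin k fun x => F x y)
    (h2 : ∀ x, Lin k fun y => F x y) :
    (sw Δ c fun c1 c2 => sw ad (c1 * b) fun e y => F (e * c2) y) =
      sw Δ c fun c1 c2 => sw ad b fun e y => F (c1 * e) (c2 * y) := by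
  simp (disch := fun_prop) only [sw_adL_mul]
  rw [sw_coassoc c fun p t c2 => sw Δ t fun q s => sw ad b fun e y =>
    F (p * e * S s * c2) (q * y)] <;> try fun_prop
  refine sw_congr fun p t => ?_
  rw [sw_coassoc t fun q s c2 => sw ad b fun e y => F (p * e * S s * c2) (q * y)] <;> try fun_prop
  simp only [mul_assoc]
  simp_rw [fun q s : A => sw_antipode_left (k := k) s
    (fun z => sw ad b fun e y => F (p * (e * z)) (q * y)) (by fun_prop)]
  rw [sw_counit_right t fun q => sw ad b fun e y => F (p * (e * 1)) (q * y)] <;> try fun_prop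
  simp only [mul_one]

theorem sw_adL_self (c : A) (F : A → A → M) (h1 : ∀ y, Lin k fun x => F x y)
    (h2 : ∀ x, Lin k fun y => F x y) :
    (sw Δ c fun c1 c2 => sw ad c1 fun e y => F (e * c2) y) = sw Δ c F := by
  have := sw_adL_mul_left c 1 F h1 h2
  simp (disch := fun_prop) only [mul_one, sw_adL_one] at this
  exact this

variable (k A) in
/-- The braiding `a ⊗ b ↦ a⁽⁻¹⁾ b ⊗ a⁽⁰⁾` of the crossed module `A`. -/
def adBraid : A ⊗[k] A →ₗ[k] A ⊗[k] A :=
  LinearMap.rTensor A (LinearMap.mul' k A) ∘ₗ (TensorProduct.assoc k A A A).symm.toLinearMap ∘ₗ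
    LinearMap.lTensor A (TensorProduct.comm k A A).toLinearMap ∘ₗ
    (TensorProduct.assoc k A A A).toLinearMap ∘ₗ LinearMap.rTensor A adL

theorem adBraid_tmul (a b : A) :
    adBraid k A (a ⊗ₜ b) = sw ad a fun c x => (c * b) ⊗ₜ[k] x := by
  simp only [adBraid, LinearMap.comp_apply, LinearEquiv.coe_coe, LinearMap.rTensor_tmul, eq_sw ad,
    sw_tmul, map_sw, mapEquiv_sw, TensorProduct.assoc_tmul, LinearMap.lTensor_tmul,
    TensorProduct.comm_tmul, TensorProduct.assoc_symm_tmul, LinearMap.mul'_apply]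

/-- The product of the braided tensor square. -/
def braidedMul {V : Type*} [AddCommGroup V] [Module k V] (r : A ⊗[k] A →ₗ[k] k)
    (δ : V →ₗ[k] A ⊗[k] V) (μ : V ⊗[k] V →ₗ[k] V) :
    (V ⊗[k] V) ⊗[k] (V ⊗[k] V) →ₗ[k] V ⊗[k] V :=
  TensorProduct.map μ μ ∘ₗ mid (braidL r δ δ)

theorem mid_braidL_tmul {V₁ V₂ V₃ V₄ : Type*} [AddCommGroup V₁] [Module k V₁]
    [AddCommGroup V₂] [Module k V₂] [AddCommGroup V₃] [Module k V₃]
    [AddCommGroup V₄] [Module k V₄] (r : A ⊗[k] A →ₗ[k] k)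
    (δ : V₂ →ₗ[k] A ⊗[k] V₂) (δ' : V₃ →ₗ[k] A ⊗[k] V₃) (v₁ : V₁) (v₂ : V₂) (v₃ : V₃) (v₄ : V₄) :
    mid (braidL r δ δ') ((v₁ ⊗ₜ v₂) ⊗ₜ (v₃ ⊗ₜ v₄)) =
      sw δ v₂ fun c x => (v₁ ⊗ₜ cqtAct r δ' (c ⊗ₜ v₃)) ⊗ₜ[k] (x ⊗ₜ v₄) := by
  rw [mid_tmul, sw_eq_liftLin] <;> try fun_prop
  simp only [braidL_tmul', map_sw, liftLin_tmul]

namespace IsCoquasitriangular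

variable {r : A ⊗[k] A →ₗ[k] k} (hr : IsCoquasitriangular r)

local notation:70 c " ▹ " b:71 => cqtAct r ad (c ⊗ₜ[k] b)
local notation:70 a " ⊙ " b:71 => uMul r (a ⊗ₜ[k] b)

theorem braidedMul_tmul (a b a' b' : A) :
    braidedMul r ad (uMul r) ((a ⊗ₜ b) ⊗ₜ (a' ⊗ₜ b')) =
      sw ad b fun c x => (a ⊙ (c ▹ a')) ⊗ₜ[k] (x ⊙ b') := by
  simp only [braidedMul, LinearMap.comp_apply, mid_braidL_tmul, map_sw, TensorProduct.map_tmul]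

include hr

/-- The braiding acts on b by the second leg of a⁽⁻¹⁾, and c₁ · (c₂ ▷ b) = c b removes it. The left
side is the transpose of the canonical braiding Υ, so Υ does not see `r`; this is why it can be
compared with the crossed module braiding σ. -/
theorem uMul_braid_cobracket :
    LinearMap.rTensor A (uMul r) ∘ₗ (TensorProduct.assoc k A A A).symm.toLinearMap ∘ₗ
      LinearMap.lTensor A (braidL r ad ad) ∘ₗ (TensorProduct.assoc k A A A).toLinearMap ∘ₗ
      LinearMap.rTensor A ad = adBraid k A := by
  ext a b
  simp only [TensorProduct.AlgebraTensorModule.curry_apply, LinearMap.restrictScalars_self,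
    TensorProduct.curry_apply, LinearMap.comp_apply, LinearEquiv.coe_coe, LinearMap.rTensor_tmul,
    eq_sw ad, sw_tmul, map_sw, mapEquiv_sw, TensorProduct.assoc_tmul, LinearMap.lTensor_tmul,
    braidL_tmul', tmul_sw, TensorProduct.assoc_symm_tmul, adBraid_tmul]
  rw [sw_adL_coassoc a fun c e y => (c ⊙ (e ▹ b)) ⊗ₜ[k] y] <;> try fun_prop
  simp only [← sw_tmul, hr.sw_uMul_act]

/-- Write e b' as e₁ · (e₂ ▷ b'), reassociate, flip b · e₁ by `uMul_eq`, and absorb the action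
again. -/
theorem sw_act_mul_uMul (b e b' : A) :
    (sw ad b fun c x => sw Δ e fun e1 e2 => r (e1 ⊗ₜ c) • (e2 * (x ⊙ b'))) = b ⊙ (e * b') := by
  symm
  calc b ⊙ (e * b') = sw Δ e fun e1 e2 => sw ad b fun c x => sw Δ e1 fun p q =>
        r (p ⊗ₜ c) • ((q * x) ⊙ (e2 ▹ b')) := by
        rw [← hr.sw_uMul_act e b', tmul_sw, map_sw]
        simp only [← hr.uMul_assoc]
        refine sw_congr fun e1 e2 => ?_
        rw [hr.uMul_eq b e1]
        simp only [sw_tmul, map_sw, ← TensorProduct.smul_tmul', map_smul]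
    _ = _ := by
        rw [sw_comm]
        refine sw_congr fun c x => ?_
        rw [sw_coassoc e fun p q e2 => r (p ⊗ₜ c) • ((q * x) ⊙ (e2 ▹ b'))] <;> try fun_prop
        simp only [← smul_sw, hr.sw_mul_uMul_act]

/-- Dually this says that Υ is a coalgebra map, the reason why its relations are compatible with a
coproduct. Both sides reduce to a⁽⁻¹⁾ (b · (a'⁽⁻¹⁾ b')) ⊗ a⁽⁰⁾ · a'⁽⁰⁾. -/
theorem adBraid_braidedMul :
    adBraid k A ∘ₗ braidedMul r ad (uMul r) =
      braidedMul r ad (uMul r) ∘ₗ TensorProduct.map (adBraid k A) (adBraid k A) := by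
  ext a b a' b'
  simp only [TensorProduct.AlgebraTensorModule.curry_apply, LinearMap.restrictScalars_self,
    TensorProduct.curry_apply, LinearMap.comp_apply]
  calc _ = sw ad b fun c x => sw ad a fun f z => sw ad a' fun d y => sw Δ d fun d1 d2 =>
        r (d1 ⊗ₜ c) • ((f * (d2 * (x ⊙ b'))) ⊗ₜ[k] (z ⊙ y)) := by
        simp only [braidedMul_tmul, map_sw, adBraid_tmul]
        refine sw_congr fun c x => ?_
        rw [hr.sw_adL_uMul a (c ▹ a') fun e y => (e * (x ⊙ b')) ⊗ₜ[k] y] <;> try fun_prop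
        refine sw_congr fun f z => ?_
        rw [cqtAct_tmul, sw_sw] <;> try fun_prop
        rw [← sw_adL_coassoc a' fun d1 d2 y =>
          r (d1 ⊗ₜ c) • ((f * (d2 * (x ⊙ b'))) ⊗ₜ[k] (z ⊙ y))] <;> try fun_prop
        refine sw_congr fun d y => ?_
        rw [sw_smul_arg, smul_sw] <;> try fun_prop
        simp only [mul_assoc]
    _ = sw ad a fun f z => sw ad a' fun d y => (f * (b ⊙ (d * b'))) ⊗ₜ[k] (z ⊙ y) := by
        rw [sw_comm]
        refine sw_congr fun f z => ?_
        rw [sw_comm]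
        refine sw_congr fun d y => ?_
        rw [← hr.sw_act_mul_uMul]
        simp only [const_mul_sw, sw_tmul, mul_smul_comm, TensorProduct.smul_tmul']
    _ = _ := by
        simp only [TensorProduct.map_tmul, adBraid_tmul, sw_tmul, tmul_sw, map_sw,
          braidedMul_tmul]
        rw [sw_comm]
        refine sw_congr fun d y => ?_
        rw [sw_adL_coassoc a fun f g w => ((f * b) ⊙ (g ▹ (d * b'))) ⊗ₜ[k] (w ⊙ y)]
          <;> try fun_prop
        simp only [← sw_tmul, hr.sw_mul_uMul_act]

omit hr in
theorem _root_.BraidedLie.adBraid_colinear :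
    tensorCoactL ad ad ∘ₗ adBraid k A = LinearMap.lTensor A (adBraid k A) ∘ₗ tensorCoactL ad ad := by
  ext a b
  simp only [TensorProduct.AlgebraTensorModule.curry_apply, LinearMap.restrictScalars_self,
    TensorProduct.curry_apply, LinearMap.comp_apply, adBraid_tmul, tensorCoactL_tmul, map_sw,
    LinearMap.lTensor_tmul, tmul_sw]
  calc _ = sw ad a fun c z => sw Δ c fun c1 c2 => sw ad (c1 * b) fun e y =>
        (e * c2) ⊗ₜ[k] (y ⊗ₜ[k] z) := by
        rw [← sw_adL_coassoc a fun c1 c2 z => sw ad (c1 * b) fun e y =>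
          (e * c2) ⊗ₜ[k] (y ⊗ₜ[k] z)] <;> try fun_prop
        refine sw_congr fun c x => ?_
        rw [sw_comm]
    _ = _ := by
        simp_rw [fun c z : A => sw_adL_mul_left (k := k) c b (fun e y => e ⊗ₜ[k] (y ⊗ₜ[k] z))
          (by fun_prop) (by fun_prop)]
        rw [← sw_adL_coassoc a fun c1 c2 z => sw ad b fun e y =>
          (c1 * e) ⊗ₜ[k] ((c2 * y) ⊗ₜ[k] z)] <;> try fun_prop
        refine sw_congr fun c x => ?_
        rw [sw_comm]

/-- The braided group of `A` is a braided Lie coalgebra. -/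
def braidedGroup : BraidedLieCoalgebra r A where
  toLeftComodule := adComodule k A
  mul := uMul r
  one := 1
  cobracket := ad
  mul_assoc := by
    ext a b c
    exact hr.uMul_assoc a b c
  one_mul := hr.one_uMul
  mul_one := hr.uMul_one
  mul_colinear := by
    ext a b
    change ad (a ⊙ b) = LinearMap.lTensor A (uMul r) (tensorCoactL ad ad (a ⊗ₜ b))
    rw [eq_sw ad, hr.sw_adL_uMul, tensorCoactL_tmul] <;> try fun_prop
    simp only [map_sw, LinearMap.lTensor_tmul]
  one_colinear := adL_one
  cobracket_colinear := by
    ext a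
    change tensorCoactL ad ad (ad a) = LinearMap.lTensor A ad (ad a)
    rw [eq_sw ad a]
    simp only [map_sw, tensorCoactL_tmul, LinearMap.lTensor_tmul, eq_sw ad, tmul_sw]
    rw [sw_adL_coassoc a fun c e y => c ⊗ₜ[k] (e ⊗ₜ[k] y)] <;> try fun_prop
    calc _ = sw ad a fun c y => sw Δ c fun c1 c2 => sw ad c1 fun p q =>
          (p * c2) ⊗ₜ[k] (q ⊗ₜ[k] y) := by
          rw [← sw_adL_coassoc a fun c1 c2 y => sw ad c1 fun p q =>
            (p * c2) ⊗ₜ[k] (q ⊗ₜ[k] y)] <;> try fun_prop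
          refine sw_congr fun c x => ?_
          rw [sw_comm]
      _ = _ := by
          refine sw_congr fun c y => ?_
          exact sw_adL_self c (fun p q => p ⊗ₜ[k] (q ⊗ₜ[k] y)) (by fun_prop) (by fun_prop)
  co_jacobi := by
    ext a
    change LinearMap.lTensor A ad (ad a) = LinearMap.rTensor (A ⊗[k] A) (uMul r)
      (mid (braidL r ad ad) (TensorProduct.map ad ad (ad a)))
    rw [eq_sw ad a]
    simp only [map_sw, TensorProduct.map_tmul, LinearMap.lTensor_tmul, eq_sw ad, tmul_sw, sw_tmul,
      mid_braidL_tmul, LinearMap.rTensor_tmul]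
    rw [sw_adL_coassoc a fun c e y => c ⊗ₜ[k] (e ⊗ₜ[k] y)] <;> try fun_prop
    symm
    calc _ = sw ad a fun c y => sw Δ c fun c1 c2 => sw ad c1 fun p q =>
          (p * c2) ⊗ₜ[k] (q ⊗ₜ[k] y) := by
          rw [← sw_adL_coassoc a fun c1 c2 y => sw ad c1 fun p q =>
            (p * c2) ⊗ₜ[k] (q ⊗ₜ[k] y)] <;> try fun_prop
          refine sw_congr fun c x => ?_
          refine sw_congr fun e y => ?_
          -- The braiding acts on e by the second leg of the coefficient, so the covariantised
          -- product collapses to the ordinary product p e.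
          rw [sw_adL_coassoc c fun p p' q => (p ⊙ (p' ▹ e)) ⊗ₜ[k] (q ⊗ₜ[k] y)] <;> try fun_prop
          simp only [← sw_tmul, hr.sw_uMul_act]
      _ = _ := by
          refine sw_congr fun c y => ?_
          exact sw_adL_self c (fun p q => p ⊗ₜ[k] (q ⊗ₜ[k] y)) (by fun_prop) (by fun_prop)
  weak_comm := by
    -- The left side becomes `adBraid` after Ψ; what remains is the flipped formula `uMul_eq` for
    -- the product on the right side.
    rw [show (adComodule k A).coact = ad from rfl, hr.uMul_braid_cobracket]
    ext a b
    simp only [TensorProduct.AlgebraTensorModule.curry_apply, LinearMap.restrictScalars_self,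
      TensorProduct.curry_apply, LinearMap.comp_apply, LinearEquiv.coe_coe, LinearMap.lTensor_tmul]
    rw [braidL_tmul, eq_sw ad b]
    simp only [map_sw, mapEquiv_sw, tmul_sw, TensorProduct.assoc_symm_tmul, map_smul,
      LinearMap.rTensor_tmul, adBraid_tmul, hr.uMul_eq, sw_tmul]
    rw [sw_comm ad ad b a]
    refine sw_congr fun c x => ?_
    rw [← sw_adL_coassoc b fun e e' y => (r (e ⊗ₜ c) • (e' * x)) ⊗ₜ[k] y] <;> try fun_prop
    simp only [smul_sw, TensorProduct.smul_tmul']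
  cobracket_mul := by
    ext a b
    change ad (a ⊙ b) = TensorProduct.map (uMul r) (uMul r)
      (mid (braidL r ad ad) (ad a ⊗ₜ ad b))
    rw [eq_sw ad, hr.sw_adL_uMul] <;> try fun_prop
    rw [eq_sw ad a, eq_sw ad b]
    simp only [sw_tmul, tmul_sw, map_sw, mid_braidL_tmul, TensorProduct.map_tmul]
    rw [sw_comm ad ad a b, sw_comm ad ad b a, sw_comm ad ad a b]
    refine sw_congr fun e y => ?_
    rw [sw_adL_coassoc a fun c e' w => (c ⊙ (e' ▹ e)) ⊗ₜ[k] (w ⊙ y)] <;> try fun_prop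
    simp only [← sw_tmul, hr.sw_uMul_act]
  cobracket_one := adL_one

omit hr in
theorem _root_.BraidedLie.lTensor_counit_adL (a : A) :
    LinearMap.lTensor A ε (ad a) = 1 ⊗ₜ[k] ε a := by
  rw [eq_sw ad a]
  simp only [map_sw, LinearMap.lTensor_tmul]
  have := sw_adL_counit_right (k := k) a (fun x => x ⊗ₜ[k] (1 : k)) (by fun_prop)
  simpa only [TensorProduct.smul_tmul', ← TensorProduct.tmul_smul, smul_eq_mul, mul_one,
    TensorProduct.smul_tmul] using this

theorem counit_act (c b : A) : ε (c ▹ b) = ε c * ε b := by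
  rw [cqtAct_tmul]
  simp only [map_sw, map_smul, smul_eq_mul, mul_comm]
  simp only [← smul_eq_mul]
  rw [sw_adL_counit_right b (fun x => r (x ⊗ₜ c)) (by fun_prop), hr.one_left]
  exact mul_comm _ _

theorem counit_uMul (a b : A) : ε (a ⊙ b) = ε a * ε b := by
  rw [uMul_tmul, ← smul_eq_mul, ← sw_counit_left a (fun x => ε x • ε b) (by fun_prop)]
  simp only [map_sw, Bialgebra.counit_mul, hr.counit_act, HopfAlgebra.counit_antipode, smul_eq_mul]

theorem braidedGroup_isCounit : hr.braidedGroup.IsCounit (Coalgebra.counit (R := k)) where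
  colinear a := lTensor_counit_adL a
  map_mul := hr.counit_uMul
  map_one := Bialgebra.counit_one
  map_cobracket a := by
    change TensorProduct.map ε ε (ad a) = _
    rw [← LinearMap.rTensor_comp_lTensor, LinearMap.comp_apply, lTensor_counit_adL,
      LinearMap.rTensor_tmul, Bialgebra.counit_one, ← mul_one (ε a), ← smul_eq_mul,
      TensorProduct.tmul_smul, TensorProduct.smul_tmul']
  left := (adComodule k A).coact_counit
  right a := lTensor_counit_adL a

end IsCoquasitriangular
end BraidedGroup

/-! ### Intertwining maps -/

section Intertwine

variable {k : Type*} [Field k]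
variable {M N P Q R T M' N' P' Q' R' T' : Type*}
  [AddCommGroup M] [Module k M] [AddCommGroup N] [Module k N]
  [AddCommGroup P] [Module k P] [AddCommGroup Q] [Module k Q]
  [AddCommGroup R] [Module k R] [AddCommGroup T] [Module k T]
  [AddCommGroup M'] [Module k M'] [AddCommGroup N'] [Module k N']
  [AddCommGroup P'] [Module k P'] [AddCommGroup Q'] [Module k Q']
  [AddCommGroup R'] [Module k R'] [AddCommGroup T'] [Module k T']

/-- `p` and `q` intertwine `f` with `f'`. -/
def Intertwines (p : M →ₗ[k] M') (q : N →ₗ[k] N') (f : M →ₗ[k] N) (f' : M' →ₗ[k] N') : Prop :=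
  ∀ m, q (f m) = f' (p m)

namespace Intertwines

variable {p : M →ₗ[k] M'} {q : N →ₗ[k] N'} {s : P →ₗ[k] P'} {t : Q →ₗ[k] Q'}

theorem id : Intertwines p p LinearMap.id LinearMap.id := fun _ => rfl

theorem comp {g : N →ₗ[k] P} {g' : N' →ₗ[k] P'} {f : M →ₗ[k] N} {f' : M' →ₗ[k] N'}
    (hg : Intertwines q s g g') (hf : Intertwines p q f f') :
    Intertwines p s (g ∘ₗ f) (g' ∘ₗ f') := fun m => by
  rw [LinearMap.comp_apply, hg, hf, LinearMap.comp_apply]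

theorem map {f : M →ₗ[k] N} {f' : M' →ₗ[k] N'} {g : P →ₗ[k] Q} {g' : P' →ₗ[k] Q'}
    (hf : Intertwines p q f f') (hg : Intertwines s t g g') :
    Intertwines (TensorProduct.map p s) (TensorProduct.map q t) (TensorProduct.map f g)
      (TensorProduct.map f' g') := fun m => by
  simp only [← LinearMap.comp_apply, ← TensorProduct.map_comp]
  rw [show q ∘ₗ f = f' ∘ₗ p from LinearMap.ext hf, show t ∘ₗ g = g' ∘ₗ s from LinearMap.ext hg]

theorem rTensor {f : M →ₗ[k] N} {f' : M' →ₗ[k] N'} (s : P →ₗ[k] P')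
    (hf : Intertwines p q f f') :
    Intertwines (TensorProduct.map p s) (TensorProduct.map q s) (LinearMap.rTensor P f)
      (LinearMap.rTensor P' f') := hf.map id

theorem lTensor {f : M →ₗ[k] N} {f' : M' →ₗ[k] N'} (s : P →ₗ[k] P')
    (hf : Intertwines p q f f') :
    Intertwines (TensorProduct.map s p) (TensorProduct.map s q) (LinearMap.lTensor P f)
      (LinearMap.lTensor P' f') := id.map hf

theorem assoc (p : M →ₗ[k] M') (q : N →ₗ[k] N') (s : P →ₗ[k] P') :
    Intertwines (TensorProduct.map (TensorProduct.map p q) s)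
      (TensorProduct.map p (TensorProduct.map q s))
      (TensorProduct.assoc k M N P).toLinearMap (TensorProduct.assoc k M' N' P').toLinearMap :=
  fun m => (LinearMap.congr_fun (TensorProduct.map_map_comp_assoc_eq p q s) m)

theorem symm {e : M ≃ₗ[k] N} {e' : M' ≃ₗ[k] N'}
    (h : Intertwines p q e.toLinearMap e'.toLinearMap) :
    Intertwines q p e.symm.toLinearMap e'.symm.toLinearMap := fun n => by
  obtain ⟨m, rfl⟩ := e.surjective n
  have := h m
  simp only [LinearEquiv.coe_coe] at this
  simp only [LinearEquiv.coe_coe, this, LinearEquiv.symm_apply_apply]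

theorem swapMid (p : M →ₗ[k] M') (q : N →ₗ[k] N') (s : P →ₗ[k] P') (t : Q →ₗ[k] Q') :
    Intertwines (TensorProduct.map (TensorProduct.map p q) (TensorProduct.map s t))
      (TensorProduct.map (TensorProduct.map p s) (TensorProduct.map q t))
      BraidedLie.swapMid BraidedLie.swapMid := fun m => by
  simp only [← LinearMap.comp_apply]
  congr 1
  ext
  rfl

theorem mid {f : P →ₗ[k] P'} {g : Q →ₗ[k] Q'} {f₂ : R →ₗ[k] R'} {g₂ : T →ₗ[k] T'}
    (p : M →ₗ[k] M') (q : N →ₗ[k] N')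
    {φ : P ⊗[k] Q →ₗ[k] R ⊗[k] T} {φ' : P' ⊗[k] Q' →ₗ[k] R' ⊗[k] T'}
    (h : Intertwines (TensorProduct.map f g) (TensorProduct.map f₂ g₂) φ φ') :
    Intertwines (TensorProduct.map (TensorProduct.map p f) (TensorProduct.map g q))
      (TensorProduct.map (TensorProduct.map p f₂) (TensorProduct.map g₂ q))
      (BraidedLie.mid φ) (BraidedLie.mid φ') :=
  (assoc p f₂ (TensorProduct.map g₂ q)).symm.comp
    ((((assoc f₂ g₂ q).comp ((h.rTensor q).comp (assoc f g q).symm)).lTensor p).comp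
      (assoc p f (TensorProduct.map g q)))

/-- An axiom is an equality of two composites. Once both composites are seen to be intertwined by
the same maps, the axiom passes to the image of a surjection, or by `eq_of_injective` to the source
of an injection. -/
theorem eq_of_surjective {f g : M →ₗ[k] N} {f' g' : M' →ₗ[k] N'} (hf : Intertwines p q f f')
    (hg : Intertwines p q g g') (hp : Function.Surjective p) (h : f = g) : f' = g' := by
  ext m'
  obtain ⟨m, rfl⟩ := hp m'
  rw [← hf, ← hg, h]

theorem eq_of_injective {f g : M →ₗ[k] N} {f' g' : M' →ₗ[k] N'} (hf : Intertwines p q f f')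
    (hg : Intertwines p q g g') (hq : Function.Injective q) (h : f' = g') : f = g := by
  ext m
  apply hq
  rw [hf, hg, h]

end Intertwines

variable {A : Type*} [Ring A] [HopfAlgebra k A]

theorem Intertwines.braidL (r : A ⊗[k] A →ₗ[k] k) {δ : M →ₗ[k] A ⊗[k] M}
    {δ' : M' →ₗ[k] A ⊗[k] M'} {p : M →ₗ[k] M'}
    (h : Intertwines p (TensorProduct.map LinearMap.id p) δ δ') :
    Intertwines (TensorProduct.map p p) (TensorProduct.map p p) (BraidedLie.braidL r δ δ)
      (BraidedLie.braidL r δ' δ') := by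
  refine Intertwines.comp (q := TensorProduct.map LinearMap.id (TensorProduct.map p p)) ?_
    (Intertwines.comp (q := TensorProduct.map (TensorProduct.map LinearMap.id LinearMap.id)
      (TensorProduct.map p p)) ?_ ((Intertwines.swapMid _ _ _ _).comp (h.map h)))
  · intro m
    simp only [← LinearMap.comp_apply]
    congr 1
    ext
    simp
  · refine Intertwines.map ?_ ?_
    · intro m
      simp [TensorProduct.map_id]
    · intro m
      simp only [← LinearMap.comp_apply]
      congr 1
      ext
      rfl

theorem Intertwines.tensorCoactL {δ : M →ₗ[k] A ⊗[k] M}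
    {δ' : M' →ₗ[k] A ⊗[k] M'} {p : M →ₗ[k] M'}
    (h : Intertwines p (TensorProduct.map LinearMap.id p) δ δ') :
    Intertwines (TensorProduct.map p p) (TensorProduct.map LinearMap.id (TensorProduct.map p p))
      (BraidedLie.tensorCoactL δ δ) (BraidedLie.tensorCoactL δ' δ') :=
  Intertwines.comp (q := TensorProduct.map (TensorProduct.map LinearMap.id LinearMap.id)
      (TensorProduct.map p p)) (fun m => by
        simp only [← LinearMap.comp_apply]
        congr 1
        ext
        simp) ((Intertwines.swapMid _ _ _ _).comp (h.map h))

theorem Intertwines.braidR (r : A ⊗[k] A →ₗ[k] k) {δ : M →ₗ[k] M ⊗[k] A}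
    {δ' : M' →ₗ[k] M' ⊗[k] A} {p : M →ₗ[k] M'} {κ : N →ₗ[k] N ⊗[k] A}
    {κ' : N' →ₗ[k] N' ⊗[k] A} {q : N →ₗ[k] N'}
    (h : Intertwines p (TensorProduct.map p LinearMap.id) δ δ')
    (h' : Intertwines q (TensorProduct.map q LinearMap.id) κ κ') :
    Intertwines (TensorProduct.map p q) (TensorProduct.map q p) (BraidedLie.braidR r δ κ)
      (BraidedLie.braidR r δ' κ') := by
  refine Intertwines.comp (q := TensorProduct.map (TensorProduct.map q p) LinearMap.id) ?_
    (Intertwines.comp (q := TensorProduct.map (TensorProduct.map p q)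
      (TensorProduct.map LinearMap.id LinearMap.id)) ?_
      ((Intertwines.swapMid _ _ _ _).comp (h.map h')))
  · intro m
    simp only [← LinearMap.comp_apply]
    congr 1
    ext
    simp
  · refine Intertwines.map ?_ ?_
    · intro m
      simp only [← LinearMap.comp_apply]
      congr 1
      ext
      rfl
    · intro m
      simp [TensorProduct.map_id]

theorem Intertwines.tensorCoactR {δ : M →ₗ[k] M ⊗[k] A}
    {δ' : M' →ₗ[k] M' ⊗[k] A} {p : M →ₗ[k] M'} {κ : N →ₗ[k] N ⊗[k] A}
    {κ' : N' →ₗ[k] N' ⊗[k] A} {q : N →ₗ[k] N'}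
    (h : Intertwines p (TensorProduct.map p LinearMap.id) δ δ')
    (h' : Intertwines q (TensorProduct.map q LinearMap.id) κ κ') :
    Intertwines (TensorProduct.map p q) (TensorProduct.map (TensorProduct.map p q) LinearMap.id)
      (BraidedLie.tensorCoactR δ κ) (BraidedLie.tensorCoactR δ' κ') :=
  Intertwines.comp (q := TensorProduct.map (TensorProduct.map p q)
      (TensorProduct.map LinearMap.id LinearMap.id)) (fun m => by
        simp only [← LinearMap.comp_apply]
        congr 1
        ext
        simp) ((Intertwines.swapMid _ _ _ _).comp (h.map h'))

end Intertwine

/-! ### Quotients of braided Lie coalgebras, braided Lie subalgebras -/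

section Transfer

variable {k : Type*} [Field k] {A : Type*} [Ring A] [HopfAlgebra k A] {r : A ⊗[k] A →ₗ[k] k}
variable {V W L N : Type*} [AddCommGroup V] [Module k V] [AddCommGroup W] [Module k W]
  [AddCommGroup L] [Module k L] [AddCommGroup N] [Module k N]

open TensorProduct (map)

/-- The image of a braided Lie coalgebra under a surjection compatible with the operations. -/
def BraidedLieCoalgebra.ofSurjective (C : BraidedLieCoalgebra r W) (π : W →ₗ[k] V)
    (hπ : Function.Surjective π) (coact : V →ₗ[k] A ⊗[k] V) (mul : V ⊗[k] V →ₗ[k] V)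
    (one : V) (cobracket : V →ₗ[k] V ⊗[k] V)
    (hcoact : Intertwines π (map LinearMap.id π) C.coact coact)
    (hmul : Intertwines (map π π) π C.mul mul) (hone : π C.one = one)
    (hcobr : Intertwines π (map π π) C.cobracket cobracket) : BraidedLieCoalgebra r V :=
  have hππ : Function.Surjective (map π π) := TensorProduct.map_surjective hπ hπ
  have hπππ : Function.Surjective (map (map π π) π) := TensorProduct.map_surjective hππ hπ
  have hA : Intertwines LinearMap.id (map LinearMap.id LinearMap.id)
    (Coalgebra.comul (R := k) (A := A)) Coalgebra.comul := fun m => by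
      simp [TensorProduct.map_id]
  { coact := coact
    coact_coassoc :=
      (((Intertwines.assoc _ _ _).comp ((hA.rTensor π).comp hcoact))).eq_of_surjective
        ((hcoact.lTensor _).comp hcoact) hπ C.coact_coassoc
    coact_counit := by
      intro v
      obtain ⟨w, rfl⟩ := hπ v
      have h := congrArg (LinearMap.lTensor k π) (C.coact_counit w)
      rw [← hcoact, ← LinearMap.lTensor, ← LinearMap.comp_apply, LinearMap.rTensor_comp_lTensor,
        ← LinearMap.lTensor_comp_rTensor, LinearMap.comp_apply, h, LinearMap.lTensor_tmul]
    mul := mul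
    one := one
    cobracket := cobracket
    mul_assoc := (hmul.comp (hmul.rTensor π)).eq_of_surjective
      (hmul.comp ((hmul.lTensor π).comp (Intertwines.assoc _ _ _))) hπππ C.mul_assoc
    one_mul := by
      intro v
      obtain ⟨w, rfl⟩ := hπ v
      rw [← hone, ← TensorProduct.map_tmul, ← hmul, C.one_mul]
    mul_one := by
      intro v
      obtain ⟨w, rfl⟩ := hπ v
      rw [← hone, ← TensorProduct.map_tmul, ← hmul, C.mul_one]
    mul_colinear := (hcoact.comp hmul).eq_of_surjective
      ((hmul.lTensor _).comp hcoact.tensorCoactL) hππ C.mul_colinear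
    one_colinear := by
      rw [← hone, ← hcoact, C.one_colinear, TensorProduct.map_tmul, LinearMap.id_apply]
    cobracket_colinear := (hcoact.tensorCoactL.comp hcobr).eq_of_surjective
      ((hcobr.lTensor _).comp hcoact) hπ C.cobracket_colinear
    co_jacobi := ((hcobr.lTensor _).comp hcobr).eq_of_surjective
      ((hmul.rTensor _).comp ((hcoact.braidL r).mid _ _ |>.comp ((hcobr.map hcobr).comp hcobr)))
      hπ C.co_jacobi
    weak_comm := (((hmul.rTensor π).comp ((Intertwines.assoc _ _ _).symm.comp
        (((hcoact.braidL r).lTensor π).comp ((Intertwines.assoc _ _ _).comp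
          (hcobr.rTensor π))))).comp (hcoact.braidL r)).eq_of_surjective
      ((hmul.rTensor π).comp ((Intertwines.assoc _ _ _).symm.comp (hcobr.lTensor π)))
      hππ C.weak_comm
    cobracket_mul := (hcobr.comp hmul).eq_of_surjective
      ((hmul.map hmul).comp ((hcoact.braidL r).mid _ _ |>.comp (hcobr.map hcobr)))
      hππ C.cobracket_mul
    cobracket_one := by
      rw [← hone, ← hcobr, C.cobracket_one, TensorProduct.map_tmul] }

theorem BraidedLieCoalgebra.IsCounit.of_surjective {C : BraidedLieCoalgebra r W}
    {D : BraidedLieCoalgebra r V} {e : W →ₗ[k] k} (h : C.IsCounit e) (π : W →ₗ[k] V)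
    (hπ : Function.Surjective π)
    (hcoact : Intertwines π (map LinearMap.id π) C.coact D.coact)
    (hmul : Intertwines (map π π) π C.mul D.mul) (hone : π C.one = D.one)
    (hcobr : Intertwines π (map π π) C.cobracket D.cobracket) {e' : V →ₗ[k] k}
    (he : e' ∘ₗ π = e) : D.IsCounit e' where
  colinear v := by
    obtain ⟨w, rfl⟩ := hπ v
    rw [← hcoact, ← LinearMap.lTensor, ← LinearMap.comp_apply, ← LinearMap.lTensor_comp, he,
      h.colinear, ← he, LinearMap.comp_apply]
  map_mul v w := by
    obtain ⟨v, rfl⟩ := hπ v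
    obtain ⟨w, rfl⟩ := hπ w
    rw [← TensorProduct.map_tmul, ← hmul, ← LinearMap.comp_apply, he, h.map_mul, ← he]
    rfl
  map_one := by rw [← hone, ← LinearMap.comp_apply, he, h.map_one]
  map_cobracket v := by
    obtain ⟨w, rfl⟩ := hπ v
    rw [← hcobr, ← LinearMap.comp_apply, ← TensorProduct.map_comp, he, h.map_cobracket, ← he]
    rfl
  left v := by
    obtain ⟨w, rfl⟩ := hπ v
    rw [← hcobr, ← LinearMap.comp_apply, LinearMap.rTensor_comp_map, he,
      ← LinearMap.lTensor_comp_rTensor, LinearMap.comp_apply, h.left, LinearMap.lTensor_tmul]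
  right v := by
    obtain ⟨w, rfl⟩ := hπ v
    rw [← hcobr, ← LinearMap.comp_apply, LinearMap.lTensor_comp_map, he,
      ← LinearMap.rTensor_comp_lTensor, LinearMap.comp_apply, h.right, LinearMap.rTensor_tmul,
      hone, ← he]
    rfl

/-- The restriction of a braided Lie algebra to a subspace closed under the operations. -/
def BraidedLieAlgebra.restrict (𝓛 : BraidedLieAlgebra r L) (ι : N →ₗ[k] L)
    (hι : Function.Injective ι) (coact : N →ₗ[k] N ⊗[k] A) (comul : N →ₗ[k] N ⊗[k] N)
    (bracket : N ⊗[k] N →ₗ[k] N)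
    (hcoact : Intertwines ι (map ι LinearMap.id) coact 𝓛.coact)
    (hcomul : Intertwines ι (map ι ι) comul 𝓛.comul)
    (hbr : Intertwines (map ι ι) ι bracket 𝓛.bracket) : BraidedLieAlgebra r N :=
  -- Modules over a field are flat, so tensor powers of ι remain injective and every axiom can be
  -- tested in 𝓛.
  have hι2 : Function.Injective (map ι ι) :=
    TensorProduct.map_injective_of_flat_flat ι ι hι hι
  have hid : Function.Injective (LinearMap.id : A →ₗ[k] A) := Function.injective_id
  have hA : Intertwines LinearMap.id (map LinearMap.id LinearMap.id)
    (Coalgebra.comul (R := k) (A := A)) Coalgebra.comul := fun m => by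
      simp [TensorProduct.map_id]
  { coact := coact
    coact_coassoc := ((Intertwines.assoc _ _ _).comp ((hcoact.rTensor _).comp
        hcoact)).eq_of_injective ((hA.lTensor ι).comp hcoact)
        (TensorProduct.map_injective_of_flat_flat _ _ hι
          (TensorProduct.map_injective_of_flat_flat _ _ hid hid)) 𝓛.coact_coassoc
    coact_counit := by
      intro v
      have h := 𝓛.coact_counit (ι v)
      rw [← hcoact, ← LinearMap.rTensor, ← LinearMap.comp_apply, LinearMap.lTensor_comp_rTensor,
        ← LinearMap.rTensor_comp_lTensor, LinearMap.comp_apply, ← LinearMap.rTensor_tmul] at h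
      exact Module.Flat.rTensor_preserves_injective_linearMap ι hι h
    comul := comul
    counit := 𝓛.counit ∘ₗ ι
    coassoc := ((Intertwines.assoc _ _ _).comp ((hcomul.rTensor _).comp
        hcomul)).eq_of_injective ((hcomul.lTensor ι).comp hcomul)
        (TensorProduct.map_injective_of_flat_flat _ _ hι hι2) 𝓛.coassoc
    rTensor_counit_comp_comul := by
      ext v
      have h := LinearMap.congr_fun 𝓛.rTensor_counit_comp_comul (ι v)
      rw [LinearMap.comp_apply, ← hcomul, ← LinearMap.comp_apply, LinearMap.rTensor_comp_map,
        ← LinearMap.lTensor_comp_rTensor, LinearMap.comp_apply] at h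
      exact Module.Flat.lTensor_preserves_injective_linearMap (M := k) ι hι h
    lTensor_counit_comp_comul := by
      ext v
      have h := LinearMap.congr_fun 𝓛.lTensor_counit_comp_comul (ι v)
      rw [LinearMap.comp_apply, ← hcomul, ← LinearMap.comp_apply, LinearMap.lTensor_comp_map,
        ← LinearMap.rTensor_comp_lTensor, LinearMap.comp_apply] at h
      exact Module.Flat.rTensor_preserves_injective_linearMap (M := k) ι hι h
    bracket := bracket
    comul_colinear := ((hcoact.tensorCoactR hcoact).comp hcomul).eq_of_injective
      ((hcomul.rTensor _).comp hcoact)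
      (TensorProduct.map_injective_of_flat_flat _ _ hι2 hid) 𝓛.comul_colinear
    counit_colinear := by
      intro v
      have h := 𝓛.counit_colinear (ι v)
      rwa [← hcoact, ← LinearMap.rTensor, ← LinearMap.comp_apply, ← LinearMap.rTensor_comp] at h
    bracket_colinear := (hcoact.comp hbr).eq_of_injective
      ((hbr.rTensor _).comp (hcoact.tensorCoactR hcoact))
      (TensorProduct.map_injective_of_flat_flat _ _ hι hid) 𝓛.bracket_colinear
    jacobi := (hbr.comp (hbr.lTensor ι)).eq_of_injective
      (hbr.comp ((hbr.map hbr).comp (((hcoact.braidR r hcoact).mid ι ι).comp (hcomul.rTensor _))))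
      hι 𝓛.jacobi
    weak_cocomm := ((hcoact.braidR r hcoact).comp ((hbr.rTensor ι).comp
        ((Intertwines.assoc _ _ _).symm.comp (((hcoact.braidR r hcoact).lTensor ι).comp
          ((Intertwines.assoc _ _ _).comp (hcomul.rTensor ι)))))).eq_of_injective
      ((hbr.lTensor ι).comp ((Intertwines.assoc _ _ _).comp (hcomul.rTensor ι)))
      hι2 𝓛.weak_cocomm
    bracket_comul := (hcomul.comp hbr).eq_of_injective
      ((hbr.map hbr).comp (((hcoact.braidR r hcoact).mid ι ι).comp (hcomul.map hcomul)))
      hι2 𝓛.bracket_comul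
    bracket_counit := by
      intro x y
      rw [LinearMap.comp_apply, hbr, TensorProduct.map_tmul, 𝓛.bracket_counit]
      rfl }

theorem BraidedLieAlgebra.restrict_isHom (𝓛 : BraidedLieAlgebra r L) (ι : N →ₗ[k] L)
    (hι : Function.Injective ι) (coact : N →ₗ[k] N ⊗[k] A) (comul : N →ₗ[k] N ⊗[k] N)
    (bracket : N ⊗[k] N →ₗ[k] N)
    (hcoact : Intertwines ι (map ι LinearMap.id) coact 𝓛.coact)
    (hcomul : Intertwines ι (map ι ι) comul 𝓛.comul)
    (hbr : Intertwines (map ι ι) ι bracket 𝓛.bracket) :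
    (𝓛.restrict ι hι coact comul bracket hcoact hcomul hbr).IsHom 𝓛 ι where
  colinear := LinearMap.ext fun m => (hcoact m).symm
  comul := LinearMap.ext fun m => (hcomul m).symm
  counit := rfl
  bracket := LinearMap.ext fun m => (hbr m).symm

end Transfer

/-! ### Hopf bimodules: adjoint action and right invariants. -/

namespace BiData

variable {k : Type*} {A : Type*} [Field k] [Ring A] [HopfAlgebra k A]
variable {Γ : Type*} [AddCommGroup Γ] [Module k Γ] {X : BiData k A Γ}
variable {M : Type*} [AddCommMonoid M] [Module k M]

local notation "Δ" => Coalgebra.comul (R := k)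
local notation "ε" => Coalgebra.counit (R := k)
local notation "S" => HopfAlgebra.antipode k
local notation "ad" => adL (k := k) (A := A)

section RightHandSides

variable (X) (a : A) (v : Γ)

theorem map_mul_lact_swapMid :
    TensorProduct.map (LinearMap.mul' k A) X.lact (swapMid (TensorProduct.map Δ X.lco (a ⊗ₜ v))) =
      sw Δ a fun a1 a2 => sw X.lco v fun c x => (a1 * c) ⊗ₜ[k] X.lact (a2 ⊗ₜ x) := by
  rw [TensorProduct.map_tmul, eq_sw Δ a, eq_sw X.lco v]
  simp only [sw_tmul, tmul_sw, map_sw, swapMid_tmul, TensorProduct.map_tmul, LinearMap.mul'_apply]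
  rw [sw_comm]

theorem map_mul_ract_swapMid :
    TensorProduct.map (LinearMap.mul' k A) X.ract (swapMid (TensorProduct.map X.lco Δ (v ⊗ₜ a))) =
      sw X.lco v fun c x => sw Δ a fun b1 b2 => (c * b1) ⊗ₜ[k] X.ract (x ⊗ₜ b2) := by
  rw [TensorProduct.map_tmul, eq_sw Δ a, eq_sw X.lco v]
  simp only [sw_tmul, tmul_sw, map_sw, swapMid_tmul, TensorProduct.map_tmul, LinearMap.mul'_apply]
  rw [sw_comm]

theorem map_lact_mul_swapMid :
    TensorProduct.map X.lact (LinearMap.mul' k A) (swapMid (TensorProduct.map Δ X.rco (a ⊗ₜ v))) =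
      sw Δ a fun a1 a2 => sw X.rco v fun x c => X.lact (a1 ⊗ₜ x) ⊗ₜ[k] (a2 * c) := by
  rw [TensorProduct.map_tmul, eq_sw Δ a, eq_sw X.rco v]
  simp only [sw_tmul, tmul_sw, map_sw, swapMid_tmul, TensorProduct.map_tmul, LinearMap.mul'_apply]
  rw [sw_comm]

theorem map_ract_mul_swapMid :
    TensorProduct.map X.ract (LinearMap.mul' k A) (swapMid (TensorProduct.map X.rco Δ (v ⊗ₜ a))) =
      sw X.rco v fun x c => sw Δ a fun b1 b2 => X.ract (x ⊗ₜ b1) ⊗ₜ[k] (c * b2) := by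
  rw [TensorProduct.map_tmul, eq_sw Δ a, eq_sw X.rco v]
  simp only [sw_tmul, tmul_sw, map_sw, swapMid_tmul, TensorProduct.map_tmul, LinearMap.mul'_apply]
  rw [sw_comm]

end RightHandSides

namespace IsHopfBimodule

theorem lco_lact_eq (h : X.IsHopfBimodule) (a : A) (v : Γ) : X.lco (X.lact (a ⊗ₜ v)) =
    sw Δ a fun a1 a2 => sw X.lco v fun c x => (a1 * c) ⊗ₜ[k] X.lact (a2 ⊗ₜ x) :=
  (LinearMap.congr_fun h.lco_lact (a ⊗ₜ v)).trans (X.map_mul_lact_swapMid a v)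

theorem lco_ract_eq (h : X.IsHopfBimodule) (v : Γ) (b : A) : X.lco (X.ract (v ⊗ₜ b)) =
    sw X.lco v fun c x => sw Δ b fun b1 b2 => (c * b1) ⊗ₜ[k] X.ract (x ⊗ₜ b2) :=
  (LinearMap.congr_fun h.lco_ract (v ⊗ₜ b)).trans (X.map_mul_ract_swapMid b v)

theorem rco_lact_eq (h : X.IsHopfBimodule) (a : A) (v : Γ) : X.rco (X.lact (a ⊗ₜ v)) =
    sw Δ a fun a1 a2 => sw X.rco v fun x c => X.lact (a1 ⊗ₜ x) ⊗ₜ[k] (a2 * c) :=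
  (LinearMap.congr_fun h.rco_lact (a ⊗ₜ v)).trans (X.map_lact_mul_swapMid a v)

theorem rco_ract_eq (h : X.IsHopfBimodule) (v : Γ) (b : A) : X.rco (X.ract (v ⊗ₜ b)) =
    sw X.rco v fun x c => sw Δ b fun b1 b2 => X.ract (x ⊗ₜ b1) ⊗ₜ[k] (c * b2) :=
  (LinearMap.congr_fun h.rco_ract (v ⊗ₜ b)).trans (X.map_ract_mul_swapMid b v)

end IsHopfBimodule

theorem adAct_tmul (X : BiData k A Γ) (a : A) (v : Γ) :
    X.adAct (a ⊗ₜ v) = sw Δ a fun a1 a2 => X.ract (X.lact (a1 ⊗ₜ v) ⊗ₜ S a2) := by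
  simp only [adAct, LinearMap.comp_apply, LinearEquiv.coe_coe, LinearMap.rTensor_tmul, eq_sw Δ,
    sw_tmul, map_sw, mapEquiv_sw, TensorProduct.assoc_tmul, LinearMap.lTensor_tmul,
    TensorProduct.comm_tmul, TensorProduct.assoc_symm_tmul, TensorProduct.map_tmul]

/-- The projection `v ↦ v⁽⁰⁾ S(v⁽¹⁾)` of a Hopf bimodule to its right invariants. -/
def rightProj (X : BiData k A Γ) : Γ →ₗ[k] Γ :=
  X.ract ∘ₗ LinearMap.lTensor Γ (HopfAlgebra.antipode k) ∘ₗ X.rco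

theorem rightProj_apply (X : BiData k A Γ) (v : Γ) :
    X.rightProj v = sw X.rco v fun x c => X.ract (x ⊗ₜ S c) := by
  simp only [rightProj, LinearMap.comp_apply]
  rw [eq_sw X.rco]
  simp only [map_sw, LinearMap.lTensor_tmul]

theorem mem_rightInv {v : Γ} : v ∈ X.rightInv ↔ X.rco v = v ⊗ₜ 1 := Iff.rfl

namespace IsHopfBimodule

theorem adAct_mul (h : X.IsHopfBimodule) (a b : A) (v : Γ) :
    X.adAct ((a * b) ⊗ₜ v) = X.adAct (a ⊗ₜ X.adAct (b ⊗ₜ v)) := by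
  simp only [adAct_tmul]
  rw [sw_mul] <;> try fun_prop
  simp only [HopfAlgebra.antipode_mul_antidistrib, h.ract_mul, h.mul_lact, tmul_sw, sw_tmul, map_sw,
    h.lact_ract]

/-- The action contributes the coefficient a₂ S(a₃) to Δ_R, and the antipode axiom collapses it. -/
theorem rco_adAct (h : X.IsHopfBimodule) (a : A) {v : Γ} (hv : X.rco v = v ⊗ₜ 1) :
    X.rco (X.adAct (a ⊗ₜ v)) = X.adAct (a ⊗ₜ v) ⊗ₜ 1 := by
  simp only [adAct_tmul, map_sw, h.rco_ract_eq]
  calc _ = sw Δ a fun a1 a2 => sw Δ a1 fun p q => sw Δ a2 fun x y =>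
        X.ract (X.lact (p ⊗ₜ v) ⊗ₜ S y) ⊗ₜ[k] (q * S x) := by
        refine sw_congr fun a1 a2 => ?_
        rw [sw_eq_liftLin X.rco _ (fun x c => sw Δ (S a2) fun b1 b2 =>
          X.ract (x ⊗ₜ b1) ⊗ₜ[k] (c * b2)) (by fun_prop) (by fun_prop), h.rco_lact_eq]
        simp only [map_sw, liftLin_tmul]
        refine sw_congr fun p q => ?_
        rw [sw_of_eq_tmul hv] <;> try fun_prop
        rw [sw_antipode] <;> try fun_prop
        simp only [mul_one]
    _ = sw Δ a fun p t => sw Δ t fun q u => sw Δ u fun x y =>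
        X.ract (X.lact (p ⊗ₜ v) ⊗ₜ S y) ⊗ₜ[k] (q * S x) := by
        rw [sw_coassoc a fun p q u => sw Δ u fun x y =>
          X.ract (X.lact (p ⊗ₜ v) ⊗ₜ S y) ⊗ₜ[k] (q * S x)] <;> fun_prop
    _ = _ := by
        simp only [sw_tmul]
        refine sw_congr fun p t => ?_
        rw [← sw_coassoc t fun q x y => X.ract (X.lact (p ⊗ₜ v) ⊗ₜ S y) ⊗ₜ[k] (q * S x)]
          <;> try fun_prop
        simp_rw [fun w y : A => sw_antipode_right (k := k) w
          (fun z => X.ract (X.lact (p ⊗ₜ v) ⊗ₜ S y) ⊗ₜ[k] z) (by fun_prop)]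
        rw [sw_counit_left t fun y => X.ract (X.lact (p ⊗ₜ v) ⊗ₜ S y) ⊗ₜ[k] (1 : A)]
        fun_prop

/-- In Δ_L the outer legs a₁ S(a₄) stay as coefficient and the inner legs a₂, S(a₃) act on v: this
is ad_L followed by the action. -/
theorem lco_adAct (h : X.IsHopfBimodule) (a : A) {v : Γ} (hv : X.lco v = 1 ⊗ₜ v) :
    X.lco (X.adAct (a ⊗ₜ v)) = sw ad a fun c x => c ⊗ₜ X.adAct (x ⊗ₜ v) := by
  simp only [adAct_tmul, map_sw, h.lco_ract_eq, tmul_sw]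
  rw [sw_adL a fun c x => sw Δ x fun x y => c ⊗ₜ[k] X.ract (X.lact (x ⊗ₜ v) ⊗ₜ S y)]
    <;> try fun_prop
  calc _ = sw Δ a fun a1 a2 => sw Δ a1 fun p q => sw Δ a2 fun x y =>
        (p * S y) ⊗ₜ[k] X.ract (X.lact (q ⊗ₜ v) ⊗ₜ S x) := by
        refine sw_congr fun a1 a2 => ?_
        rw [sw_eq_liftLin X.lco _ (fun c x => sw Δ (S a2) fun b1 b2 =>
          (c * b1) ⊗ₜ[k] X.ract (x ⊗ₜ b2)) (by fun_prop) (by fun_prop), h.lco_lact_eq]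
        simp only [map_sw, liftLin_tmul]
        refine sw_congr fun p q => ?_
        rw [sw_of_eq_tmul hv] <;> try fun_prop
        rw [sw_antipode] <;> try fun_prop
        simp only [mul_one]
    _ = _ := by
        rw [sw_coassoc a fun p q u => sw Δ u fun x y =>
          (p * S y) ⊗ₜ[k] X.ract (X.lact (q ⊗ₜ v) ⊗ₜ S x)] <;> try fun_prop
        refine sw_congr fun p t => ?_
        rw [sw_coassoc t fun q x y => (p * S y) ⊗ₜ[k] X.ract (X.lact (q ⊗ₜ v) ⊗ₜ S x)]
          <;> fun_prop

theorem rightProj_ract (h : X.IsHopfBimodule) {v : Γ} (hv : X.rco v = v ⊗ₜ 1) (b : A) :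
    X.rightProj (X.ract (v ⊗ₜ b)) = ε b • v := by
  rw [rightProj_apply, sw_eq_liftLin X.rco _ (fun x c => X.ract (x ⊗ₜ S c)) (by fun_prop)
    (by fun_prop), h.rco_ract_eq]
  simp only [map_sw, liftLin_tmul]
  rw [sw_of_eq_tmul hv] <;> try fun_prop
  simp only [one_mul, ← h.ract_mul]
  rw [sw_antipode_right b (fun z => X.ract (v ⊗ₜ z)) (by fun_prop), h.ract_one]

theorem rightProj_of_mem (h : X.IsHopfBimodule) {v : Γ} (hv : X.rco v = v ⊗ₜ 1) :
    X.rightProj v = v := by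
  have := h.rightProj_ract hv 1
  rwa [h.ract_one, Bialgebra.counit_one, one_smul] at this

/-- Since S reverses products, v⁽⁰⁾ S(v⁽¹⁾) carries left multiplication to the adjoint action. -/
theorem rightProj_lact (h : X.IsHopfBimodule) (a : A) (v : Γ) :
    X.rightProj (X.lact (a ⊗ₜ v)) = X.adAct (a ⊗ₜ X.rightProj v) := by
  rw [rightProj_apply, sw_eq_liftLin X.rco _ (fun x c => X.ract (x ⊗ₜ S c)) (by fun_prop)
    (by fun_prop), h.rco_lact_eq]
  simp only [map_sw, liftLin_tmul, adAct_tmul, rightProj_apply, tmul_sw, sw_tmul]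
  simp only [HopfAlgebra.antipode_mul_antidistrib, h.ract_mul, h.lact_ract]
  rw [sw_comm]

theorem rightProj_lact_ract (h : X.IsHopfBimodule) (a : A) {v : Γ} (hv : X.rco v = v ⊗ₜ 1)
    (b : A) : X.rightProj (X.lact (a ⊗ₜ X.ract (v ⊗ₜ b))) = ε b • X.adAct (a ⊗ₜ v) := by
  rw [h.rightProj_lact, h.rightProj_ract hv, TensorProduct.tmul_smul, map_smul]

end IsHopfBimodule

/-! ### The extended bimodule -/

section Extension

variable (X) (d : A →ₗ[k] Γ)

theorem ext_lact_tmul (a : A) (v : Γ × A) : (X.ext d).lact (a ⊗ₜ v) =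
    (X.lact (a ⊗ₜ v.1) + X.ract (d a ⊗ₜ v.2), a * v.2) := rfl

theorem ext_ract_tmul (v : Γ × A) (a : A) : (X.ext d).ract (v ⊗ₜ a) =
    (X.ract (v.1 ⊗ₜ a), v.2 * a) := rfl

theorem ext_lco_apply (v : Γ × A) : (X.ext d).lco v =
    (sw X.lco v.1 fun c x => c ⊗ₜ[k] (x, (0 : A))) + sw Δ v.2 fun c x => c ⊗ₜ[k] ((0 : Γ), x) := by
  change LinearMap.lTensor A (LinearMap.inl k Γ A) (X.lco v.1) +
    LinearMap.lTensor A (LinearMap.inr k Γ A) (Δ v.2) = _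
  rw [eq_sw X.lco, eq_sw Δ]
  simp only [map_sw, LinearMap.lTensor_tmul, LinearMap.inl_apply, LinearMap.inr_apply]

theorem ext_rco_apply (v : Γ × A) : (X.ext d).rco v =
    (sw X.rco v.1 fun x c => (x, (0 : A)) ⊗ₜ[k] c) + sw Δ v.2 fun x c => ((0 : Γ), x) ⊗ₜ[k] c := by
  change LinearMap.rTensor A (LinearMap.inl k Γ A) (X.rco v.1) +
    LinearMap.rTensor A (LinearMap.inr k Γ A) (Δ v.2) = _
  rw [eq_sw X.rco, eq_sw Δ]
  simp only [map_sw, LinearMap.rTensor_tmul, LinearMap.inl_apply, LinearMap.inr_apply]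

variable {X d}

namespace IsBicovariantFODC

variable (hd : X.IsBicovariantFODC d)
include hd

theorem d_one : d 1 = 0 := by
  have := hd.leibniz 1 1
  rw [mul_one, hd.one_lact, hd.ract_one] at this
  exact left_eq_add.mp this

theorem lco_d (a : A) : X.lco (d a) = sw Δ a fun a1 a2 => a1 ⊗ₜ[k] d a2 := by
  have := LinearMap.congr_fun hd.d_lco a
  rw [LinearMap.comp_apply, LinearMap.comp_apply, eq_sw Δ a] at this
  simpa only [map_sw, LinearMap.lTensor_tmul] using this

theorem rco_d (a : A) : X.rco (d a) = sw Δ a fun a1 a2 => d a1 ⊗ₜ[k] a2 := by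
  have := LinearMap.congr_fun hd.d_rco a
  rw [LinearMap.comp_apply, LinearMap.comp_apply, eq_sw Δ a] at this
  simpa only [map_sw, LinearMap.rTensor_tmul] using this

-- The coactions of the extension are direct sums of those of Γ and `A`. The comodule axioms are
-- therefore checked on the two inclusions, through `Intertwines.prod_ext`.
omit hd in
theorem ext_lco_inl : Intertwines (LinearMap.inl k Γ A)
    (TensorProduct.map LinearMap.id (LinearMap.inl k Γ A)) X.lco (X.ext d).lco := fun v => by
  change _ = LinearMap.lTensor A (LinearMap.inl k Γ A) (X.lco v) +
    LinearMap.lTensor A (LinearMap.inr k Γ A) (Δ 0)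
  rw [map_zero, map_zero, add_zero, LinearMap.lTensor]

omit hd in
theorem ext_lco_inr : Intertwines (LinearMap.inr k Γ A)
    (TensorProduct.map LinearMap.id (LinearMap.inr k Γ A)) Δ (X.ext d).lco := fun v => by
  change _ = LinearMap.lTensor A (LinearMap.inl k Γ A) (X.lco 0) +
    LinearMap.lTensor A (LinearMap.inr k Γ A) (Δ v)
  rw [map_zero, map_zero, zero_add, LinearMap.lTensor]

omit hd in
theorem ext_rco_inl : Intertwines (LinearMap.inl k Γ A)
    (TensorProduct.map (LinearMap.inl k Γ A) LinearMap.id) X.rco (X.ext d).rco := fun v => by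
  change _ = LinearMap.rTensor A (LinearMap.inl k Γ A) (X.rco v) +
    LinearMap.rTensor A (LinearMap.inr k Γ A) (Δ 0)
  rw [map_zero, map_zero, add_zero, LinearMap.rTensor]

omit hd in
theorem ext_rco_inr : Intertwines (LinearMap.inr k Γ A)
    (TensorProduct.map (LinearMap.inr k Γ A) LinearMap.id) Δ (X.ext d).rco := fun v => by
  change _ = LinearMap.rTensor A (LinearMap.inl k Γ A) (X.rco 0) +
    LinearMap.rTensor A (LinearMap.inr k Γ A) (Δ v)
  rw [map_zero, map_zero, zero_add, LinearMap.rTensor]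

omit hd in
theorem _root_.BraidedLie.Intertwines.prod_ext {M N Γ Q : Type*} [AddCommGroup M] [Module k M]
    [AddCommGroup N] [Module k N] [AddCommGroup Γ] [Module k Γ] [AddCommGroup Q] [Module k Q]
    {f' g' : Γ × Q →ₗ[k] N} {q₁ : M →ₗ[k] N} {f g : Γ →ₗ[k] M}
    {M' : Type*} [AddCommGroup M'] [Module k M'] {q₂ : M' →ₗ[k] N} {f₂ g₂ : Q →ₗ[k] M'}
    (hf : Intertwines (LinearMap.inl k Γ Q) q₁ f f') (hg : Intertwines (LinearMap.inl k Γ Q) q₁ g g')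
    (h₁ : f = g)
    (hf₂ : Intertwines (LinearMap.inr k Γ Q) q₂ f₂ f')
    (hg₂ : Intertwines (LinearMap.inr k Γ Q) q₂ g₂ g') (h₂ : f₂ = g₂) : f' = g' :=
  LinearMap.prod_ext
    (LinearMap.ext fun m => by rw [LinearMap.comp_apply, LinearMap.comp_apply, ← hf, ← hg, h₁])
    (LinearMap.ext fun m => by rw [LinearMap.comp_apply, LinearMap.comp_apply, ← hf₂, ← hg₂, h₂])

omit hd in
theorem comul_intertwines_id : Intertwines (LinearMap.id : A →ₗ[k] A)
    (TensorProduct.map LinearMap.id LinearMap.id) Δ Δ := fun m => by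
  simp [TensorProduct.map_id]

theorem ext_lco_coassoc : (TensorProduct.assoc k A A (Γ × A)).toLinearMap ∘ₗ
    LinearMap.rTensor (Γ × A) Δ ∘ₗ (X.ext d).lco =
      LinearMap.lTensor A (X.ext d).lco ∘ₗ (X.ext d).lco :=
  Intertwines.prod_ext ((Intertwines.assoc _ _ _).comp ((comul_intertwines_id.rTensor _).comp
        ext_lco_inl)) ((ext_lco_inl.lTensor _).comp ext_lco_inl) hd.lco_coassoc
      ((Intertwines.assoc _ _ _).comp ((comul_intertwines_id.rTensor _).comp
        ext_lco_inr)) ((ext_lco_inr.lTensor _).comp ext_lco_inr) Coalgebra.coassoc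

theorem ext_rco_coassoc : (TensorProduct.assoc k (Γ × A) A A).toLinearMap ∘ₗ
    LinearMap.rTensor A (X.ext d).rco ∘ₗ (X.ext d).rco =
      LinearMap.lTensor (Γ × A) Δ ∘ₗ (X.ext d).rco :=
  Intertwines.prod_ext ((Intertwines.assoc _ _ _).comp ((ext_rco_inl.rTensor _).comp
        ext_rco_inl)) ((comul_intertwines_id.lTensor _).comp ext_rco_inl) hd.rco_coassoc
      ((Intertwines.assoc _ _ _).comp ((ext_rco_inr.rTensor _).comp
        ext_rco_inr)) ((comul_intertwines_id.lTensor _).comp ext_rco_inr) Coalgebra.coassoc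

theorem ext_lco_rco : (TensorProduct.assoc k A (Γ × A) A).toLinearMap ∘ₗ
    LinearMap.rTensor A (X.ext d).lco ∘ₗ (X.ext d).rco =
      LinearMap.lTensor A (X.ext d).rco ∘ₗ (X.ext d).lco :=
  Intertwines.prod_ext ((Intertwines.assoc _ _ _).comp ((ext_lco_inl.rTensor _).comp
        ext_rco_inl)) ((ext_rco_inl.lTensor _).comp ext_lco_inl) hd.lco_rco
      ((Intertwines.assoc _ _ _).comp ((ext_lco_inr.rTensor _).comp
        ext_rco_inr)) ((ext_rco_inr.lTensor _).comp ext_lco_inr) Coalgebra.coassoc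

omit hd in
theorem sw_ext_lco (v : Γ × A) (F : A → Γ × A → M) (h1 : ∀ y, Lin k fun x => F x y)
    (h2 : ∀ x, Lin k fun y => F x y) : sw (X.ext d).lco v F =
      (sw X.lco v.1 fun c x => F c (x, 0)) + sw Δ v.2 fun c x => F c (0, x) := by
  rw [sw_eq_liftLin _ v F h1 h2, ext_lco_apply]
  simp only [map_add, map_sw, liftLin_tmul]

omit hd in
theorem sw_ext_rco (v : Γ × A) (F : Γ × A → A → M) (h1 : ∀ y, Lin k fun x => F x y)
    (h2 : ∀ x, Lin k fun y => F x y) : sw (X.ext d).rco v F =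
      (sw X.rco v.1 fun x c => F (x, 0) c) + sw Δ v.2 fun x c => F (0, x) c := by
  rw [sw_eq_liftLin _ v F h1 h2, ext_rco_apply]
  simp only [map_add, map_sw, liftLin_tmul]

omit hd in
theorem sw_of_eq_sw {P Q V P' Q' V' : Type*} [AddCommMonoid P] [Module k P] [AddCommMonoid Q]
    [Module k Q] [AddCommMonoid V] [Module k V] [AddCommMonoid P'] [Module k P']
    [AddCommMonoid Q'] [Module k Q'] [AddCommMonoid V'] [Module k V'] {δ : V →ₗ[k] P ⊗[k] Q}
    {v : V} {δ' : V' →ₗ[k] P' ⊗[k] Q'} {v' : V'} {g : P' → Q' → P ⊗[k] Q}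
    (h : δ v = sw δ' v' g) (F : P → Q → M) (h1 : ∀ y, Lin k fun x => F x y)
    (h2 : ∀ x, Lin k fun y => F x y) :
    sw δ v F = sw δ' v' fun p q => liftLin F h1 h2 (g p q) := by
  rw [sw_eq_liftLin δ v F h1 h2, h, map_sw]

/-- The left action is the only operation mixing the two summands, by the term da · c; colinearity
of `d` controls the coaction of that term. -/
theorem ext_lco_lact (a : A) (v : Γ × A) : (X.ext d).lco ((X.ext d).lact (a ⊗ₜ v)) =
    sw Δ a fun a1 a2 => sw (X.ext d).lco v fun c x => (a1 * c) ⊗ₜ[k] (X.ext d).lact (a2 ⊗ₜ x) := by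
  simp (disch := fun_prop) only [sw_ext_lco]
  simp only [ext_lact_tmul, TensorProduct.tmul_zero, map_zero, add_zero, zero_add, mul_zero]
  rw [ext_lco_apply, sw_eq_liftLin X.lco _ (fun c x => c ⊗ₜ[k] (x, (0 : A))) (by fun_prop)
    (by fun_prop), map_add, map_add, hd.lco_lact_eq, hd.lco_ract_eq, sw_mul] <;> try fun_prop
  rw [sw_of_eq_sw (hd.lco_d a)] <;> try fun_prop
  simp only [map_sw, liftLin_tmul, sw_add]
  rw [add_assoc, ← sw_add]
  simp only [← sw_add, ← TensorProduct.tmul_add, Prod.mk_add_mk, add_zero, zero_add]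

theorem ext_rco_lact (a : A) (v : Γ × A) : (X.ext d).rco ((X.ext d).lact (a ⊗ₜ v)) =
    sw Δ a fun a1 a2 => sw (X.ext d).rco v fun x c => (X.ext d).lact (a1 ⊗ₜ x) ⊗ₜ[k] (a2 * c) := by
  simp (disch := fun_prop) only [sw_ext_rco]
  simp only [ext_lact_tmul, TensorProduct.tmul_zero, map_zero, add_zero, zero_add, mul_zero]
  rw [ext_rco_apply, sw_eq_liftLin X.rco _ (fun x c => (x, (0 : A)) ⊗ₜ[k] c) (by fun_prop)
    (by fun_prop), map_add, map_add, hd.rco_lact_eq, hd.rco_ract_eq, sw_mul] <;> try fun_prop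
  rw [sw_of_eq_sw (hd.rco_d a)] <;> try fun_prop
  simp only [map_sw, liftLin_tmul, sw_add]
  rw [add_assoc, ← sw_add]
  simp only [← sw_add, ← TensorProduct.add_tmul, Prod.mk_add_mk, add_zero, zero_add]

theorem ext_lco_ract (v : Γ × A) (a : A) : (X.ext d).lco ((X.ext d).ract (v ⊗ₜ a)) =
    sw (X.ext d).lco v fun c x => sw Δ a fun b1 b2 => (c * b1) ⊗ₜ[k] (X.ext d).ract (x ⊗ₜ b2) := by
  simp (disch := fun_prop) only [sw_ext_lco]
  simp only [ext_ract_tmul, TensorProduct.zero_tmul, map_zero, add_zero, zero_add, zero_mul]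
  rw [ext_lco_apply, sw_eq_liftLin X.lco _ (fun c x => c ⊗ₜ[k] (x, (0 : A))) (by fun_prop)
    (by fun_prop), hd.lco_ract_eq, sw_mul] <;> try fun_prop
  simp only [map_sw, liftLin_tmul]

theorem ext_rco_ract (v : Γ × A) (a : A) : (X.ext d).rco ((X.ext d).ract (v ⊗ₜ a)) =
    sw (X.ext d).rco v fun x c => sw Δ a fun b1 b2 => (X.ext d).ract (x ⊗ₜ b1) ⊗ₜ[k] (c * b2) := by
  simp (disch := fun_prop) only [sw_ext_rco]
  simp only [ext_ract_tmul, TensorProduct.zero_tmul, map_zero, add_zero, zero_add, zero_mul]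
  rw [ext_rco_apply, sw_eq_liftLin X.rco _ (fun x c => (x, (0 : A)) ⊗ₜ[k] c) (by fun_prop)
    (by fun_prop), hd.rco_ract_eq, sw_mul] <;> try fun_prop
  simp only [map_sw, liftLin_tmul]

theorem ext_isHopfBimodule : (X.ext d).IsHopfBimodule :=
  { one_lact := fun v => by
      rw [ext_lact_tmul, hd.d_one, TensorProduct.zero_tmul, map_zero, add_zero, hd.one_lact, one_mul]
    -- The Leibniz rule is what makes a Θ = da + Θ a an associative left action.
    mul_lact := fun a b v => by
      simp only [ext_lact_tmul, hd.leibniz, hd.mul_lact, TensorProduct.add_tmul,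
        TensorProduct.tmul_add, map_add, hd.ract_mul, hd.lact_ract, mul_assoc]
      rw [add_assoc, add_comm (X.ract _)]
    ract_one := fun v => by
      rw [ext_ract_tmul, hd.ract_one, mul_one]
    ract_mul := fun v a b => by
      simp only [ext_ract_tmul, hd.ract_mul, mul_assoc]
    lact_ract := fun a v b => by
      simp only [ext_lact_tmul, ext_ract_tmul, hd.lact_ract, hd.ract_mul, mul_assoc,
        TensorProduct.add_tmul, map_add]
    lco_coassoc := hd.ext_lco_coassoc
    rco_coassoc := hd.ext_rco_coassoc
    lco_rco := hd.ext_lco_rco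
    lco_counit := fun v => by
      rw [ext_lco_apply]
      simp only [map_add, map_sw, LinearMap.rTensor_tmul]
      have e1 := congrArg (LinearMap.lTensor k (LinearMap.inl k Γ A)) (hd.lco_counit v.1)
      have e2 := congrArg (LinearMap.lTensor k (LinearMap.inr k Γ A))
        (Coalgebra.rTensor_counit_comul (R := k) v.2)
      rw [eq_sw X.lco] at e1
      rw [eq_sw Δ] at e2
      simp only [map_sw, LinearMap.rTensor_tmul, LinearMap.lTensor_tmul, LinearMap.inl_apply,
        LinearMap.inr_apply] at e1 e2
      rw [e1, e2, ← TensorProduct.tmul_add, Prod.mk_add_mk, add_zero, zero_add]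
    rco_counit := fun v => by
      rw [ext_rco_apply]
      simp only [map_add, map_sw, LinearMap.lTensor_tmul]
      have e1 := congrArg (LinearMap.rTensor k (LinearMap.inl k Γ A)) (hd.rco_counit v.1)
      have e2 := congrArg (LinearMap.rTensor k (LinearMap.inr k Γ A))
        (Coalgebra.lTensor_counit_comul (R := k) v.2)
      rw [eq_sw X.rco] at e1
      rw [eq_sw Δ] at e2
      simp only [map_sw, LinearMap.rTensor_tmul, LinearMap.lTensor_tmul, LinearMap.inl_apply,
        LinearMap.inr_apply] at e1 e2
      rw [e1, e2, ← TensorProduct.add_tmul, Prod.mk_add_mk, add_zero, zero_add]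
    lco_lact := TensorProduct.ext' fun a v =>
      (hd.ext_lco_lact a v).trans ((X.ext d).map_mul_lact_swapMid a v).symm
    lco_ract := TensorProduct.ext' fun v a =>
      (hd.ext_lco_ract v a).trans ((X.ext d).map_mul_ract_swapMid a v).symm
    rco_lact := TensorProduct.ext' fun a v =>
      (hd.ext_rco_lact a v).trans ((X.ext d).map_lact_mul_swapMid a v).symm
    rco_ract := TensorProduct.ext' fun v a =>
      (hd.ext_rco_ract v a).trans ((X.ext d).map_ract_mul_swapMid a v).symm }

end IsBicovariantFODC
end Extension

end BiData

/-! ### Quotients of the braided group by left ideals that are adjoint subcomodules. -/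

section Descent

variable {k : Type*} {A : Type*} [Field k] [Ring A] [HopfAlgebra k A]
variable {V : Type*} [AddCommGroup V] [Module k V]

local notation "Δ" => Coalgebra.comul (R := k)
local notation "ε" => Coalgebra.counit (R := k)
local notation "S" => HopfAlgebra.antipode k
local notation "ad" => adL (k := k) (A := A)

/-- The kernel of `π` is a left ideal and a subcomodule for the adjoint coaction. -/
structure IsCrossedQuotient (π : A →ₗ[k] V) : Prop where
  surjective : Function.Surjective π
  adL : ∀ a, π a = 0 → LinearMap.lTensor A π (ad a) = 0
  mul : ∀ a b, π b = 0 → π (a * b) = 0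

theorem sw_eq_lTensor {P Q Q' W M : Type*} [AddCommMonoid P] [Module k P] [AddCommMonoid Q]
    [Module k Q] [AddCommMonoid Q'] [Module k Q'] [AddCommMonoid W] [Module k W] [AddCommMonoid M]
    [Module k M] (δ : W →ₗ[k] P ⊗[k] Q) (π : Q →ₗ[k] Q') (w : W) (F : P → Q' → M)
    (h1 : ∀ y, Lin k fun x => F x y) (h2 : ∀ x, Lin k fun y => F x y) :
    (sw δ w fun c x => F c (π x)) = liftLin F h1 h2 (LinearMap.lTensor P π (δ w)) := by
  rw [eq_sw δ w]
  simp only [map_sw, LinearMap.lTensor_tmul, liftLin_tmul]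

namespace IsCrossedQuotient

variable {r : A ⊗[k] A →ₗ[k] k} {π : A →ₗ[k] V} (hπ : IsCrossedQuotient π)
include hπ

local notation:70 c " ▹ " b:71 => cqtAct r ad (c ⊗ₜ[k] b)
local notation:70 a " ⊙ " b:71 => uMul r (a ⊗ₜ[k] b)

/-- A subcomodule is stable under ▷, and the left ideal absorbs the factor a₁ in a₁ (S(a₂) ▷ b). -/
theorem uMul_right (a : A) {b : A} (hb : π b = 0) : π (a ⊙ b) = 0 := by
  have hact (c : A) : π (c ▹ b) = 0 := by
    rw [cqtAct_tmul, map_sw]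
    simp only [map_smul]
    rw [sw_eq_lTensor ad π b (fun e y => r (e ⊗ₜ c) • y) (by fun_prop) (by fun_prop),
      hπ.adL b hb, map_zero]
  rw [uMul_tmul, map_sw]
  exact (sw_congr fun a1 a2 => hπ.mul a1 _ (hact _)).trans Finset.sum_const_zero

/-- In a₁ (S(a₂) ▷ b) the kernel element stands on the left, where a left ideal gives no
information. The flipped formula r(b₁, a⁽⁻¹⁾) b₂ a⁽⁰⁾ moves it to the right. -/
theorem uMul_left (hr : IsCoquasitriangular r) {a : A} (b : A) (ha : π a = 0) :
    π (a ⊙ b) = 0 := by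
  obtain ⟨s, hs⟩ := π.exists_rightInverse_of_surjective (LinearMap.range_eq_top.mpr hπ.surjective)
  -- The left ideal property makes π(b x) a function of π(x). With the section `s` the sum then
  -- factors through (id ⊗ π) ad_L(a), which is zero.
  have hmul (b x : A) : π (b * x) = π (b * s (π x)) := by
    rw [← sub_eq_zero, ← map_sub, ← mul_sub]
    apply hπ.mul
    rw [map_sub, ← LinearMap.comp_apply, hs, LinearMap.id_apply, sub_self]
  rw [hr.uMul_eq]
  simp only [map_sw, map_smul]
  refine (sw_congr fun c y => sw_congr fun b1 b2 => congrArg (r (b1 ⊗ₜ c) • ·) (hmul _ _)).trans ?_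
  rw [sw_eq_lTensor ad π a (fun c y => sw Δ b fun b1 b2 => r (b1 ⊗ₜ c) • π (b2 * s y))
    (by fun_prop) (by fun_prop), hπ.adL a ha, map_zero]

/-- The quotient of the braided group by a crossed submodule. -/
theorem exists_braidedLieCoalgebra (hr : IsCoquasitriangular r) :
    ∃ C : BraidedLieCoalgebra r V,
      (∀ a, C.coact (π a) = LinearMap.lTensor A π (ad a)) ∧
      (∀ a b, C.mul (π a ⊗ₜ π b) = π (a ⊙ b)) ∧ C.one = π 1 ∧
      (∀ a, C.cobracket (π a) = TensorProduct.map π π (ad a)) := by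
  -- The induced operations are computed on the representatives chosen by a linear section;
  -- `hcoact`, `hmul` and `hcobr` show that the choice does not matter.
  obtain ⟨s, hs⟩ := π.exists_rightInverse_of_surjective (LinearMap.range_eq_top.mpr hπ.surjective)
  have hs' (a : A) : π (s (π a) - a) = 0 := by
    rw [map_sub, ← LinearMap.comp_apply, hs, LinearMap.id_apply, sub_self]
  have hcoact (a : A) : LinearMap.lTensor A π (ad (s (π a))) = LinearMap.lTensor A π (ad a) := by
    rw [← sub_eq_zero, ← map_sub, ← map_sub, hπ.adL _ (hs' a)]
  have hmul (a b : A) : π (s (π a) ⊙ s (π b)) = π (a ⊙ b) := by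
    have h1 := hπ.uMul_left hr (s (π b)) (hs' a)
    have h2 := hπ.uMul_right (r := r) a (hs' b)
    rw [TensorProduct.sub_tmul, map_sub, map_sub, sub_eq_zero] at h1
    rw [TensorProduct.tmul_sub, map_sub, map_sub, sub_eq_zero] at h2
    rw [h1, h2]
  have hcobr (a : A) : LinearMap.rTensor V π (LinearMap.lTensor A π (ad (s (π a)))) =
      TensorProduct.map π π (ad a) := by
    rw [hcoact, ← LinearMap.comp_apply, LinearMap.rTensor_comp_lTensor]
  refine ⟨hr.braidedGroup.ofSurjective π hπ.surjective (LinearMap.lTensor A π ∘ₗ ad ∘ₗ s)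
    (π ∘ₗ uMul r ∘ₗ TensorProduct.map s s) (π 1)
    (LinearMap.rTensor V π ∘ₗ LinearMap.lTensor A π ∘ₗ ad ∘ₗ s) (fun a => (hcoact a).symm) ?_ rfl
    (fun a => (hcobr a).symm), hcoact, hmul, rfl, hcobr⟩
  intro t
  change (π ∘ₗ uMul r) t = (π ∘ₗ uMul r ∘ₗ TensorProduct.map s s ∘ₗ TensorProduct.map π π) t
  congr 1
  ext a b
  exact (hmul a b).symm

end IsCrossedQuotient
end Descent

/-! ### The extended Maurer-Cartan map and the extended cotangent space. -/

namespace BiData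

variable {k : Type*} {A : Type*} [Field k] [Ring A] [HopfAlgebra k A]
variable {Γ : Type*} [AddCommGroup Γ] [Module k Γ] {X : BiData k A Γ} {d : A →ₗ[k] Γ}

local notation "Δ" => Coalgebra.comul (R := k)
local notation "ε" => Coalgebra.counit (R := k)
local notation "S" => HopfAlgebra.antipode k
local notation "ad" => adL (k := k) (A := A)

namespace IsBicovariantFODC

variable (hd : X.IsBicovariantFODC d)

theorem extOmega_apply (a : A) : X.extOmega d a = (X.ext d).adAct (a ⊗ₜ ((0 : Γ), (1 : A))) := rfl

theorem ext_lco_unit : (X.ext d).lco ((0 : Γ), (1 : A)) = 1 ⊗ₜ ((0 : Γ), (1 : A)) := by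
  rw [show ((0 : Γ), (1 : A)) = LinearMap.inr k Γ A 1 from rfl, ← ext_lco_inr,
    Bialgebra.comul_one, Algebra.TensorProduct.one_def, TensorProduct.map_tmul, LinearMap.id_apply]

theorem ext_rco_unit : (X.ext d).rco ((0 : Γ), (1 : A)) = ((0 : Γ), (1 : A)) ⊗ₜ 1 := by
  rw [show ((0 : Γ), (1 : A)) = LinearMap.inr k Γ A 1 from rfl, ← ext_rco_inr,
    Bialgebra.comul_one, Algebra.TensorProduct.one_def, TensorProduct.map_tmul, LinearMap.id_apply]

include hd

theorem extOmega_mul (a b : A) :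
    X.extOmega d (a * b) = (X.ext d).adAct (a ⊗ₜ X.extOmega d b) :=
  hd.ext_isHopfBimodule.adAct_mul a b _

-- The Θ-component of a₁ Θ S(a₂) is a₁ S(a₂). Hence ε factors through the right invariants, which
-- yields the counit of the cotangent space and places ε in the extended tangent space.
omit hd in
theorem extOmega_snd (a : A) : (X.extOmega d a).2 = ε a • 1 := by
  rw [extOmega_apply, adAct_tmul, ← LinearMap.snd_apply (R := k), map_sw]
  simp only [LinearMap.snd_apply, ext_ract_tmul, ext_lact_tmul, mul_one]
  exact sw_antipode_right a (fun z => z) (by fun_prop)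

theorem lco_extOmega (a : A) :
    (X.ext d).lco (X.extOmega d a) = LinearMap.lTensor A (X.extOmega d) (ad a) := by
  rw [extOmega_apply, hd.ext_isHopfBimodule.lco_adAct a ext_lco_unit, eq_sw ad a, map_sw]
  simp only [LinearMap.lTensor_tmul, extOmega_apply]

theorem extOmega_mem (a : A) : X.extOmega d a ∈ X.extCotangent d :=
  mem_rightInv.mpr (hd.ext_isHopfBimodule.rco_adAct a ext_rco_unit)

/-- The extended Maurer-Cartan map, with values in the right invariants. -/
def omegaR : A →ₗ[k] X.extCotangent d :=
  (X.extOmega d).codRestrict _ hd.extOmega_mem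

theorem coe_omegaR (a : A) : (hd.omegaR a : Γ × A) = X.extOmega d a := rfl

/-- The extended bimodule is spanned by the elements aΘb, because a db = (ab)Θ − aΘb, and the
projection sends aΘb to ε(b) a ▷ Θ. -/
theorem rightProj_mem_range (w : Γ × A) :
    (X.ext d).rightProj w ∈ LinearMap.range (X.extOmega d) := by
  have hH := hd.ext_isHopfBimodule
  have h2 (a b : A) : (X.ext d).rightProj ((X.ext d).lact (a ⊗ₜ (X.ext d).ract
      (((0 : Γ), (1 : A)) ⊗ₜ b))) ∈ LinearMap.range (X.extOmega d) := by
    rw [hH.rightProj_lact_ract a ext_rco_unit]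
    exact Submodule.smul_mem _ _ ⟨a, rfl⟩
  have h1 (a b : A) : (X.ext d).rightProj (X.lact (a ⊗ₜ d b), (0 : A)) ∈
      LinearMap.range (X.extOmega d) := by
    have : (X.lact (a ⊗ₜ d b), (0 : A)) =
        (X.ext d).lact ((a * b) ⊗ₜ (X.ext d).ract (((0 : Γ), (1 : A)) ⊗ₜ 1)) -
        (X.ext d).lact (a ⊗ₜ (X.ext d).ract (((0 : Γ), (1 : A)) ⊗ₜ b)) := by
      simp [ext_lact_tmul, ext_ract_tmul, hd.ract_one, hd.leibniz, TensorProduct.add_tmul]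
    rw [this, map_sub]
    exact Submodule.sub_mem _ (h2 _ _) (h2 _ _)
  have h3 (v : Γ) : (X.ext d).rightProj (v, (0 : A)) ∈ LinearMap.range (X.extOmega d) := by
    obtain ⟨t, rfl⟩ := hd.surj v
    induction t using TensorProduct.induction_on with
    | zero => rw [map_zero, show ((0 : Γ), (0 : A)) = 0 from rfl, map_zero]; exact zero_mem _
    | tmul a b => exact h1 a b
    | add x y hx hy =>
      rw [map_add, ← add_zero (0 : A), ← Prod.mk_add_mk, map_add]
      exact add_mem hx hy
  have : w = (w.1, 0) + (X.ext d).lact (1 ⊗ₜ (X.ext d).ract (((0 : Γ), (1 : A)) ⊗ₜ w.2)) := by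
    rw [hH.one_lact, ext_ract_tmul]
    simp
  rw [this, map_add]
  exact add_mem (h3 _) (h2 _ _)

theorem omegaR_surjective : Function.Surjective hd.omegaR := by
  rintro ⟨v, hv⟩
  obtain ⟨a, ha⟩ := hd.rightProj_mem_range v
  rw [hd.ext_isHopfBimodule.rightProj_of_mem (mem_rightInv.mp hv)] at ha
  exact ⟨a, Subtype.ext ha⟩

theorem lTensor_subtype_omegaR (a : A) : LinearMap.lTensor A (X.extCotangent d).subtype
    (LinearMap.lTensor A hd.omegaR (ad a)) = (X.ext d).lco (X.extOmega d a) := by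
  rw [← LinearMap.comp_apply, ← LinearMap.lTensor_comp, hd.lco_extOmega]
  rfl

theorem omegaR_eq_zero_iff (a : A) : hd.omegaR a = 0 ↔ a ∈ X.ideal d := by
  rw [ideal, LinearMap.mem_ker, ← hd.coe_omegaR]
  exact Subtype.ext_iff

theorem isCrossedQuotient : IsCrossedQuotient hd.omegaR where
  surjective := hd.omegaR_surjective
  -- Δ_L of the Maurer-Cartan form is (id ⊗ ω̃_R) ad_L, computed in Γ ⊕ ΘA; by flatness nothing is
  -- lost in passing from the right invariants to the whole bimodule.
  adL a ha := by
    apply Module.Flat.lTensor_preserves_injective_linearMap (M := A) _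
      (X.extCotangent d).subtype_injective
    rw [hd.lTensor_subtype_omegaR, ← hd.coe_omegaR, ha, map_zero, Submodule.coe_zero, map_zero]
  mul a b hb := by
    apply Subtype.ext
    rw [hd.coe_omegaR, hd.extOmega_mul, ← hd.coe_omegaR, hb, Submodule.coe_zero,
      TensorProduct.tmul_zero, map_zero]

/-- The isomorphism of `A / I` with the extended cotangent space. -/
def quotEquiv : (A ⧸ X.ideal d) ≃ₗ[k] X.extCotangent d :=
  (Submodule.quotEquivOfEq _ _ (by
    ext a
    rw [LinearMap.mem_ker, hd.omegaR_eq_zero_iff])).trans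
    (hd.omegaR.quotKerEquivOfSurjective hd.omegaR_surjective)

/-- The extended cotangent space is a counital braided Lie coalgebra. -/
theorem extCotangent_braidedLieCoalgebra (r : A ⊗[k] A →ₗ[k] k) (hr : IsCoquasitriangular r) :
    ∃ (C : BraidedLieCoalgebra r (X.extCotangent d)) (e : X.extCotangent d →ₗ[k] k)
      (f : (A ⧸ X.ideal d) ≃ₗ[k] X.extCotangent d),
      C.IsCounit e ∧
      (∀ v : X.extCotangent d,
        LinearMap.lTensor A (X.extCotangent d).subtype (C.coact v) = (X.ext d).lco v) ∧
      (∀ a : A, (f (Submodule.Quotient.mk a) : Γ × A) = X.extOmega d a) ∧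
      (∀ a b : A, (f (Submodule.Quotient.mk (a * b)) : Γ × A) =
        (X.ext d).adAct (a ⊗ₜ[k] (f (Submodule.Quotient.mk b) : Γ × A))) ∧
      (∀ a : A, C.coact (f (Submodule.Quotient.mk a)) =
        LinearMap.lTensor A (f.toLinearMap ∘ₗ (X.ideal d).mkQ) (adL a)) ∧
      (∀ a b : A, C.mul (f (Submodule.Quotient.mk a) ⊗ₜ f (Submodule.Quotient.mk b)) =
        f (Submodule.Quotient.mk (uMul r (a ⊗ₜ b)))) ∧
      C.one = f (Submodule.Quotient.mk 1) ∧
      (∀ a : A, C.cobracket (f (Submodule.Quotient.mk a)) =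
        TensorProduct.map (f.toLinearMap ∘ₗ (X.ideal d).mkQ) (f.toLinearMap ∘ₗ (X.ideal d).mkQ)
          (adL a)) ∧
      (∀ a : A, e (f (Submodule.Quotient.mk a)) = Coalgebra.counit (R := k) a) := by
  obtain ⟨C, hcoact, hmul, hone, hcobr⟩ := hd.isCrossedQuotient.exists_braidedLieCoalgebra hr
  have he (a : A) : (ε ∘ₗ LinearMap.snd k Γ A ∘ₗ (X.extCotangent d).subtype) (hd.omegaR a) =
      ε a := by
    simp only [LinearMap.comp_apply, Submodule.subtype_apply, hd.coe_omegaR, LinearMap.snd_apply,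
      extOmega_snd, map_smul, Bialgebra.counit_one, smul_eq_mul, mul_one]
  -- The counit applies ε to the Θ-component.
  refine ⟨C, ε ∘ₗ LinearMap.snd k Γ A ∘ₗ (X.extCotangent d).subtype, hd.quotEquiv,
    hr.braidedGroup_isCounit.of_surjective hd.omegaR hd.omegaR_surjective
      (fun a => (hcoact a).symm) ?_ hone.symm (fun a => (hcobr a).symm) (LinearMap.ext he),
    ?_, fun a => rfl, hd.extOmega_mul, hcoact, hmul, hone, hcobr, he⟩
  · intro t
    simp only [← LinearMap.comp_apply]
    congr 1
    refine TensorProduct.ext' fun a b => ?_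
    exact (hmul a b).symm
  · intro v
    obtain ⟨a, rfl⟩ := hd.omegaR_surjective v
    rw [hcoact, hd.lTensor_subtype_omegaR]
    rfl

end IsBicovariantFODC
end BiData

/-! ### Transposition along injective pairings. -/

section Transpose

variable {k : Type*} [Field k]
variable {M N P Q R T M' N' P' Q' R' T' E : Type*}
  [AddCommGroup M] [Module k M] [AddCommGroup N] [Module k N] [AddCommGroup P] [Module k P]
  [AddCommGroup Q] [Module k Q] [AddCommGroup R] [Module k R] [AddCommGroup T] [Module k T]
  [AddCommGroup M'] [Module k M'] [AddCommGroup N'] [Module k N'] [AddCommGroup P'] [Module k P']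
  [AddCommGroup Q'] [Module k Q'] [AddCommGroup R'] [Module k R'] [AddCommGroup T'] [Module k T']
  [AddCommGroup E] [Module k E]

/-- Contraction of the first tensor factor with `v` under a pairing `b`. -/
def slice (b : M →ₗ[k] Module.Dual k M') (v : M') : M ⊗[k] E →ₗ[k] E :=
  (TensorProduct.lid k E).toLinearMap ∘ₗ LinearMap.rTensor E (LinearMap.applyₗ v ∘ₗ b)

theorem slice_tmul (b : M →ₗ[k] Module.Dual k M') (v : M') (m : M) (x : E) :
    slice b v (m ⊗ₜ x) = b m v • x := rfl

/-- Expansion in a basis of `E` reduces the claim to injectivity of `b`; the pairing need not be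
perfect and no space need be finite dimensional. -/
theorem slice_ext {b : M →ₗ[k] Module.Dual k M'} (hb : Function.Injective b) {s t : M ⊗[k] E}
    (h : ∀ v, slice b v s = slice b v t) : s = t := by
  rw [← sub_eq_zero]
  have h' (v : M') : slice b v (s - t) = 0 := by rw [map_sub, h, sub_self]
  generalize s - t = u at h'
  obtain ⟨c, rfl⟩ := TensorProduct.eq_repr_basis_right (Module.Basis.ofVectorSpace k E) u
  refine Finset.sum_eq_zero fun i hi => ?_
  suffices hc : c i = 0 by simp only [hc, TensorProduct.zero_tmul]
  apply hb
  ext v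
  have := h' v
  rw [Finsupp.sum, map_sum] at this
  simp only [slice_tmul] at this
  rw [map_zero, LinearMap.zero_apply]
  exact linearIndependent_iff'.mp (Module.Basis.ofVectorSpace k E).linearIndependent c.support
    (fun i => b (c i) v) this i hi

/-- The tensor product of two pairings. -/
def pairing (b : M →ₗ[k] Module.Dual k M') (c : N →ₗ[k] Module.Dual k N') :
    M ⊗[k] N →ₗ[k] Module.Dual k (M' ⊗[k] N') :=
  TensorProduct.dualDistrib k M' N' ∘ₗ TensorProduct.map b c

theorem pairing_tmul (b : M →ₗ[k] Module.Dual k M') (c : N →ₗ[k] Module.Dual k N')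
    (m : M) (n : N) (m' : M') (n' : N') :
    pairing b c (m ⊗ₜ n) (m' ⊗ₜ n') = b m m' * c n n' := rfl

theorem pairing_apply_tmul (b : M →ₗ[k] Module.Dual k M') (c : N →ₗ[k] Module.Dual k N')
    (t : M ⊗[k] N) (m' : M') (n' : N') :
    pairing b c t (m' ⊗ₜ n') = c (slice b m' t) n' := by
  induction t using TensorProduct.induction_on with
  | zero => simp
  | add x y hx hy => simp only [map_add, LinearMap.add_apply, hx, hy]
  | tmul m n => rw [pairing_tmul, slice_tmul, map_smul, LinearMap.smul_apply, smul_eq_mul]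

theorem pairing_injective {b : M →ₗ[k] Module.Dual k M'} {c : N →ₗ[k] Module.Dual k N'}
    (hb : Function.Injective b) (hc : Function.Injective c) :
    Function.Injective (pairing b c) := fun s t h => slice_ext hb fun v => hc <| by
  ext w
  rw [← pairing_apply_tmul, h, pairing_apply_tmul]

/-- `f` is the transpose of `g` with respect to the pairings `b` and `c`. -/
def Transposes (b : M →ₗ[k] Module.Dual k M') (c : N →ₗ[k] Module.Dual k N')
    (g : M →ₗ[k] N) (f : N' →ₗ[k] M') : Prop :=
  ∀ m n', c (g m) n' = b m (f n')

namespace Transposes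

variable {b : M →ₗ[k] Module.Dual k M'} {c : N →ₗ[k] Module.Dual k N'}
  {d : P →ₗ[k] Module.Dual k P'} {e : Q →ₗ[k] Module.Dual k Q'}

theorem id : Transposes b b LinearMap.id LinearMap.id := fun _ _ => rfl

theorem comp {g : N →ₗ[k] P} {f : P' →ₗ[k] N'} {g' : M →ₗ[k] N} {f' : N' →ₗ[k] M'}
    (h : Transposes c d g f) (h' : Transposes b c g' f') : Transposes b d (g ∘ₗ g') (f' ∘ₗ f) :=
  fun _ _ => (h _ _).trans (h' _ _)

theorem map {g : M →ₗ[k] N} {f : N' →ₗ[k] M'} {g' : P →ₗ[k] Q} {f' : Q' →ₗ[k] P'}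
    (h : Transposes b c g f) (h' : Transposes d e g' f') :
    Transposes (pairing b d) (pairing c e) (TensorProduct.map g g') (TensorProduct.map f f') := by
  intro s t
  induction s using TensorProduct.induction_on with
  | zero => simp
  | add x y hx hy => simp only [map_add, LinearMap.add_apply, hx, hy]
  | tmul m p =>
    induction t using TensorProduct.induction_on with
    | zero => simp
    | add x y hx hy => simp only [map_add, hx, hy]
    | tmul n q => simp only [TensorProduct.map_tmul, pairing_tmul, h m n, h' p q]

theorem rTensor (d : P →ₗ[k] Module.Dual k P') {g : M →ₗ[k] N} {f : N' →ₗ[k] M'}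
    (h : Transposes b c g f) :
    Transposes (pairing b d) (pairing c d) (LinearMap.rTensor P g) (LinearMap.rTensor P' f) :=
  h.map id

theorem lTensor (d : P →ₗ[k] Module.Dual k P') {g : M →ₗ[k] N} {f : N' →ₗ[k] M'}
    (h : Transposes b c g f) :
    Transposes (pairing d b) (pairing d c) (LinearMap.lTensor P g) (LinearMap.lTensor P' f) :=
  id.map h

theorem assoc (b : M →ₗ[k] Module.Dual k M') (c : N →ₗ[k] Module.Dual k N')
    (d : P →ₗ[k] Module.Dual k P') :
    Transposes (pairing (pairing b c) d) (pairing b (pairing c d))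
      (TensorProduct.assoc k M N P).toLinearMap
      (TensorProduct.assoc k M' N' P').symm.toLinearMap := by
  intro s t
  have : ((pairing b (pairing c d)) ∘ₗ (TensorProduct.assoc k M N P).toLinearMap) =
      (TensorProduct.assoc k M' N' P').symm.toLinearMap.dualMap ∘ₗ pairing (pairing b c) d := by
    ext _ _ _ _ _ _
    simp [pairing, mul_assoc]
  exact LinearMap.congr_fun (LinearMap.congr_fun this s) t

theorem symm {g : M ≃ₗ[k] N} {f : N' ≃ₗ[k] M'}
    (h : Transposes b c g.toLinearMap f.toLinearMap) :
    Transposes c b g.symm.toLinearMap f.symm.toLinearMap := fun m n => by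
  have := h (g.symm m) (f.symm n)
  simpa using this.symm

theorem mid (b : M →ₗ[k] Module.Dual k M') (e : Q →ₗ[k] Module.Dual k Q')
    {c₂ : R →ₗ[k] Module.Dual k R'} {d₂ : T →ₗ[k] Module.Dual k T'}
    {φ : N ⊗[k] P →ₗ[k] R ⊗[k] T} {ψ : R' ⊗[k] T' →ₗ[k] N' ⊗[k] P'}
    (h : Transposes (pairing c d) (pairing c₂ d₂) φ ψ) :
    Transposes (pairing (pairing b c) (pairing d e)) (pairing (pairing b c₂) (pairing d₂ e))
      (BraidedLie.mid φ) (BraidedLie.mid ψ) :=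
  (assoc b c₂ (pairing d₂ e)).symm.comp
    ((((assoc c₂ d₂ e).comp ((h.rTensor e).comp (assoc c d e).symm)).lTensor b).comp
      (assoc b c (pairing d e)))

/-- The contravariant counterpart of `Intertwines.eq_of_injective`. It lets each braided Lie algebra
axiom be read off from the transposed axiom of the coalgebra. -/
theorem unique {g g' : M →ₗ[k] N} {f f' : N' →ₗ[k] M'} (h : Transposes b c g f)
    (h' : Transposes b c g' f') (hc : Function.Injective c) (hf : f = f') : g = g' := by
  ext m
  apply hc
  ext n
  rw [h, h', hf]

end Transposes

variable {A : Type*} [Ring A] [HopfAlgebra k A]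

local notation "Δ" => Coalgebra.comul (R := k)
local notation "ε" => Coalgebra.counit (R := k)

theorem braidR_tmul (r : A ⊗[k] A →ₗ[k] k) (ρ : M →ₗ[k] M ⊗[k] A) (ρ' : N →ₗ[k] N ⊗[k] A)
    (x : M) (y : N) : braidR r ρ ρ' (x ⊗ₜ y) =
      sw ρ x fun x0 a => sw ρ' y fun y0 a' => r (a ⊗ₜ a') • (y0 ⊗ₜ[k] x0) := by
  rw [sw_comm]
  simp only [braidR, LinearMap.comp_apply, TensorProduct.map_tmul, LinearEquiv.coe_coe,
    eq_sw ρ, eq_sw ρ', tmul_sw, sw_tmul, mapEquiv_sw, map_sw, swapMid_tmul,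
    TensorProduct.comm_tmul, TensorProduct.rid_tmul]

theorem tensorCoactR_tmul (ρ : M →ₗ[k] M ⊗[k] A) (ρ' : N →ₗ[k] N ⊗[k] A) (x : M) (y : N) :
    tensorCoactR ρ ρ' (x ⊗ₜ y) =
      sw ρ x fun x0 a => sw ρ' y fun y0 a' => (x0 ⊗ₜ[k] y0) ⊗ₜ (a * a') := by
  rw [sw_comm]
  simp only [tensorCoactR, LinearMap.comp_apply, TensorProduct.map_tmul,
    eq_sw ρ, eq_sw ρ', tmul_sw, sw_tmul, map_sw, swapMid_tmul, LinearMap.lTensor_tmul,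
    LinearMap.mul'_apply]

/-- The right coaction `ρ` is dual to the left coaction `δ`:
`⟨x⁰, v⟩ x¹ = v⁻¹ ⟨x, v⁰⟩`. -/
def CoactDual (b : M →ₗ[k] Module.Dual k M') (ρ : M →ₗ[k] M ⊗[k] A) (δ : M' →ₗ[k] A ⊗[k] M') :
    Prop :=
  ∀ x v, slice b v (ρ x) = TensorProduct.rid k A (LinearMap.lTensor A (b x) (δ v))

namespace CoactDual

variable {b : M →ₗ[k] Module.Dual k M'} {c : N →ₗ[k] Module.Dual k N'}
variable {ρ : M →ₗ[k] M ⊗[k] A} {δ : M' →ₗ[k] A ⊗[k] M'}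
variable {ρ' : N →ₗ[k] N ⊗[k] A} {δ' : N' →ₗ[k] A ⊗[k] N'}

theorem sw_eq (h : CoactDual b ρ δ) (x : M) (v : M') (F : A → E) (hF : Lin k F) :
    (sw ρ x fun y a => b y v • F a) = sw δ v fun a w => b x w • F a := by
  have := h x v
  rw [eq_sw ρ, eq_sw δ, map_sw, map_sw, mapEquiv_sw] at this
  have h2 := congrArg F this
  rw [hF.map_sw, hF.map_sw] at h2
  simpa only [slice_tmul, LinearMap.lTensor_tmul, TensorProduct.rid_tmul, hF.map_smul] using h2

/-- The conventions match: r(v⁽¹⁾, w⁽¹⁾) for right comodules and r(w⁽⁻¹⁾, v⁽⁻¹⁾) for left ones feed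
`r` in the same order when the tensor factors are paired without reversal. -/
theorem braid (r : A ⊗[k] A →ₗ[k] k) (h : CoactDual b ρ δ) (h' : CoactDual c ρ' δ') :
    Transposes (pairing b c) (pairing c b) (braidR r ρ ρ') (braidL r δ' δ) := by
  intro s t
  have : pairing c b ∘ₗ braidR r ρ ρ' = (braidL r δ' δ).dualMap ∘ₗ pairing b c := by
    refine TensorProduct.ext' fun x y => TensorProduct.ext' fun v w => ?_
    simp only [LinearMap.comp_apply, LinearMap.dualMap_apply, braidR_tmul, braidL_tmul, map_sw, map_smul,
      pairing_tmul, smul_eq_mul]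
    calc _ = sw ρ x fun x0 a => b x0 w • sw ρ' y fun y0 a' => c y0 v • r (a ⊗ₜ a') := by
          simp only [sw, LinearMap.sum_apply, LinearMap.smul_apply, pairing_tmul, Finset.smul_sum,
            smul_eq_mul, Finset.mul_sum]
          refine Finset.sum_congr rfl fun _ _ => Finset.sum_congr rfl fun _ _ => ?_
          ring
      _ = _ := by
          simp_rw [fun a : A => h'.sw_eq y v (fun a' => r (a ⊗ₜ a')) (by fun_prop)]
          rw [h.sw_eq x w (fun a => sw δ' v fun a' v0 => c y v0 • r (a ⊗ₜ a')) (by fun_prop)]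
          simp only [smul_sw]
          rw [sw_comm]
          simp only [smul_eq_mul]
          refine sw_congr fun _ _ => sw_congr fun _ _ => ?_
          ring
  exact LinearMap.congr_fun (LinearMap.congr_fun this s) t

theorem tensor (h : CoactDual b ρ δ) (h' : CoactDual c ρ' δ') :
    CoactDual (pairing b c) (tensorCoactR ρ ρ') (tensorCoactL δ δ') := by
  intro s t
  induction s using TensorProduct.induction_on with
  | zero => simp
  | add x y hx hy => simp only [map_add, LinearMap.lTensor_add, LinearMap.add_apply, hx, hy]
  | tmul x y =>
  induction t using TensorProduct.induction_on with
  | zero => simp [slice]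
  | add v w hv hw =>
    have : ∀ z : (M ⊗[k] N) ⊗[k] A, slice (pairing b c) (v + w) z =
        slice (pairing b c) v z + slice (pairing b c) w z := by
      intro z
      simp [slice, LinearMap.add_comp]
    rw [this, hv, hw]
    simp only [map_add]
  | tmul v w =>
    simp only [tensorCoactR_tmul, tensorCoactL_tmul, map_sw, mapEquiv_sw, slice_tmul, pairing_tmul,
      LinearMap.lTensor_tmul, TensorProduct.rid_tmul, mul_smul, ← smul_sw]
    simp_rw [fun a : A => h'.sw_eq y w (fun a' => a * a') (by fun_prop)]
    exact h.sw_eq x v (fun a => sw δ' w fun a' w0 => c y w0 • (a * a')) (by fun_prop)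

theorem colinear (h : CoactDual b ρ δ) (h' : CoactDual c ρ' δ') (hc : Function.Injective c)
    {g : M →ₗ[k] N} {f : N' →ₗ[k] M'} (hgf : Transposes b c g f)
    (hf : δ ∘ₗ f = LinearMap.lTensor A f ∘ₗ δ') :
    ρ' ∘ₗ g = LinearMap.rTensor A g ∘ₗ ρ := by
  ext x
  refine slice_ext hc fun v => ?_
  have e (z : M ⊗[k] A) : slice c v (LinearMap.rTensor A g z) = slice b (f v) z := by
    induction z using TensorProduct.induction_on with
    | zero => simp
    | add x y hx hy => simp only [map_add, hx, hy]
    | tmul m a => rw [LinearMap.rTensor_tmul, slice_tmul, slice_tmul, hgf]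
  rw [LinearMap.comp_apply, LinearMap.comp_apply, h', e, h, ← LinearMap.comp_apply δ, hf,
    LinearMap.comp_apply, ← LinearMap.comp_apply _ (LinearMap.lTensor A f),
    ← LinearMap.lTensor_comp, show c (g x) = b x ∘ₗ f from LinearMap.ext fun n => hgf x n]

/-- The right comodule dual to a left comodule. -/
def rightComodule (D : LeftComodule k A M') (h : CoactDual b ρ D.coact)
    (hb : Function.Injective b) : RightComodule k A M where
  coact := ρ
  coact_coassoc := by
    ext x
    refine slice_ext hb fun v => ?_
    simp only [LinearMap.comp_apply, LinearEquiv.coe_coe]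
    rw [eq_sw ρ x]
    simp only [map_sw, mapEquiv_sw, LinearMap.rTensor_tmul, LinearMap.lTensor_tmul, eq_sw ρ,
      sw_tmul, TensorProduct.assoc_tmul, slice_tmul]
    simp_rw [fun (y : M) (a : A) => h.sw_eq y v (fun a' => a' ⊗ₜ[k] a) (by fun_prop)]
    rw [sw_comm]
    simp_rw [fun (a : A) (w : M') => h.sw_eq x w (fun a' => a ⊗ₜ[k] a') (by fun_prop)]
    rw [D.sw_coassoc v fun c e y => b x y • (c ⊗ₜ[k] e)] <;> try fun_prop
    rw [h.sw_eq x v (fun a => Δ a) (by fun_prop)]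
    simp only [eq_sw Δ, smul_sw]
  coact_counit x := by
    refine slice_ext hb fun v => ?_
    rw [eq_sw ρ x]
    simp only [map_sw, LinearMap.lTensor_tmul, slice_tmul]
    rw [h.sw_eq x v (fun a => ε a) (by fun_prop)]
    have := D.sw_counit v (fun w => b x w • (1 : k)) (by fun_prop)
    rw [← this]
    refine sw_congr fun _ _ => ?_
    simp [mul_comm]

end CoactDual

variable {L W : Type*} [AddCommGroup L] [Module k L] [AddCommGroup W] [Module k W]
variable {r : A ⊗[k] A →ₗ[k] k}

/-- The braided Lie algebra dual to a braided Lie coalgebra. -/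
def BraidedLieCoalgebra.dual (C : BraidedLieCoalgebra r W) (b : L →ₗ[k] Module.Dual k W)
    (hb : Function.Injective b) (ρ : L →ₗ[k] L ⊗[k] A) (comul : L →ₗ[k] L ⊗[k] L)
    (bracket : L ⊗[k] L →ₗ[k] L) (hρ : CoactDual b ρ C.coact)
    (hΔ : Transposes b (pairing b b) comul C.mul)
    (hbr : Transposes (pairing b b) b bracket C.cobracket) : BraidedLieAlgebra r L :=
  have hbb := pairing_injective hb hb
  have hbbb := pairing_injective hb hbb
  have hΨ := hρ.braid r hρ
  { hρ.rightComodule C.toLeftComodule hb with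
    comul := comul
    counit := LinearMap.applyₗ C.one ∘ₗ b
    bracket := bracket
    coassoc := ((Transposes.assoc b b b).comp ((hΔ.rTensor b).comp hΔ)).unique
      ((hΔ.lTensor b).comp hΔ) hbbb (by
        ext x y z
        have := LinearMap.congr_fun C.mul_assoc ((x ⊗ₜ y) ⊗ₜ z)
        simpa using this)
    rTensor_counit_comp_comul := by
      ext x
      apply (TensorProduct.lid k L).injective
      apply hb
      ext w
      change b (slice b C.one (comul x)) w = b ((1 : k) • x) w
      rw [← pairing_apply_tmul, hΔ, C.one_mul, one_smul]
    lTensor_counit_comp_comul := by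
      ext x
      apply (TensorProduct.rid k L).injective
      apply hb
      ext w
      have e (t : L ⊗[k] L) : b (TensorProduct.rid k L
          (LinearMap.lTensor L (LinearMap.applyₗ C.one ∘ₗ b) t)) w =
          pairing b b t (w ⊗ₜ C.one) := by
        induction t using TensorProduct.induction_on with
        | zero => simp
        | add x y hx hy => simp only [map_add, LinearMap.add_apply, hx, hy]
        | tmul m n => simp [pairing_tmul, mul_comm]
      refine (e _).trans ?_
      rw [hΔ, C.mul_one]
      simp
    comul_colinear := hρ.colinear (hρ.tensor hρ) hbb hΔ C.mul_colinear
    counit_colinear := fun x => by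
      apply (TensorProduct.lid k A).injective
      change slice b C.one (ρ x) = (b x C.one) • 1
      rw [hρ, C.one_colinear]
      simp
    bracket_colinear := (hρ.tensor hρ).colinear hρ hb hbr C.cobracket_colinear
    jacobi := (hbr.comp (hbr.lTensor b)).unique
      (hbr.comp ((hbr.map hbr).comp ((hΨ.mid b b).comp (hΔ.rTensor (pairing b b))))) hb
      C.co_jacobi
    weak_cocomm := (hΨ.comp ((hbr.rTensor b).comp ((Transposes.assoc b b b).symm.comp
      ((hΨ.lTensor b).comp ((Transposes.assoc b b b).comp (hΔ.rTensor b)))))).unique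
      ((hbr.lTensor b).comp ((Transposes.assoc b b b).comp (hΔ.rTensor b))) hbb C.weak_comm
    bracket_comul := (hΔ.comp hbr).unique
      ((hbr.map hbr).comp ((hΨ.mid b b).comp (hΔ.map hΔ))) hbb C.cobracket_mul
    bracket_counit := fun x y => by
      change b (bracket (x ⊗ₜ y)) C.one = b x C.one * b y C.one
      rw [hbr, C.cobracket_one, pairing_tmul] }

theorem BraidedLieCoalgebra.dual_isUnit (C : BraidedLieCoalgebra r W) {e : W →ₗ[k] k}
    (he : C.IsCounit e) (b : L →ₗ[k] Module.Dual k W)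
    (hb : Function.Injective b) (ρ : L →ₗ[k] L ⊗[k] A) (comul : L →ₗ[k] L ⊗[k] L)
    (bracket : L ⊗[k] L →ₗ[k] L) (hρ : CoactDual b ρ C.coact)
    (hΔ : Transposes b (pairing b b) comul C.mul)
    (hbr : Transposes (pairing b b) b bracket C.cobracket) {γ : L} (hγ : b γ = e) :
    (C.dual b hb ρ comul bracket hρ hΔ hbr).IsUnit γ where
  colinear := show ρ γ = γ ⊗ₜ 1 from slice_ext hb fun v => by
    refine (hρ γ v).trans ?_
    rw [hγ, he.colinear]
    simp [slice_tmul, hγ]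
  comul := show comul γ = γ ⊗ₜ γ from pairing_injective hb hb <| TensorProduct.ext' fun v w => by
    refine (hΔ γ _).trans ?_
    rw [pairing_tmul, hγ, he.map_mul]
  counit := show b γ C.one = 1 by
    rw [hγ, he.map_one]
  bracket_left z := show bracket (γ ⊗ₜ z) = z from hb <| by
    ext w
    refine (hbr _ w).trans ?_
    have e1 (t : W ⊗[k] W) : pairing b b (γ ⊗ₜ z) t =
        b z (TensorProduct.lid k W (LinearMap.rTensor W e t)) := by
      induction t using TensorProduct.induction_on with
      | zero => simp
      | add x y hx hy => simp only [map_add, LinearMap.add_apply, hx, hy]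
      | tmul m n => simp [pairing_tmul, hγ]
    rw [e1, he.left]
    simp
  bracket_right z := show bracket (z ⊗ₜ γ) = (b z C.one) • γ from hb <| by
    ext w
    refine (hbr _ w).trans ?_
    have e1 (t : W ⊗[k] W) : pairing b b (z ⊗ₜ γ) t =
        b z (TensorProduct.rid k W (LinearMap.lTensor W e t)) := by
      induction t using TensorProduct.induction_on with
      | zero => simp
      | add x y hx hy => simp only [map_add, LinearMap.add_apply, hx, hy]
      | tmul m n => simp [pairing_tmul, hγ, mul_comm]
    rw [e1, he.right]
    simp [hγ, mul_comm]

end Transpose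

/-! ### The canonical braiding of a dual braided Lie algebra. -/

section Upsilon

variable {k : Type*} {A : Type*} [Field k] [Ring A] [HopfAlgebra k A]
variable {L : Type*} [AddCommGroup L] [Module k L] {r : A ⊗[k] A →ₗ[k] k}

/-- The comultiplication of the braided tensor square of a braided Lie algebra. -/
def BraidedLieAlgebra.comul₂ (𝓛 : BraidedLieAlgebra r L) :
    L ⊗[k] L →ₗ[k] (L ⊗[k] L) ⊗[k] (L ⊗[k] L) :=
  mid (braidR r 𝓛.coact 𝓛.coact) ∘ₗ TensorProduct.map 𝓛.comul 𝓛.comul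

/-- The canonical braiding is a morphism of coalgebras in the category of comodules. -/
structure BraidedLieAlgebra.IsRegular (𝓛 : BraidedLieAlgebra r L) : Prop where
  colinear : tensorCoactR 𝓛.coact 𝓛.coact ∘ₗ 𝓛.upsilon =
    LinearMap.rTensor A 𝓛.upsilon ∘ₗ tensorCoactR 𝓛.coact 𝓛.coact
  comul : 𝓛.comul₂ ∘ₗ 𝓛.upsilon = TensorProduct.map 𝓛.upsilon 𝓛.upsilon ∘ₗ 𝓛.comul₂
  counit : (LinearMap.mul' k k ∘ₗ TensorProduct.map 𝓛.counit 𝓛.counit) ∘ₗ 𝓛.upsilon =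
    LinearMap.mul' k k ∘ₗ TensorProduct.map 𝓛.counit 𝓛.counit

/-- The structure maps of `𝓛` are the transposes of those of the braided group of `A`. -/
structure BraidedLieAlgebra.IsDual (𝓛 : BraidedLieAlgebra r L) (b : L →ₗ[k] Module.Dual k A) :
    Prop where
  injective : Function.Injective b
  coact : CoactDual b 𝓛.coact adL
  comul : Transposes b (pairing b b) 𝓛.comul (uMul r)
  counit : ∀ x, 𝓛.counit x = b x 1
  bracket : Transposes (pairing b b) b 𝓛.bracket adL

namespace BraidedLieAlgebra.IsDual

variable {𝓛 : BraidedLieAlgebra r L} {b : L →ₗ[k] Module.Dual k A} (h : 𝓛.IsDual b)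
  (hr : IsCoquasitriangular r)
include h hr

/-- Υ is composed of the transposes of exactly the maps whose composite `uMul_braid_cobracket`
simplifies. -/
theorem upsilon : Transposes (pairing b b) (pairing b b) 𝓛.upsilon (adBraid k A) := by
  rw [← hr.uMul_braid_cobracket]
  exact (h.bracket.rTensor b).comp ((Transposes.assoc b b b).symm.comp
    (((h.coact.braid r h.coact).lTensor b).comp ((Transposes.assoc b b b).comp
      (h.comul.rTensor b))))

/-- The three clauses are transposed from `adBraid`: it is colinear, multiplicative on the braided
square, and fixes 1 ⊗ 1. -/
theorem isRegular : 𝓛.IsRegular := by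
  have hΥ := h.upsilon hr
  have hbb := pairing_injective h.injective h.injective
  have h2 : Transposes (pairing b b) (pairing (pairing b b) (pairing b b)) 𝓛.comul₂
      (braidedMul r adL (uMul r)) :=
    ((h.coact.braid r h.coact).mid b b).comp (h.comul.map h.comul)
  refine ⟨(h.coact.tensor h.coact).colinear (h.coact.tensor h.coact) hbb hΥ adBraid_colinear,
    (h2.comp hΥ).unique ((hΥ.map hΥ).comp h2) (pairing_injective hbb hbb) hr.adBraid_braidedMul,
    ?_⟩
  have e (t : L ⊗[k] L) : (LinearMap.mul' k k ∘ₗ TensorProduct.map 𝓛.counit 𝓛.counit) t =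
      pairing b b t (1 ⊗ₜ 1) := by
    induction t using TensorProduct.induction_on with
    | zero => simp
    | add x y hx hy => simp only [map_add, LinearMap.add_apply, hx, hy]
    | tmul m n => simp [h.counit, pairing_tmul]
  refine LinearMap.ext fun t => (e _).trans ((hΥ _ _).trans ((e t).trans ?_).symm)
  rw [adBraid_tmul, sw_adL_one] <;> try fun_prop
  rw [mul_one]

end BraidedLieAlgebra.IsDual

end Upsilon

/-! ### The extended tangent space of a finite dimensional calculus. -/

namespace BiData

variable {k : Type*} {A : Type*} [Field k] [Ring A] [HopfAlgebra k A]
variable {Γ : Type*} [AddCommGroup Γ] [Module k Γ] {X : BiData k A Γ} {d : A →ₗ[k] Γ}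

local notation "Δ" => Coalgebra.comul (R := k)
local notation "ε" => Coalgebra.counit (R := k)
local notation "ad" => adL (k := k) (A := A)

/-- If v + Θ c is right invariant, then so is v, and Δ(c) = c ⊗ 1 forces c = ε(c) 1; the extension
adds at most one dimension. -/
theorem finiteDimensional_extCotangent (X : BiData k A Γ) (d : A →ₗ[k] Γ)
    [FiniteDimensional k X.rightInv] : FiniteDimensional k (X.extCotangent d) := by
  have : X.extCotangent d ≤ X.rightInv.prod (Submodule.span k {(1 : A)}) := by
    rintro ⟨v, c⟩ h
    rw [mem_rightInv, ext_rco_apply] at h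
    constructor
    · have := congrArg (LinearMap.rTensor A (LinearMap.fst k Γ A)) h
      simp only [map_add, map_sw, LinearMap.rTensor_tmul, LinearMap.fst_apply, LinearMap.snd_apply,
        TensorProduct.zero_tmul, ← eq_sw] at this
      rw [show (sw Δ c fun _ _ => (0 : Γ ⊗[k] A)) = 0 from Finset.sum_const_zero, add_zero] at this
      exact mem_rightInv.mpr this
    · have := congrArg (LinearMap.rTensor A (LinearMap.snd k Γ A)) h
      simp only [map_add, map_sw, LinearMap.rTensor_tmul, LinearMap.fst_apply, LinearMap.snd_apply,
        TensorProduct.zero_tmul, ← eq_sw] at this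
      rw [show (sw X.rco v fun _ _ => (0 : A ⊗[k] A)) = 0 from Finset.sum_const_zero, zero_add]
        at this
      have h3 := Coalgebra.rTensor_counit_comul (R := k) c
      rw [this, LinearMap.rTensor_tmul] at h3
      have h4 := congrArg (TensorProduct.lid k A) h3
      simp only [TensorProduct.lid_tmul, one_smul] at h4
      exact Submodule.mem_span_singleton.mpr ⟨ε c, h4⟩
  have h1 : FiniteDimensional k (X.rightInv.prod (Submodule.span k {(1 : A)})) :=
    FiniteDimensional.of_surjective
      ((LinearMap.prodMap X.rightInv.subtype (Submodule.span k {(1 : A)}).subtype).codRestrict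
        (X.rightInv.prod (Submodule.span k {(1 : A)})) fun x => ⟨x.1.2, x.2.2⟩)
      (fun ⟨⟨x, y⟩, hx, hy⟩ => ⟨(⟨x, hx⟩, ⟨y, hy⟩), rfl⟩)
  exact Submodule.finiteDimensional_of_le this

namespace IsBicovariantFODC

variable (hd : X.IsBicovariantFODC d)
include hd

omit hd in
theorem mem_extTangent {x : Module.Dual k A} :
    x ∈ X.extTangent d ↔ ∀ a ∈ X.ideal d, x a = 0 := Submodule.mem_dualAnnihilator _

omit hd in
theorem counit_mem_extTangent : (Coalgebra.counit : Module.Dual k A) ∈ X.extTangent d := by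
  rw [mem_extTangent]
  intro a ha
  have h := extOmega_snd (X := X) (d := d) a
  rw [show X.extOmega d a = 0 from ha] at h
  have := congrArg (Coalgebra.counit (R := k)) h
  simpa using this.symm

variable {L : Type*} [AddCommGroup L] [Module k L] {b : L →ₗ[k] Module.Dual k A}
  (hL : LinearMap.range b = X.extTangent d)

include hL

/-- A finite dual basis for the pairing of the extended tangent space with `A`. -/
theorem exists_dualBasis [FiniteDimensional k X.rightInv] :
    ∃ (n : ℕ) (f : Fin n → L) (a : Fin n → A), ∀ c, c - ∑ i, b (f i) c • a i ∈ X.ideal d := by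
  have := X.finiteDimensional_extCotangent d
  -- The aᵢ are lifts of this basis under the Maurer-Cartan map, and the fᵢ are its coordinate
  -- functionals pulled back to `A`.
  let v := Module.finBasis k (X.extCotangent d)
  choose a ha using fun i => hd.omegaR_surjective (v i)
  have h (i) : v.coord i ∘ₗ hd.omegaR ∈ LinearMap.range b := by
    rw [hL, mem_extTangent]
    intro c hc
    rw [LinearMap.comp_apply, (hd.omegaR_eq_zero_iff c).mpr hc, map_zero]
  choose f hf using h
  refine ⟨_, f, a, fun c => ?_⟩
  rw [← hd.omegaR_eq_zero_iff, map_sub, map_sum, sub_eq_zero]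
  simp only [map_smul, ha, hf]
  exact (v.sum_repr _).symm

omit hd hL in
theorem eq_sum_dualBasis {n : ℕ} {f : Fin n → L} {a : Fin n → A}
    (h : ∀ c, c - ∑ i, b (f i) c • a i ∈ X.ideal d) {M : Type*} [AddCommGroup M]
    [Module k M] (G : A →ₗ[k] M) (hG : ∀ c ∈ X.ideal d, G c = 0) (c : A) :
    G c = ∑ i, b (f i) c • G (a i) := by
  have := hG _ (h c)
  rwa [map_sub, map_sum, sub_eq_zero, Finset.sum_congr rfl fun i _ => map_smul G _ _] at this

omit hd in
theorem apply_eq_zero (x : L) {a : A} (ha : a ∈ X.ideal d) : b x a = 0 :=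
  mem_extTangent.mp (hL ▸ ⟨x, rfl⟩ : b x ∈ X.extTangent d) a ha

/-- An element of the extended tangent space, as a functional on the extended cotangent space. -/
theorem exists_comp_omegaR (x : L) :
    ∃ y : X.extCotangent d →ₗ[k] k, b x = y ∘ₗ hd.omegaR := by
  obtain ⟨s, hs⟩ := hd.omegaR.exists_rightInverse_of_surjective
    (LinearMap.range_eq_top.mpr hd.omegaR_surjective)
  refine ⟨b x ∘ₗ s, LinearMap.ext fun a => ?_⟩
  rw [← sub_eq_zero, LinearMap.comp_apply, LinearMap.comp_apply, ← map_sub]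
  apply apply_eq_zero hL
  rw [← hd.omegaR_eq_zero_iff, map_sub, ← LinearMap.comp_apply hd.omegaR, hs, LinearMap.id_apply,
    sub_self]

theorem lTensor_adL_eq_zero (x : L) {a : A} (ha : a ∈ X.ideal d) :
    LinearMap.lTensor A (b x) (ad a) = 0 := by
  obtain ⟨y, hy⟩ := hd.exists_comp_omegaR hL x
  rw [hy, LinearMap.lTensor_comp, LinearMap.comp_apply,
    hd.isCrossedQuotient.adL a ((hd.omegaR_eq_zero_iff a).mpr ha), map_zero]

theorem pairing_adL_eq_zero (t : L ⊗[k] L) {a : A} (ha : a ∈ X.ideal d) :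
    pairing b b t (ad a) = 0 := by
  induction t using TensorProduct.induction_on with
  | zero => simp
  | add x y hx hy => simp only [map_add, LinearMap.add_apply, hx, hy, add_zero]
  | tmul x y =>
    have e (z : A ⊗[k] A) : pairing b b (x ⊗ₜ y) z =
        b x (TensorProduct.rid k A (LinearMap.lTensor A (b y) z)) := by
      induction z using TensorProduct.induction_on with
      | zero => simp
      | add x y hx hy => simp only [map_add, hx, hy]
      | tmul m n => simp [pairing_tmul, mul_comm]
    rw [e, hd.lTensor_adL_eq_zero hL y ha, map_zero, map_zero]

/-- The extended tangent space of a finite dimensional calculus is a unital braided Lie algebra. -/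
theorem exists_braidedLieAlgebra [FiniteDimensional k X.rightInv] {r : A ⊗[k] A →ₗ[k] k}
    (hr : IsCoquasitriangular r) (hinj : Function.Injective b) :
    ∃ (𝓛 : BraidedLieAlgebra r L) (γ : L),
      𝓛.IsDual b ∧ b γ = Coalgebra.counit ∧ 𝓛.IsUnit γ := by
  obtain ⟨n, f, a, hfa⟩ := hd.exists_dualBasis hL
  -- The ideal is two-sided for the covariantised product, so x(a · c) depends only on classes and
  -- may be expanded in the finite dual basis in both arguments.
  have hl (x : L) {a : A} (ha : a ∈ X.ideal d) (c : A) : b x (uMul r (a ⊗ₜ c)) = 0 :=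
    apply_eq_zero hL x ((hd.omegaR_eq_zero_iff _).mp
      (hd.isCrossedQuotient.uMul_left hr c ((hd.omegaR_eq_zero_iff a).mpr ha)))
  have hr' (x : L) (c : A) {a : A} (ha : a ∈ X.ideal d) : b x (uMul r (c ⊗ₜ a)) = 0 :=
    apply_eq_zero hL x ((hd.omegaR_eq_zero_iff _).mp
      (hd.isCrossedQuotient.uMul_right c ((hd.omegaR_eq_zero_iff a).mpr ha)))
  let coactAt (c : A) : L →ₗ[k] A :=
    { toFun := fun x => TensorProduct.rid k A (LinearMap.lTensor A (b x) (ad c))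
      map_add' := fun x y => by simp [LinearMap.lTensor_add]
      map_smul' := fun t x => by simp [LinearMap.lTensor_smul] }
  -- The coaction and the coproduct take values in tensor products and need the dual basis. The
  -- bracket does not: its functional vanishes on the ideal and so already lies in the range of `b`.
  let ρ : L →ₗ[k] L ⊗[k] A := ∑ i, TensorProduct.mk k _ A (f i) ∘ₗ coactAt (a i)
  let comul : L →ₗ[k] L ⊗[k] L :=
    ∑ i, ∑ j, (LinearMap.applyₗ (uMul r (a i ⊗ₜ a j)) ∘ₗ b).smulRight (f i ⊗ₜ[k] f j)
  have hρ : CoactDual b ρ ad := fun x c => by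
    have := eq_sum_dualBasis hfa
      ((TensorProduct.rid k A).toLinearMap ∘ₗ LinearMap.lTensor A (b x) ∘ₗ ad)
      (fun c hc => by
        simp only [LinearMap.comp_apply, hd.lTensor_adL_eq_zero hL x hc, map_zero]) c
    simp only [LinearMap.comp_apply, LinearEquiv.coe_coe] at this
    simp only [ρ, LinearMap.sum_apply, map_sum, LinearMap.comp_apply, TensorProduct.mk_apply,
      slice_tmul]
    exact this.symm
  have hΔ : Transposes b (pairing b b) comul (uMul r) := fun x t => by
    induction t using TensorProduct.induction_on with
    | zero => simp
    | add x y hx hy => simp only [map_add, hx, hy]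
    | tmul c e =>
      have h1 := eq_sum_dualBasis hfa (b x ∘ₗ TensorProduct.curry (uMul r) c)
        (fun e he => hr' x c he) e
      have h2 (j) := eq_sum_dualBasis hfa (b x ∘ₗ (TensorProduct.curry (uMul r)).flip (a j))
        (fun e he => hl x he (a j)) c
      simp only [LinearMap.comp_apply, LinearMap.flip_apply, TensorProduct.curry_apply] at h1 h2
      rw [h1]
      simp only [h2, comul, LinearMap.sum_apply, map_sum, LinearMap.smulRight_apply, map_smul,
        LinearMap.smul_apply, pairing_tmul, Finset.smul_sum]
      rw [Finset.sum_comm]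
      refine Finset.sum_congr rfl fun i _ => Finset.sum_congr rfl fun j _ => ?_
      simp only [smul_eq_mul, LinearMap.comp_apply, LinearMap.applyₗ_apply_apply]
      ring
  have hmem (t : L ⊗[k] L) : LinearMap.dualMap ad (pairing b b t) ∈ LinearMap.range b := by
    rw [hL, mem_extTangent]
    exact fun c hc => hd.pairing_adL_eq_zero hL t hc
  let bracket : L ⊗[k] L →ₗ[k] L :=
    (LinearEquiv.ofInjective b hinj).symm.toLinearMap ∘ₗ
      LinearMap.codRestrict (LinearMap.range b) (LinearMap.dualMap ad ∘ₗ pairing b b) hmem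
  have hbr : Transposes (pairing b b) b bracket ad := fun t c =>
    LinearMap.congr_fun (congrArg Subtype.val
      ((LinearEquiv.ofInjective b hinj).apply_symm_apply ⟨_, hmem t⟩)) c
  obtain ⟨γ, hγ⟩ : Coalgebra.counit ∈ LinearMap.range b := hL ▸ counit_mem_extTangent
  exact ⟨hr.braidedGroup.dual b hinj ρ comul bracket hρ hΔ hbr, γ,
    ⟨hinj, hρ, hΔ, fun x => rfl, hbr⟩, hγ,
    hr.braidedGroup.dual_isUnit hr.braidedGroup_isCounit b hinj ρ comul bracket hρ hΔ hbr hγ⟩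

end IsBicovariantFODC
end BiData

/-! ### Braided tensor products of comodule algebras -/

section BraidedTensor

variable {k : Type*} {A : Type*} [Field k] [Ring A] [HopfAlgebra k A]
variable {P Q U P' Q' M : Type*} [AddCommGroup P] [Module k P] [AddCommGroup Q] [Module k Q]
  [AddCommGroup U] [Module k U]
  [AddCommGroup P'] [Module k P'] [AddCommGroup Q'] [Module k Q'] [AddCommGroup M] [Module k M]

local notation "Δ" => Coalgebra.comul (R := k)
local notation "ε" => Coalgebra.counit (R := k)

theorem RightComodule.sw_coassoc (X : RightComodule k A P) (v : P) (F : P → A → A → M)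
    (h1 : ∀ y z, Lin k fun x => F x y z) (h2 : ∀ x z, Lin k fun y => F x y z)
    (h3 : ∀ x y, Lin k fun z => F x y z) :
    (sw X.coact v fun x c => sw X.coact x fun y e => F y e c) =
      sw X.coact v fun y c => sw Δ c fun c1 c2 => F y c1 c2 := by
  have h := congrArg (liftLin (fun x t => liftLin (F x) (h2 x) (h3 x) t)
    (fun t => by
      induction t using TensorProduct.induction_on with
      | zero => simp only [map_zero]; exact ⟨fun _ _ => by simp, fun _ _ => by simp⟩
      | tmul y z => exact h1 y z
      | add s t hs ht =>
        simp only [map_add]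
        exact ⟨fun x y => by rw [hs.map_add, ht.map_add]; abel,
          fun c x => by rw [hs.map_smul, ht.map_smul, smul_add]⟩)
    (fun x => by fun_prop)) (LinearMap.congr_fun X.coact_coassoc v)
  simp only [LinearMap.comp_apply, LinearEquiv.coe_coe] at h
  rw [eq_sw X.coact v] at h
  simpa only [map_sw, mapEquiv_sw, LinearMap.rTensor_tmul, LinearMap.lTensor_tmul, eq_sw X.coact,
    eq_sw Δ, sw_tmul, tmul_sw, TensorProduct.assoc_tmul, liftLin_tmul] using h

theorem RightComodule.sw_counit (X : RightComodule k A P) (v : P) (G : P → M) (h : Lin k G) :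
    (sw X.coact v fun y c => ε c • G y) = G v := by
  have := congrArg (liftLin (fun (y : P) (c : k) => c • G y) (fun q => by fun_prop)
    (fun p => by fun_prop)) (X.coact_counit v)
  rw [eq_sw X.coact v] at this
  simpa only [map_sw, LinearMap.lTensor_tmul, liftLin_tmul, one_smul] using this

/-- The product of the braided tensor product of `P` and `Q`. -/
def braidedMulR (r : A ⊗[k] A →ₗ[k] k) (ρ : P →ₗ[k] P ⊗[k] A) (κ : Q →ₗ[k] Q ⊗[k] A)
    (μ : P ⊗[k] P →ₗ[k] P) (ν : Q ⊗[k] Q →ₗ[k] Q) :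
    (P ⊗[k] Q) ⊗[k] (P ⊗[k] Q) →ₗ[k] P ⊗[k] Q :=
  TensorProduct.map μ ν ∘ₗ mid (braidR r κ ρ)

theorem mid_braidR_tmul (r : A ⊗[k] A →ₗ[k] k) (ρ : P →ₗ[k] P ⊗[k] A) (κ : Q →ₗ[k] Q ⊗[k] A)
    (a : P') (b : Q) (c : P) (d : Q') :
    mid (braidR r κ ρ) ((a ⊗ₜ b) ⊗ₜ (c ⊗ₜ d)) =
      sw κ b fun b0 b1 => sw ρ c fun c0 c1 => r (b1 ⊗ₜ c1) • ((a ⊗ₜ[k] c0) ⊗ₜ[k] (b0 ⊗ₜ[k] d)) := by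
  simp only [mid, LinearMap.comp_apply, LinearEquiv.coe_coe, TensorProduct.assoc_tmul,
    LinearMap.lTensor_tmul, TensorProduct.assoc_symm_tmul, LinearMap.rTensor_tmul, braidR_tmul]
  simp only [sw_tmul, tmul_sw, map_sw, mapEquiv_sw, TensorProduct.tmul_smul, map_smul,
    ← TensorProduct.smul_tmul', TensorProduct.assoc_tmul, TensorProduct.assoc_symm_tmul]

theorem braidedMulR_tmul (r : A ⊗[k] A →ₗ[k] k) (ρ : P →ₗ[k] P ⊗[k] A) (κ : Q →ₗ[k] Q ⊗[k] A)
    (μ : P ⊗[k] P →ₗ[k] P) (ν : Q ⊗[k] Q →ₗ[k] Q) (a c : P) (b d : Q) :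
    braidedMulR r ρ κ μ ν ((a ⊗ₜ b) ⊗ₜ (c ⊗ₜ d)) = sw κ b fun b0 b1 => sw ρ c fun c0 c1 =>
      r (b1 ⊗ₜ c1) • (μ (a ⊗ₜ c0) ⊗ₜ[k] ν (b0 ⊗ₜ d)) := by
  simp only [braidedMulR, LinearMap.comp_apply, mid_braidR_tmul, map_sw, map_smul,
    TensorProduct.map_tmul]

theorem Intertwines.braidedMulR (r : A ⊗[k] A →ₗ[k] k) {ρ : P →ₗ[k] P ⊗[k] A}
    {κ : Q →ₗ[k] Q ⊗[k] A} {μ : P ⊗[k] P →ₗ[k] P} {ν : Q ⊗[k] Q →ₗ[k] Q}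
    {ρ' : P' →ₗ[k] P' ⊗[k] A}
    {κ' : Q' →ₗ[k] Q' ⊗[k] A} {μ' : P' ⊗[k] P' →ₗ[k] P'} {ν' : Q' ⊗[k] Q' →ₗ[k] Q'}
    {f : P →ₗ[k] P'} {g : Q →ₗ[k] Q'}
    (hf : Intertwines f (TensorProduct.map f LinearMap.id) ρ ρ')
    (hg : Intertwines g (TensorProduct.map g LinearMap.id) κ κ')
    (hμ : Intertwines (TensorProduct.map f f) f μ μ')
    (hν : Intertwines (TensorProduct.map g g) g ν ν') :
    Intertwines (TensorProduct.map (TensorProduct.map f g) (TensorProduct.map f g))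
      (TensorProduct.map f g) (BraidedLie.braidedMulR r ρ κ μ ν)
      (BraidedLie.braidedMulR r ρ' κ' μ' ν') :=
  (hμ.map hν).comp ((hg.braidR r hf).mid f g)

/-- The product `μ` is colinear. -/
def IsColinearMul (ρ : P →ₗ[k] P ⊗[k] A) (μ : P ⊗[k] P →ₗ[k] P) : Prop :=
  ρ ∘ₗ μ = LinearMap.rTensor A μ ∘ₗ tensorCoactR ρ ρ

theorem sw_tensorCoactR (ρ : P →ₗ[k] P ⊗[k] A) (κ : Q →ₗ[k] Q ⊗[k] A) (p : P) (q : Q)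
    (F : P ⊗[k] Q → A → M) (h1 : ∀ y, Lin k fun x => F x y) (h2 : ∀ x, Lin k fun y => F x y) :
    sw (tensorCoactR ρ κ) (p ⊗ₜ q) F = sw ρ p fun p0 p1 => sw κ q fun q0 q1 =>
      F (p0 ⊗ₜ q0) (p1 * q1) := by
  rw [sw_eq_liftLin _ _ F h1 h2, tensorCoactR_tmul]
  simp only [map_sw, liftLin_tmul]

theorem IsColinearMul.sw_mul {ρ : P →ₗ[k] P ⊗[k] A} {μ : P ⊗[k] P →ₗ[k] P}
    (h : IsColinearMul ρ μ) (x y : P)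
    (F : P → A → M) (h1 : ∀ y, Lin k fun x => F x y) (h2 : ∀ x, Lin k fun y => F x y) :
    sw ρ (μ (x ⊗ₜ y)) F = sw ρ x fun x0 x1 => sw ρ y fun y0 y1 =>
      F (μ (x0 ⊗ₜ y0)) (x1 * y1) := by
  rw [sw_eq_liftLin _ _ F h1 h2, ← LinearMap.comp_apply ρ, h, LinearMap.comp_apply,
    tensorCoactR_tmul]
  simp only [map_sw, liftLin_tmul, LinearMap.rTensor_tmul]

/-- The braided tensor product is associative up to the associator. -/
theorem IsCoquasitriangular.assoc_braidedMulR {r : A ⊗[k] A →ₗ[k] k} (hr : IsCoquasitriangular r)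
    (X : RightComodule k A P) (Y : RightComodule k A Q) (Z : RightComodule k A U)
    (μ : P ⊗[k] P →ₗ[k] P) (ν : Q ⊗[k] Q →ₗ[k] Q) (ξ : U ⊗[k] U →ₗ[k] U) :
    (TensorProduct.assoc k P Q U).toLinearMap ∘ₗ
      braidedMulR r (tensorCoactR X.coact Y.coact) Z.coact (braidedMulR r X.coact Y.coact μ ν) ξ =
    braidedMulR r X.coact (tensorCoactR Y.coact Z.coact) μ (braidedMulR r Y.coact Z.coact ν ξ) ∘ₗ
      TensorProduct.map (TensorProduct.assoc k P Q U).toLinearMap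
        (TensorProduct.assoc k P Q U).toLinearMap := by
  ext a b c a' b' c'
  simp only [TensorProduct.AlgebraTensorModule.curry_apply, LinearMap.restrictScalars_self,
    TensorProduct.curry_apply, LinearMap.comp_apply, TensorProduct.map_tmul, LinearEquiv.coe_coe,
    TensorProduct.assoc_tmul]
  -- Both sides expand to the same sixfold sum. Splitting coefficients by `mul_right_sw` here and by
  -- `mul_left_sw` in `e2` expresses the two hexagon identities.
  have e1 : (TensorProduct.assoc k P Q U) (braidedMulR r (tensorCoactR X.coact Y.coact) Z.coact
      (braidedMulR r X.coact Y.coact μ ν) ξ (((a ⊗ₜ b) ⊗ₜ c) ⊗ₜ ((a' ⊗ₜ b') ⊗ₜ c'))) =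
      sw Z.coact c fun c0 c1 => sw Δ c1 fun c11 c12 => sw X.coact a' fun a0' a1' =>
        sw Δ a1' fun a11 a12 => sw Y.coact b fun b0 b1 => sw Y.coact b' fun b0' b1' =>
        (r (c11 ⊗ₜ b1') * r (c12 ⊗ₜ a12) * r (b1 ⊗ₜ a11)) •
          (μ (a ⊗ₜ a0') ⊗ₜ[k] (ν (b0 ⊗ₜ b0') ⊗ₜ[k] ξ (c0 ⊗ₜ c'))) := by
    rw [braidedMulR_tmul, mapEquiv_sw]
    refine sw_congr fun c0 c1 => ?_
    rw [sw_tensorCoactR] <;> try fun_prop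
    simp only [braidedMulR_tmul, hr.mul_right_sw, sw_tmul, smul_sw, sw_smul, mapEquiv_sw,
      map_smul, ← TensorProduct.smul_tmul', TensorProduct.assoc_tmul]
    simp only [sw_comm Y.coact Δ, sw_comm X.coact Δ, sw_comm Y.coact X.coact]
    refine sw_congr fun c11 c12 => ?_
    rw [X.sw_coassoc a' fun x y z => sw Y.coact b' fun b0' b1' => sw Y.coact b fun b0 b1 =>
        (r (c11 ⊗ₜ b1') * r (c12 ⊗ₜ z)) • r (b1 ⊗ₜ y) •
          (μ (a ⊗ₜ x) ⊗ₜ[k] (ν (b0 ⊗ₜ b0') ⊗ₜ[k] ξ (c0 ⊗ₜ c')))] <;> try fun_prop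
    refine sw_congr fun a0' a1' => sw_congr fun a11 a12 => ?_
    rw [sw_comm Y.coact Y.coact]
    simp only [smul_smul]
  have e2 : braidedMulR r X.coact (tensorCoactR Y.coact Z.coact) μ
        (braidedMulR r Y.coact Z.coact ν ξ) ((a ⊗ₜ (b ⊗ₜ c)) ⊗ₜ (a' ⊗ₜ (b' ⊗ₜ c'))) =
      sw Z.coact c fun c0 c1 => sw Δ c1 fun c11 c12 => sw X.coact a' fun a0' a1' =>
        sw Δ a1' fun a11 a12 => sw Y.coact b fun b0 b1 => sw Y.coact b' fun b0' b1' =>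
        (r (c11 ⊗ₜ b1') * r (c12 ⊗ₜ a12) * r (b1 ⊗ₜ a11)) •
          (μ (a ⊗ₜ a0') ⊗ₜ[k] (ν (b0 ⊗ₜ b0') ⊗ₜ[k] ξ (c0 ⊗ₜ c'))) := by
    rw [braidedMulR_tmul]
    rw [sw_tensorCoactR] <;> try fun_prop
    simp only [braidedMulR_tmul, hr.mul_left_sw, tmul_sw, smul_sw, sw_smul, TensorProduct.tmul_smul]
    simp only [sw_comm Y.coact Z.coact, sw_comm X.coact Z.coact, sw_comm Y.coact X.coact,
      sw_comm Y.coact Δ]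
    rw [Z.sw_coassoc c fun x y z => sw X.coact a' fun a0' a1' =>
        sw Δ a1' fun a11 a12 => sw Y.coact b fun b0 b1 => sw Y.coact b' fun b0' b1' =>
        (r (b1 ⊗ₜ a11) * r (z ⊗ₜ a12)) • r (y ⊗ₜ b1') •
          (μ (a ⊗ₜ a0') ⊗ₜ[k] (ν (b0 ⊗ₜ b0') ⊗ₜ[k] ξ (x ⊗ₜ c')))] <;> try fun_prop
    refine sw_congr fun _ _ => sw_congr fun _ _ => sw_congr fun _ _ => sw_congr fun _ _ =>
      sw_congr fun _ _ => sw_congr fun _ _ => ?_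
    rw [smul_smul]
    congr 1
    ring
  exact e1.trans e2.symm

/-- The braided tensor product of algebras in the category is associative. -/
theorem IsCoquasitriangular.braidedMulR_assoc {r : A ⊗[k] A →ₗ[k] k} (hr : IsCoquasitriangular r)
    (X : RightComodule k A P) (Y : RightComodule k A Q)
    {μ : P ⊗[k] P →ₗ[k] P} {ν : Q ⊗[k] Q →ₗ[k] Q} (hX : IsColinearMul X.coact μ)
    (hY : IsColinearMul Y.coact ν)
    (hμ : ∀ x y z, μ (μ (x ⊗ₜ y) ⊗ₜ z) = μ (x ⊗ₜ μ (y ⊗ₜ z)))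
    (hν : ∀ x y z, ν (ν (x ⊗ₜ y) ⊗ₜ z) = ν (x ⊗ₜ ν (y ⊗ₜ z))) (s t u : P ⊗[k] Q) :
    braidedMulR r X.coact Y.coact μ ν (braidedMulR r X.coact Y.coact μ ν (s ⊗ₜ t) ⊗ₜ u) =
      braidedMulR r X.coact Y.coact μ ν (s ⊗ₜ braidedMulR r X.coact Y.coact μ ν (t ⊗ₜ u)) := by
  induction s using TensorProduct.induction_on with
  | zero => simp
  | add x y hx hy => simp only [TensorProduct.add_tmul, map_add, hx, hy]
  | tmul a b =>
  induction t using TensorProduct.induction_on with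
  | zero => simp
  | add x y hx hy => simp only [TensorProduct.add_tmul, TensorProduct.tmul_add, map_add, hx, hy]
  | tmul a' b' =>
  induction u using TensorProduct.induction_on with
  | zero => simp
  | add x y hx hy => simp only [TensorProduct.tmul_add, map_add, hx, hy]
  | tmul a'' b'' =>
  -- Colinearity of ν with `mul_left_sw` on this side, and of μ with `mul_right_sw` in `e2`, lead to
  -- the same sum.
  have e1 : braidedMulR r X.coact Y.coact μ ν (braidedMulR r X.coact Y.coact μ ν
      ((a ⊗ₜ b) ⊗ₜ (a' ⊗ₜ b')) ⊗ₜ (a'' ⊗ₜ b'')) =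
      sw X.coact a'' fun x0 x1 => sw Δ x1 fun x11 x12 => sw X.coact a' fun a0' a1' =>
        sw Y.coact b' fun b0' b1' => sw Y.coact b fun b0 b1 => sw Δ b1 fun b11 b12 =>
        (r (b11 ⊗ₜ x11) * r (b12 ⊗ₜ a1') * r (b1' ⊗ₜ x12)) •
          (μ (a ⊗ₜ μ (a0' ⊗ₜ x0)) ⊗ₜ[k] ν (b0 ⊗ₜ ν (b0' ⊗ₜ b''))) := by
    rw [braidedMulR_tmul]
    simp only [sw_tmul, map_sw, map_smul, ← TensorProduct.smul_tmul', braidedMulR_tmul]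
    simp (disch := fun_prop) only [hY.sw_mul, smul_sw, hr.mul_left_sw, sw_smul]
    simp only [sw_comm Y.coact X.coact, sw_comm Y.coact Δ]
    rw [sw_comm X.coact X.coact a' a'']
    simp only [sw_comm X.coact Δ]
    refine sw_congr fun x0 x1 => sw_congr fun x11 x12 => sw_congr fun a0' a1' => ?_
    rw [Y.sw_coassoc b fun x y z => sw Y.coact b' fun b0' b1' => r (z ⊗ₜ a1') •
      (r (y ⊗ₜ x11) * r (b1' ⊗ₜ x12)) •
        (μ (μ (a ⊗ₜ a0') ⊗ₜ x0) ⊗ₜ[k] ν (ν (x ⊗ₜ b0') ⊗ₜ b''))] <;> try fun_prop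
    simp only [sw_comm Δ Y.coact]
    rw [sw_comm Y.coact Y.coact b b']
    refine sw_congr fun _ _ => sw_congr fun _ _ => sw_congr fun _ _ => ?_
    rw [smul_smul, hμ, hν]
    congr 1
    ring
  have e2 : braidedMulR r X.coact Y.coact μ ν ((a ⊗ₜ b) ⊗ₜ braidedMulR r X.coact Y.coact μ ν
      ((a' ⊗ₜ b') ⊗ₜ (a'' ⊗ₜ b''))) =
      sw X.coact a'' fun x0 x1 => sw Δ x1 fun x11 x12 => sw X.coact a' fun a0' a1' =>
        sw Y.coact b' fun b0' b1' => sw Y.coact b fun b0 b1 => sw Δ b1 fun b11 b12 =>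
        (r (b11 ⊗ₜ x11) * r (b12 ⊗ₜ a1') * r (b1' ⊗ₜ x12)) •
          (μ (a ⊗ₜ μ (a0' ⊗ₜ x0)) ⊗ₜ[k] ν (b0 ⊗ₜ ν (b0' ⊗ₜ b''))) := by
    rw [braidedMulR_tmul]
    simp only [tmul_sw, map_sw, map_smul, TensorProduct.tmul_smul, braidedMulR_tmul, smul_sw]
    simp (disch := fun_prop) only [hX.sw_mul, smul_sw, hr.mul_right_sw, sw_smul]
    simp only [sw_comm Y.coact X.coact]
    refine (sw_congr fun x0 x1 => sw_comm X.coact X.coact a' x0 _).trans ?_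
    rw [X.sw_coassoc a'' fun x y z => sw X.coact a' fun a0' a1' => sw Y.coact b' fun b0' b1' =>
      sw Y.coact b fun b0 b1 => sw Δ b1 fun b11 b12 => r (b1' ⊗ₜ z) •
        (r (b11 ⊗ₜ y) * r (b12 ⊗ₜ a1')) •
          (μ (a ⊗ₜ μ (a0' ⊗ₜ x)) ⊗ₜ[k] ν (b0 ⊗ₜ ν (b0' ⊗ₜ b'')))] <;> try fun_prop
    refine sw_congr fun _ _ => sw_congr fun _ _ => sw_congr fun _ _ => sw_congr fun _ _ =>
      sw_congr fun _ _ => sw_congr fun _ _ => ?_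
    rw [smul_smul]
    congr 1
    ring
  exact e1.trans e2.symm

/-- The unit acts as the identity in the braided tensor product. -/
theorem IsCoquasitriangular.one_braidedMulR {r : A ⊗[k] A →ₗ[k] k} (hr : IsCoquasitriangular r)
    (X : RightComodule k A P) (Y : RightComodule k A Q)
    {μ : P ⊗[k] P →ₗ[k] P} {ν : Q ⊗[k] Q →ₗ[k] Q} {e : P} {f : Q} (hf : Y.coact f = f ⊗ₜ 1)
    (hμ : ∀ x, μ (e ⊗ₜ x) = x) (hν : ∀ x, ν (f ⊗ₜ x) = x) (t : P ⊗[k] Q) :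
    braidedMulR r X.coact Y.coact μ ν ((e ⊗ₜ f) ⊗ₜ t) = t := by
  induction t using TensorProduct.induction_on with
  | zero => simp
  | add x y hx hy => simp only [TensorProduct.tmul_add, map_add, hx, hy]
  | tmul c d =>
    rw [braidedMulR_tmul, sw_of_eq_tmul hf] <;> try fun_prop
    simp only [hμ, hν, hr.one_left]
    exact X.sw_counit c (fun c => c ⊗ₜ d) (by fun_prop)

theorem IsCoquasitriangular.braidedMulR_one {r : A ⊗[k] A →ₗ[k] k} (hr : IsCoquasitriangular r)
    (X : RightComodule k A P) (Y : RightComodule k A Q)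
    {μ : P ⊗[k] P →ₗ[k] P} {ν : Q ⊗[k] Q →ₗ[k] Q} {e : P} {f : Q} (he : X.coact e = e ⊗ₜ 1)
    (hμ : ∀ x, μ (x ⊗ₜ e) = x) (hν : ∀ x, ν (x ⊗ₜ f) = x) (t : P ⊗[k] Q) :
    braidedMulR r X.coact Y.coact μ ν (t ⊗ₜ (e ⊗ₜ f)) = t := by
  induction t using TensorProduct.induction_on with
  | zero => simp
  | add x y hx hy => simp only [TensorProduct.add_tmul, map_add, hx, hy]
  | tmul a b =>
    rw [braidedMulR_tmul, sw_comm, sw_of_eq_tmul he] <;> try fun_prop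
    simp only [hμ, hν, hr.one_right]
    exact Y.sw_counit b (fun b => a ⊗ₜ b) (by fun_prop)

/-- The braided tensor product is an algebra in the category. -/
theorem IsCoquasitriangular.tensorCoactR_braidedMulR {r : A ⊗[k] A →ₗ[k] k}
    (hr : IsCoquasitriangular r) (X : RightComodule k A P) (Y : RightComodule k A Q)
    {μ : P ⊗[k] P →ₗ[k] P} {ν : Q ⊗[k] Q →ₗ[k] Q} (hX : IsColinearMul X.coact μ)
    (hY : IsColinearMul Y.coact ν) :
    IsColinearMul (tensorCoactR X.coact Y.coact) (braidedMulR r X.coact Y.coact μ ν) := by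
  ext a b c d
  simp only [TensorProduct.AlgebraTensorModule.curry_apply, LinearMap.restrictScalars_self,
    TensorProduct.curry_apply, LinearMap.comp_apply]
  have e1 : tensorCoactR X.coact Y.coact
      (braidedMulR r X.coact Y.coact μ ν ((a ⊗ₜ b) ⊗ₜ (c ⊗ₜ d))) =
      sw X.coact a fun a0 a1 => sw X.coact c fun c0 c1 => sw Δ c1 fun c11 c12 =>
        sw Y.coact b fun b0 b1 => sw Δ b1 fun b11 b12 => sw Y.coact d fun d0 d1 =>
          r (b12 ⊗ₜ c12) • ((μ (a0 ⊗ₜ c0) ⊗ₜ[k] ν (b0 ⊗ₜ d0)) ⊗ₜ[k] (a1 * (c11 * b11) * d1)) := by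
    simp only [braidedMulR_tmul, map_sw, map_smul, tensorCoactR_tmul]
    simp (disch := fun_prop) only [hX.sw_mul, hY.sw_mul, smul_sw]
    simp only [sw_comm Y.coact X.coact]
    rw [sw_comm X.coact X.coact c a]
    refine sw_congr fun a0 a1 => ?_
    rw [X.sw_coassoc c fun x y z => sw Y.coact b fun b0 b1 => sw Y.coact b0 fun b00 b01 =>
      sw Y.coact d fun d0 d1 => r (b1 ⊗ₜ z) •
        ((μ (a0 ⊗ₜ x) ⊗ₜ[k] ν (b00 ⊗ₜ d0)) ⊗ₜ[k] (a1 * y * (b01 * d1)))] <;> try fun_prop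
    refine sw_congr fun c0 c1 => sw_congr fun c11 c12 => ?_
    rw [Y.sw_coassoc b fun x y z => sw Y.coact d fun d0 d1 => r (z ⊗ₜ c12) •
        ((μ (a0 ⊗ₜ c0) ⊗ₜ[k] ν (x ⊗ₜ d0)) ⊗ₜ[k] (a1 * c11 * (y * d1)))] <;> try fun_prop
    simp only [mul_assoc]
  have e2 : LinearMap.rTensor A (braidedMulR r X.coact Y.coact μ ν)
      (tensorCoactR (tensorCoactR X.coact Y.coact) (tensorCoactR X.coact Y.coact)
        ((a ⊗ₜ b) ⊗ₜ (c ⊗ₜ d))) =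
      sw X.coact a fun a0 a1 => sw X.coact c fun c0 c1 => sw Δ c1 fun c11 c12 =>
        sw Y.coact b fun b0 b1 => sw Δ b1 fun b11 b12 => sw Y.coact d fun d0 d1 =>
          r (b11 ⊗ₜ c11) • ((μ (a0 ⊗ₜ c0) ⊗ₜ[k] ν (b0 ⊗ₜ d0)) ⊗ₜ[k] (a1 * (b12 * c12) * d1)) := by
    rw [tensorCoactR_tmul]
    simp (disch := fun_prop) only [sw_tensorCoactR, map_sw, LinearMap.rTensor_tmul,
      braidedMulR_tmul, sw_tmul, ← TensorProduct.smul_tmul']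
    simp only [sw_comm Y.coact X.coact]
    refine sw_congr fun a0 a1 => ?_
    rw [X.sw_coassoc c fun x y z => sw Y.coact b fun b0 b1 => sw Y.coact d fun d0 d1 =>
      sw Y.coact b0 fun b00 b01 => r (b01 ⊗ₜ y) •
        ((μ (a0 ⊗ₜ x) ⊗ₜ[k] ν (b00 ⊗ₜ d0)) ⊗ₜ[k] (a1 * b1 * (z * d1)))] <;> try fun_prop
    refine sw_congr fun c0 c1 => sw_congr fun c11 c12 => ?_
    refine (sw_congr fun b0 b1 => sw_comm Y.coact Y.coact d b0 _).trans ?_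
    rw [Y.sw_coassoc b fun x y z => sw Y.coact d fun d0 d1 => r (y ⊗ₜ c11) •
        ((μ (a0 ⊗ₜ c0) ⊗ₜ[k] ν (x ⊗ₜ d0)) ⊗ₜ[k] (a1 * z * (c12 * d1)))] <;> try fun_prop
    simp only [mul_assoc]
  rw [e1, e2]
  refine sw_congr fun a0 a1 => sw_congr fun c0 c1 => ?_
  simp only [sw_comm Δ Y.coact]
  refine sw_congr fun b0 b1 => sw_congr fun d0 d1 => ?_
  -- The sides now differ only as c₁ b₁ r(b₂, c₂) differs from r(b₁, c₁) b₂ c₂, which is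
  -- quasi-commutativity.
  rw [sw_comm, sw_comm Δ Δ c1 b1]
  exact hr.quasicomm_sw b1 c1 (fun z => (μ (a0 ⊗ₜ c0) ⊗ₜ[k] ν (b0 ⊗ₜ d0)) ⊗ₜ[k] (a1 * z * d1))
    (by fun_prop)

/-- A colinear character of the first factor is multiplicative on the braided tensor product. -/
theorem IsCoquasitriangular.character_left {r : A ⊗[k] A →ₗ[k] k} (hr : IsCoquasitriangular r)
    (X : RightComodule k A P) (Y : RightComodule k A Q)
    {μ : P ⊗[k] P →ₗ[k] P} {ν : Q ⊗[k] Q →ₗ[k] Q} {χ : P →ₗ[k] k}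
    (hχ : ∀ x, LinearMap.rTensor A χ (X.coact x) = χ x ⊗ₜ[k] 1)
    (hμ : ∀ x y, χ (μ (x ⊗ₜ y)) = χ x * χ y) (s t : P ⊗[k] Q) :
    TensorProduct.lid k Q (LinearMap.rTensor Q χ (braidedMulR r X.coact Y.coact μ ν (s ⊗ₜ t))) =
      ν (TensorProduct.lid k Q (LinearMap.rTensor Q χ s) ⊗ₜ
        TensorProduct.lid k Q (LinearMap.rTensor Q χ t)) := by
  induction s using TensorProduct.induction_on with
  | zero => simp
  | add x y hx hy => simp only [TensorProduct.add_tmul, map_add, hx, hy]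
  | tmul a b =>
  induction t using TensorProduct.induction_on with
  | zero => simp
  | add x y hx hy => simp only [TensorProduct.tmul_add, map_add, hx, hy]
  | tmul c d =>
  -- Colinearity of χ replaces the coefficient of c by 1, and r(b₁, 1) = ε(b₁) then removes the
  -- braiding.
  have h (c : P) (G : A → Q) (hG : Lin k G) : (sw X.coact c fun c0 c1 => χ c0 • G c1) = χ c • G 1 := by
    have := congrArg (fun z => G (TensorProduct.lid k A z)) (hχ c)
    simp only [eq_sw X.coact c, map_sw, mapEquiv_sw, LinearMap.rTensor_tmul,
      TensorProduct.lid_tmul, hG.map_sw, hG.map_smul] at this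
    exact this
  rw [braidedMulR_tmul]
  simp only [map_sw, mapEquiv_sw, map_smul, LinearMap.rTensor_tmul, TensorProduct.lid_tmul, hμ]
  rw [sw_comm]
  calc _ = sw X.coact c fun c0 c1 => χ c0 • (χ a • sw Y.coact b fun b0 b1 =>
        r (b1 ⊗ₜ c1) • ν (b0 ⊗ₜ d)) := by
        refine sw_congr fun c0 c1 => ?_
        simp only [smul_sw]
        refine sw_congr fun b0 b1 => ?_
        rw [smul_smul, smul_smul, smul_smul]
        congr 1
        ring
    _ = χ c • (χ a • sw Y.coact b fun b0 b1 => r (b1 ⊗ₜ 1) • ν (b0 ⊗ₜ d)) :=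
        h c (fun c1 => χ a • sw Y.coact b fun b0 b1 => r (b1 ⊗ₜ c1) • ν (b0 ⊗ₜ d)) (by fun_prop)
    _ = _ := by
        simp only [hr.one_right]
        rw [Y.sw_counit b (fun b => ν (b ⊗ₜ d)) (by fun_prop)]
        simp only [← TensorProduct.smul_tmul', TensorProduct.tmul_smul, map_smul]

/-- A colinear character of the second factor is multiplicative on the braided tensor product. -/
theorem IsCoquasitriangular.character_right {r : A ⊗[k] A →ₗ[k] k} (hr : IsCoquasitriangular r)
    (X : RightComodule k A P) (Y : RightComodule k A Q)
    {μ : P ⊗[k] P →ₗ[k] P} {ν : Q ⊗[k] Q →ₗ[k] Q} {χ : Q →ₗ[k] k}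
    (hχ : ∀ x, LinearMap.rTensor A χ (Y.coact x) = χ x ⊗ₜ[k] 1)
    (hν : ∀ x y, χ (ν (x ⊗ₜ y)) = χ x * χ y) (s t : P ⊗[k] Q) :
    TensorProduct.rid k P (LinearMap.lTensor P χ (braidedMulR r X.coact Y.coact μ ν (s ⊗ₜ t))) =
      μ (TensorProduct.rid k P (LinearMap.lTensor P χ s) ⊗ₜ
        TensorProduct.rid k P (LinearMap.lTensor P χ t)) := by
  induction s using TensorProduct.induction_on with
  | zero => simp
  | add x y hx hy => simp only [TensorProduct.add_tmul, map_add, hx, hy]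
  | tmul a b =>
  induction t using TensorProduct.induction_on with
  | zero => simp
  | add x y hx hy => simp only [TensorProduct.tmul_add, map_add, hx, hy]
  | tmul c d =>
  have h (b : Q) (G : A → P) (hG : Lin k G) : (sw Y.coact b fun b0 b1 => χ b0 • G b1) =
      χ b • G 1 := by
    have := congrArg (fun z => G (TensorProduct.lid k A z)) (hχ b)
    simp only [eq_sw Y.coact b, map_sw, mapEquiv_sw, LinearMap.rTensor_tmul,
      TensorProduct.lid_tmul, hG.map_sw, hG.map_smul] at this
    exact this
  rw [braidedMulR_tmul]
  simp only [map_sw, mapEquiv_sw, map_smul, LinearMap.lTensor_tmul, TensorProduct.rid_tmul, hν]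
  calc _ = sw Y.coact b fun b0 b1 => χ b0 • (χ d • sw X.coact c fun c0 c1 =>
        r (b1 ⊗ₜ c1) • μ (a ⊗ₜ c0)) := by
        refine sw_congr fun b0 b1 => ?_
        simp only [smul_sw]
        refine sw_congr fun c0 c1 => ?_
        rw [smul_smul, smul_smul, smul_smul]
        congr 1
        ring
    _ = χ b • (χ d • sw X.coact c fun c0 c1 => r (1 ⊗ₜ c1) • μ (a ⊗ₜ c0)) :=
        h b (fun b1 => χ d • sw X.coact c fun c0 c1 => r (b1 ⊗ₜ c1) • μ (a ⊗ₜ c0)) (by fun_prop)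
    _ = _ := by
        simp only [hr.one_left]
        rw [X.sw_counit c (fun c => μ (a ⊗ₜ c)) (by fun_prop)]
        simp only [← TensorProduct.smul_tmul', TensorProduct.tmul_smul, map_smul]
        rw [smul_comm]

end BraidedTensor

/-! ### Braided bialgebra structures determined on generators. -/

section BraidedSquare

variable {k : Type*} {A : Type*} [Field k] [Ring A] [HopfAlgebra k A]
variable {r : A ⊗[k] A →ₗ[k] k} {T : Type*} [Ring T] [Algebra k T]

/-- A comodule whose coaction is an algebra map. -/
structure RightComodule.IsAlgebra (X : RightComodule k A T) : Prop where
  mul : IsColinearMul X.coact (LinearMap.mul' k T)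
  one : X.coact 1 = 1 ⊗ₜ 1

/-- The product of the braided tensor square. -/
abbrev RightComodule.sqMul (X : RightComodule k A T) (r : A ⊗[k] A →ₗ[k] k) :
    (T ⊗[k] T) ⊗[k] (T ⊗[k] T) →ₗ[k] T ⊗[k] T :=
  braidedMulR r X.coact X.coact (LinearMap.mul' k T) (LinearMap.mul' k T)

/-- The braided tensor square of a comodule algebra. -/
@[nolint unusedArguments]
def BraidedSquare (_ : IsCoquasitriangular r) {X : RightComodule k A T} (_ : X.IsAlgebra) : Type _ :=
  T ⊗[k] T

namespace BraidedSquare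

variable (hr : IsCoquasitriangular r) {X : RightComodule k A T} (hX : X.IsAlgebra)

instance : AddCommGroup (BraidedSquare hr hX) := inferInstanceAs (AddCommGroup (T ⊗[k] T))

instance : Module k (BraidedSquare hr hX) := inferInstanceAs (Module k (T ⊗[k] T))

instance : Ring (BraidedSquare hr hX) :=
  { (inferInstance : AddCommGroup (BraidedSquare hr hX)) with
    mul := fun (s t : T ⊗[k] T) => X.sqMul r (s ⊗ₜ[k] t)
    one := (1 ⊗ₜ[k] 1 : T ⊗[k] T)
    left_distrib := fun (s t u : T ⊗[k] T) =>
      show X.sqMul r (s ⊗ₜ[k] (t + u)) = _ by rw [TensorProduct.tmul_add, map_add]; rfl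
    right_distrib := fun (s t u : T ⊗[k] T) =>
      show X.sqMul r ((s + t) ⊗ₜ[k] u) = _ by rw [TensorProduct.add_tmul, map_add]; rfl
    zero_mul := fun (s : T ⊗[k] T) =>
      show X.sqMul r ((0 : T ⊗[k] T) ⊗ₜ[k] s) = _ by rw [TensorProduct.zero_tmul, map_zero]; rfl
    mul_zero := fun (s : T ⊗[k] T) =>
      show X.sqMul r (s ⊗ₜ[k] (0 : T ⊗[k] T)) = _ by rw [TensorProduct.tmul_zero, map_zero]; rfl
    mul_assoc := hr.braidedMulR_assoc X X hX.mul hX.mul (fun x y z => mul_assoc x y z)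
      (fun x y z => mul_assoc x y z)
    one_mul := hr.one_braidedMulR X X hX.one (fun x => one_mul x) (fun x => one_mul x)
    mul_one := hr.braidedMulR_one X X hX.one (fun x => mul_one x) (fun x => mul_one x) }

instance : Algebra k (BraidedSquare hr hX) :=
  Algebra.ofModule
    (fun (c : k) (s t : T ⊗[k] T) => show X.sqMul r ((c • s) ⊗ₜ[k] t) = _ by
      rw [← TensorProduct.smul_tmul', map_smul]; rfl)
    (fun (c : k) (s t : T ⊗[k] T) => show X.sqMul r (s ⊗ₜ[k] (c • t)) = _ by
      rw [TensorProduct.tmul_smul, map_smul]; rfl)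

/-- The identification with the tensor square as a vector space. -/
def of : T ⊗[k] T ≃ₗ[k] BraidedSquare hr hX := LinearEquiv.refl k _

theorem of_mul (s t : T ⊗[k] T) : of hr hX s * of hr hX t = of hr hX (X.sqMul r (s ⊗ₜ t)) := rfl

theorem of_one : of hr hX (1 ⊗ₜ 1) = 1 := rfl

end BraidedSquare

variable {L : Type*} [AddCommGroup L] [Module k L]

/-- `M` is any linear map, neither associative nor unital. Identities in triple braided tensor
powers can thus be tested on generators without making those powers into rings. -/
theorem eq_of_adjoin_eq_top {f : L →ₗ[k] T} (hgen : Algebra.adjoin k (Set.range f) = ⊤)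
    {W : Type*} [AddCommGroup W] [Module k W] (M : W ⊗[k] W →ₗ[k] W) {g h : T →ₗ[k] W}
    (hg : ∀ x y, g (x * y) = M (g x ⊗ₜ g y)) (hh : ∀ x y, h (x * y) = M (h x ⊗ₜ h y))
    (h1 : g 1 = h 1) (hf : ∀ l, g (f l) = h (f l)) : g = h := by
  ext x
  have hx : x ∈ Algebra.adjoin k (Set.range f) := hgen ▸ trivial
  induction hx using Algebra.adjoin_induction with
  | mem x hx => obtain ⟨l, rfl⟩ := hx; exact hf l
  | algebraMap c => rw [Algebra.algebraMap_eq_smul_one, map_smul, map_smul, h1]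
  | add x y _ _ hx hy => rw [map_add, map_add, hx, hy]
  | mul x y _ _ hx hy => rw [hg, hh, hx, hy]

theorem isColinearMul_of_algHom (ρ : T →ₐ[k] T ⊗[k] A) :
    IsColinearMul ρ.toLinearMap (LinearMap.mul' k T) := by
  ext x y
  simp only [TensorProduct.AlgebraTensorModule.curry_apply, LinearMap.restrictScalars_self,
    TensorProduct.curry_apply, LinearMap.comp_apply, LinearMap.mul'_apply, tensorCoactR_tmul,
    map_sw, LinearMap.rTensor_tmul, AlgHom.toLinearMap_apply, map_mul]
  rw [← AlgHom.toLinearMap_apply, ← AlgHom.toLinearMap_apply, eq_sw ρ.toLinearMap x,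
    eq_sw ρ.toLinearMap y]
  simp only [sw_mul_const, const_mul_sw, Algebra.TensorProduct.tmul_mul_tmul]
  rw [sw_comm]

variable (𝓛 : BraidedLieAlgebra r L) {f : L →ₗ[k] T}

/-- The coaction on an algebra generated by a comodule. -/
def RightComodule.ofGenerators (hgen : Algebra.adjoin k (Set.range f) = ⊤) (ρ : T →ₐ[k] T ⊗[k] A)
    (hρ : ∀ l, ρ (f l) = TensorProduct.map f LinearMap.id (𝓛.coact l)) : RightComodule k A T where
  coact := ρ.toLinearMap
  coact_coassoc := by
    have hi : Intertwines f (TensorProduct.map f LinearMap.id) 𝓛.coact ρ.toLinearMap :=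
      fun l => (hρ l).symm
    have hA : Intertwines LinearMap.id (TensorProduct.map LinearMap.id LinearMap.id)
      (Coalgebra.comul (R := k) (A := A)) Coalgebra.comul := fun m => by
        simp [TensorProduct.map_id]
    have h : ((Algebra.TensorProduct.assoc k k k T A A).toAlgHom.comp
        ((Algebra.TensorProduct.map ρ (AlgHom.id k A)).comp ρ)) =
        (Algebra.TensorProduct.map (AlgHom.id k T) (Bialgebra.comulAlgHom k A)).comp ρ := by
      refine AlgHom.ext_of_adjoin_eq_top hgen ?_
      rintro _ ⟨l, rfl⟩
      have h1 := ((Intertwines.assoc f LinearMap.id LinearMap.id).comp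
        ((hi.rTensor LinearMap.id).comp hi)) l
      have h2 := ((hA.lTensor f).comp hi) l
      exact h1.symm.trans ((congrArg _ (LinearMap.congr_fun 𝓛.coact_coassoc l)).trans h2)
    exact congrArg AlgHom.toLinearMap h
  coact_counit x := by
    have h : (Algebra.TensorProduct.map (AlgHom.id k T) (Bialgebra.counitAlgHom k A)).comp ρ =
        Algebra.TensorProduct.includeLeft := by
      refine AlgHom.ext_of_adjoin_eq_top hgen ?_
      rintro _ ⟨l, rfl⟩
      change LinearMap.lTensor T Coalgebra.counit (ρ (f l)) = f l ⊗ₜ 1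
      rw [hρ, ← LinearMap.comp_apply, LinearMap.lTensor_comp_map, LinearMap.comp_id,
        ← LinearMap.rTensor_comp_lTensor, LinearMap.comp_apply, 𝓛.coact_counit,
        LinearMap.rTensor_tmul]
    exact LinearMap.congr_fun (congrArg AlgHom.toLinearMap h) x

theorem RightComodule.ofGenerators_isAlgebra (hgen : Algebra.adjoin k (Set.range f) = ⊤)
    (ρ : T →ₐ[k] T ⊗[k] A) (hρ : ∀ l, ρ (f l) = TensorProduct.map f LinearMap.id (𝓛.coact l)) :
    (RightComodule.ofGenerators 𝓛 hgen ρ hρ).IsAlgebra :=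
  ⟨isColinearMul_of_algHom ρ, map_one ρ⟩

/-- The braided bialgebra structure on an algebra generated by a braided Lie algebra. -/
def BraidedBialgebra.ofGenerators (hr : IsCoquasitriangular r)
    (hgen : Algebra.adjoin k (Set.range f) = ⊤) {X : RightComodule k A T} (hX : X.IsAlgebra)
    (hρ : Intertwines f (TensorProduct.map f LinearMap.id) 𝓛.coact X.coact)
    (D : T →ₐ[k] BraidedSquare hr hX) (comul : T →ₗ[k] T ⊗[k] T)
    (hD : ∀ x, D x = BraidedSquare.of hr hX (comul x))
    (hΔ : Intertwines f (TensorProduct.map f f) 𝓛.comul comul)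
    (e : T →ₐ[k] k) (he : ∀ l, e (f l) = 𝓛.counit l) : BraidedBialgebra r T :=
  have hmul (x y : T) : comul (x * y) = X.sqMul r (comul x ⊗ₜ comul y) := by
    apply (BraidedSquare.of hr hX).injective
    rw [← hD, map_mul, hD, hD, BraidedSquare.of_mul]
  have hone : comul 1 = 1 ⊗ₜ 1 := by
    apply (BraidedSquare.of hr hX).injective
    rw [← hD, map_one, BraidedSquare.of_one]
  have hTT := hr.tensorCoactR_braidedMulR X X hX.mul hX.mul
  -- Both sides are multiplicative for the braided product of T ⊗ T combined with the product of
  -- `A`; on generators the claim is colinearity of the coproduct of 𝓛.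
  have hcolin : tensorCoactR X.coact X.coact ∘ₗ comul = LinearMap.rTensor A comul ∘ₗ X.coact := by
    refine eq_of_adjoin_eq_top hgen
      (TensorProduct.map (X.sqMul r) (LinearMap.mul' k A) ∘ₗ swapMid) ?_ ?_ ?_ ?_
    · intro x y
      rw [LinearMap.comp_apply, hmul, ← LinearMap.comp_apply, hTT]
      simp only [LinearMap.comp_apply, tensorCoactR, TensorProduct.map_tmul]
      rw [← LinearMap.comp_apply, LinearMap.rTensor_comp_lTensor]
    · intro x y
      have h : X.coact (x * y) = LinearMap.rTensor A (LinearMap.mul' k T)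
        (tensorCoactR X.coact X.coact (x ⊗ₜ y)) := LinearMap.congr_fun hX.mul (x ⊗ₜ y)
      rw [LinearMap.comp_apply, h, tensorCoactR_tmul]
      simp only [LinearMap.comp_apply, eq_sw X.coact, map_sw, LinearMap.rTensor_tmul, sw_tmul,
        tmul_sw, swapMid_tmul, TensorProduct.map_tmul, LinearMap.mul'_apply, hmul]
      rw [sw_comm]
    · rw [LinearMap.comp_apply, LinearMap.comp_apply, hone, tensorCoactR_tmul, hX.one,
        LinearMap.rTensor_tmul, hone, sw_of_eq_tmul hX.one]
      · rw [sw_of_eq_tmul hX.one, mul_one] <;> fun_prop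
      · fun_prop
      · fun_prop
    · intro l
      have h1 := ((hρ.tensorCoactR hρ).comp hΔ) l
      have h2 := ((hΔ.rTensor LinearMap.id).comp hρ) l
      exact h1.symm.trans ((congrArg _ (LinearMap.congr_fun 𝓛.comul_colinear l)).trans h2)
  have hcounit (x : T) : LinearMap.rTensor A e.toLinearMap (X.coact x) = e x ⊗ₜ[k] 1 := by
    have h : LinearMap.rTensor A e.toLinearMap ∘ₗ X.coact =
        (TensorProduct.mk k k A).flip 1 ∘ₗ e.toLinearMap := by
      refine eq_of_adjoin_eq_top hgen (LinearMap.mul' k (k ⊗[k] A)) ?_ ?_ ?_ ?_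
      · intro x y
        have h : X.coact (x * y) = LinearMap.rTensor A (LinearMap.mul' k T)
          (tensorCoactR X.coact X.coact (x ⊗ₜ y)) := LinearMap.congr_fun hX.mul (x ⊗ₜ y)
        rw [LinearMap.comp_apply, h, tensorCoactR_tmul]
        simp only [LinearMap.comp_apply, eq_sw X.coact, map_sw, LinearMap.rTensor_tmul, sw_tmul,
          tmul_sw, LinearMap.mul'_apply, Algebra.TensorProduct.tmul_mul_tmul,
          AlgHom.toLinearMap_apply, map_mul]
        rw [sw_comm]
      · intro x y
        simp
      · simp [hX.one]
      · intro l
        have h1 := ((hρ l).symm : X.coact (f l) = _)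
        simp only [LinearMap.comp_apply, h1]
        rw [← LinearMap.comp_apply, LinearMap.rTensor_comp_map,
          show e.toLinearMap ∘ₗ f = 𝓛.counit from LinearMap.ext he]
        refine (𝓛.counit_colinear l).trans ?_
        simp [he]
    exact LinearMap.congr_fun h x
  have hi : Intertwines comul (TensorProduct.map comul LinearMap.id) X.coact
    (tensorCoactR X.coact X.coact) := fun x => (LinearMap.congr_fun hcolin x).symm
  have hid : Intertwines (LinearMap.id : T →ₗ[k] T) (TensorProduct.map LinearMap.id LinearMap.id)
    X.coact X.coact := fun x => by rw [TensorProduct.map_id]; rfl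
  have hm : Intertwines (TensorProduct.map comul comul) comul (LinearMap.mul' k T) (X.sqMul r) := by
    intro t
    simp only [← LinearMap.comp_apply]
    congr 1
    exact TensorProduct.ext' hmul
  have hmid : Intertwines (TensorProduct.map LinearMap.id LinearMap.id) LinearMap.id
    (LinearMap.mul' k T) (LinearMap.mul' k T) := fun x => by rw [TensorProduct.map_id]; rfl
  { X with
    comul := comul
    counit := e.toLinearMap
    -- After reassociation by `assoc_braidedMulR`, both iterated coproducts are multiplicative for
    -- the braided product of T with T ⊗ T.
    coassoc := by
      refine eq_of_adjoin_eq_top hgen (braidedMulR r X.coact (tensorCoactR X.coact X.coact)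
        (LinearMap.mul' k T) (X.sqMul r)) ?_ ?_ ?_ ?_
      · intro x y
        simp only [LinearMap.comp_apply, hmul]
        have h1 := hi.braidedMulR r hid hm hmid (comul x ⊗ₜ comul y)
        have h2 := LinearMap.congr_fun (hr.assoc_braidedMulR X X X (LinearMap.mul' k T)
          (LinearMap.mul' k T) (LinearMap.mul' k T))
          (LinearMap.rTensor T comul (comul x) ⊗ₜ LinearMap.rTensor T comul (comul y))
        exact (congrArg _ h1).trans h2
      · intro x y
        simp only [LinearMap.comp_apply, hmul]
        exact hid.braidedMulR r hi hmid hm (comul x ⊗ₜ comul y)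
      · simp [hone]
      · intro l
        have h1 := ((Intertwines.assoc f f f).comp ((hΔ.rTensor f).comp hΔ)) l
        have h2 := ((hΔ.lTensor f).comp hΔ) l
        exact h1.symm.trans ((congrArg _ (LinearMap.congr_fun 𝓛.coassoc l)).trans h2)
    rTensor_counit_comp_comul := by
      have h : (TensorProduct.lid k T).toLinearMap ∘ₗ LinearMap.rTensor T e.toLinearMap ∘ₗ comul =
          LinearMap.id := by
        refine eq_of_adjoin_eq_top hgen (LinearMap.mul' k T) ?_ (fun x y => by simp) ?_ ?_
        · intro x y
          simp only [LinearMap.comp_apply, hmul, LinearEquiv.coe_coe]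
          exact hr.character_left X X hcounit (fun x y => by simp) _ _
        · simp [hone]
        · intro l
          have h1 := ((hΔ l).symm : comul (f l) = _)
          simp only [LinearMap.comp_apply, h1]
          rw [← LinearMap.comp_apply (LinearMap.rTensor _ _), LinearMap.rTensor_comp_map,
            show e.toLinearMap ∘ₗ f = 𝓛.counit from LinearMap.ext he,
            ← LinearMap.lTensor_comp_rTensor, LinearMap.comp_apply,
            show LinearMap.rTensor L 𝓛.counit (𝓛.comul l) = 1 ⊗ₜ l from
              LinearMap.congr_fun 𝓛.rTensor_counit_comp_comul l]
          simp
      ext x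
      apply (TensorProduct.lid k T).injective
      exact (LinearMap.congr_fun h x).trans (one_smul k x).symm
    lTensor_counit_comp_comul := by
      have h : (TensorProduct.rid k T).toLinearMap ∘ₗ LinearMap.lTensor T e.toLinearMap ∘ₗ comul =
          LinearMap.id := by
        refine eq_of_adjoin_eq_top hgen (LinearMap.mul' k T) ?_ (fun x y => by simp) ?_ ?_
        · intro x y
          simp only [LinearMap.comp_apply, hmul, LinearEquiv.coe_coe]
          exact hr.character_right X X hcounit (fun x y => by simp) _ _
        · simp [hone]
        · intro l
          have h1 := ((hΔ l).symm : comul (f l) = _)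
          simp only [LinearMap.comp_apply, h1]
          rw [← LinearMap.comp_apply (LinearMap.lTensor _ _), LinearMap.lTensor_comp_map,
            show e.toLinearMap ∘ₗ f = 𝓛.counit from LinearMap.ext he,
            ← LinearMap.rTensor_comp_lTensor, LinearMap.comp_apply,
            show LinearMap.lTensor L 𝓛.counit (𝓛.comul l) = l ⊗ₜ 1 from
              LinearMap.congr_fun 𝓛.lTensor_counit_comp_comul l]
          simp
      ext x
      apply (TensorProduct.rid k T).injective
      exact (LinearMap.congr_fun h x).trans (one_smul k x).symm
    mul_colinear := hX.mul
    one_colinear := hX.one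
    comul_colinear := hcolin
    counit_colinear := hcounit
    comul_mul := TensorProduct.ext' hmul
    comul_one := hone
    counit_mul := fun x y => map_mul e x y
    counit_one := map_one e }

end BraidedSquare

/-! ### Universal properties of the enveloping algebras. -/

section Enveloping

variable {k : Type*} {A : Type*} [Field k] [Ring A] [HopfAlgebra k A]
variable {r : A ⊗[k] A →ₗ[k] k} {L : Type*} [AddCommGroup L] [Module k L]
variable {E : Type*} [Ring E] [Algebra k E]

theorem adjoin_range_comp_ι (φ : TensorAlgebra k L →ₐ[k] E) (hφ : Function.Surjective φ) :
    Algebra.adjoin k (Set.range (φ.toLinearMap ∘ₗ TensorAlgebra.ι k)) = ⊤ := by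
  rw [LinearMap.coe_comp, Set.range_comp, AlgHom.coe_toLinearMap, Algebra.adjoin_image,
    TensorAlgebra.adjoin_range_ι, Algebra.map_top, AlgHom.range_eq_top]
  exact hφ

/-- The linear map `f` satisfies the relations of the braided enveloping algebra. -/
def BraidedLieAlgebra.IsEnvMap (𝓛 : BraidedLieAlgebra r L) (f : L →ₗ[k] E) : Prop :=
  (LinearMap.mul' k E ∘ₗ TensorProduct.map f f) ∘ₗ 𝓛.upsilon =
    LinearMap.mul' k E ∘ₗ TensorProduct.map f f

/-- The linear map `q` satisfies the relations of the enveloping algebra of `(g, σ, br)`. -/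
def IsQEnvMap {g : Type*} [AddCommGroup g] [Module k g] (σ : g ⊗[k] g →ₗ[k] g ⊗[k] g)
    (br : g ⊗[k] g →ₗ[k] g) (q : g →ₗ[k] E) : Prop :=
  ∀ t, LinearMap.mul' k E (TensorProduct.map q q t) =
    LinearMap.mul' k E (TensorProduct.map q q (σ t)) + q (br t)

/-- The composition of an algebra map with a linear map. -/
def compLinearMap {E' : Type*} [Ring E'] [Algebra k E'] (φ : E →ₐ[k] E') (f : L →ₗ[k] E) :
    L →ₗ[k] E' := φ.toLinearMap ∘ₗ f

theorem map_mul'_map {E' : Type*} [Ring E'] [Algebra k E'] (φ : E →ₐ[k] E') (f : L →ₗ[k] E)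
    (t : L ⊗[k] L) : φ (LinearMap.mul' k E (TensorProduct.map f f t)) =
      LinearMap.mul' k E' (TensorProduct.map (φ.toLinearMap ∘ₗ f) (φ.toLinearMap ∘ₗ f) t) := by
  induction t using TensorProduct.induction_on with
  | zero => simp
  | add x y hx hy => simp only [map_add, hx, hy]
  | tmul x y => simp

theorem BraidedLieAlgebra.IsEnvMap.comp {𝓛 : BraidedLieAlgebra r L} {f : L →ₗ[k] E}
    (hf : 𝓛.IsEnvMap f) {E' : Type*} [Ring E'] [Algebra k E'] (φ : E →ₐ[k] E') :
    𝓛.IsEnvMap (compLinearMap φ f) := LinearMap.ext fun t => by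
  have := congrArg φ (LinearMap.congr_fun hf t)
  simpa only [LinearMap.comp_apply, map_mul'_map, compLinearMap] using this

theorem map_deg2 (φ : TensorAlgebra k L →ₐ[k] E) (t : L ⊗[k] L) : φ (deg2 L t) =
    LinearMap.mul' k E (TensorProduct.map (φ.toLinearMap ∘ₗ TensorAlgebra.ι k)
      (φ.toLinearMap ∘ₗ TensorAlgebra.ι k) t) :=
  map_mul'_map φ (TensorAlgebra.ι k) t

theorem BraidedLieAlgebra.isEnvMap_of_deg2 (𝓛 : BraidedLieAlgebra r L)
    (φ : TensorAlgebra k L →ₐ[k] E) (h : ∀ t, φ (deg2 L t) = φ (deg2 L (𝓛.upsilon t))) :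
    𝓛.IsEnvMap (φ.toLinearMap ∘ₗ TensorAlgebra.ι k) := LinearMap.ext fun t => by
  have := (h t).symm
  rwa [map_deg2, map_deg2] at this

theorem isQEnvMap_of_deg2 {σ : L ⊗[k] L →ₗ[k] L ⊗[k] L} {br : L ⊗[k] L →ₗ[k] L}
    (φ : TensorAlgebra k L →ₐ[k] E)
    (h : ∀ t, φ (deg2 L t) = φ (deg2 L (σ t) + TensorAlgebra.ι k (br t))) :
    IsQEnvMap σ br (φ.toLinearMap ∘ₗ TensorAlgebra.ι k) := fun t => by
  have := h t
  rwa [map_add, map_deg2, map_deg2] at this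

section QEnv

variable {g : Type*} [AddCommGroup g] [Module k g] {σ : g ⊗[k] g →ₗ[k] g ⊗[k] g}
  {br : g ⊗[k] g →ₗ[k] g}

/-- The universal property of the enveloping algebra of a quantum Lie algebra. -/
def QEnv.lift (q : g →ₗ[k] E) (hq : IsQEnvMap σ br q) : QEnv σ br →ₐ[k] E :=
  RingQuot.liftAlgHom k ⟨TensorAlgebra.lift k q, by
    rintro _ _ ⟨t⟩
    simpa only [map_add, map_deg2, TensorAlgebra.lift_ι_apply, TensorAlgebra.ι_comp_lift] using hq t⟩

theorem QEnv.lift_qenvι (q : g →ₗ[k] E) (hq) (x : g) :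
    QEnv.lift (σ := σ) (br := br) q hq (qenvι σ br x) = q x := by
  simp [QEnv.lift, qenvι]

theorem adjoin_range_qenvι : Algebra.adjoin k (Set.range (qenvι σ br)) = ⊤ :=
  adjoin_range_comp_ι _ (RingQuot.mkAlgHom_surjective k _)

theorem qenvι_rel : IsQEnvMap (E := QEnv σ br) σ br (qenvι σ br) :=
  isQEnvMap_of_deg2 _ fun t => RingQuot.mkAlgHom_rel k (QEnvRel.mk t)

end QEnv

namespace BraidedLieAlgebra

variable (𝓛 : BraidedLieAlgebra r L)

/-- The universal property of the braided enveloping algebra. -/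
def Env.lift {𝓛 : BraidedLieAlgebra r L} (q : L →ₗ[k] E)
    (hq : 𝓛.IsEnvMap q) : 𝓛.Env →ₐ[k] E :=
  RingQuot.liftAlgHom k ⟨TensorAlgebra.lift k q, by
    rintro _ _ ⟨t⟩
    rw [map_deg2, map_deg2, TensorAlgebra.ι_comp_lift]
    exact (LinearMap.congr_fun hq t).symm⟩

theorem Env.lift_envι {𝓛 : BraidedLieAlgebra r L} (q : L →ₗ[k] E) (hq) (x : L) :
    Env.lift (𝓛 := 𝓛) q hq (𝓛.envι x) = q x := by
  simp [Env.lift, envι]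

theorem adjoin_range_envι : Algebra.adjoin k (Set.range 𝓛.envι) = ⊤ :=
  adjoin_range_comp_ι _ (RingQuot.mkAlgHom_surjective k _)

theorem envι_rel : 𝓛.IsEnvMap (E := 𝓛.Env) 𝓛.envι :=
  𝓛.isEnvMap_of_deg2 _ fun t => RingQuot.mkAlgHom_rel k (EnvRel.mk t)

/-- The canonical map `L → B(L)/⟨c - 1⟩`. -/
def envUnitι (c : L) := compLinearMap (E := 𝓛.Env) (E' := 𝓛.EnvUnit c)
  (RingQuot.mkAlgHom k (𝓛.UnitRel c)) 𝓛.envι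

theorem envUnitι_apply (c x : L) :
    𝓛.envUnitι c x = RingQuot.mkAlgHom k (𝓛.UnitRel c) (𝓛.envι x) := rfl

/-- The universal property of `B(L)/⟨c - 1⟩`. -/
def EnvUnit.lift {𝓛 : BraidedLieAlgebra r L} {c : L} (q : L →ₗ[k] E)
    (hq : 𝓛.IsEnvMap q) (hc : q c = 1) : 𝓛.EnvUnit c →ₐ[k] E :=
  RingQuot.liftAlgHom k ⟨Env.lift q hq, by
    rintro _ _ ⟨⟩
    rw [Env.lift_envι, hc, map_one]⟩

theorem EnvUnit.lift_envUnitι {𝓛 : BraidedLieAlgebra r L} {c : L} (q : L →ₗ[k] E) (hq) (hc)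
    (x : L) : EnvUnit.lift (𝓛 := 𝓛) (c := c) q hq hc (𝓛.envUnitι c x) = q x := by
  simp [EnvUnit.lift, envUnitι_apply, Env.lift_envι]

theorem adjoin_range_envUnitι (c : L) : Algebra.adjoin k (Set.range (𝓛.envUnitι c)) = ⊤ := by
  rw [envUnitι, compLinearMap, LinearMap.coe_comp, Set.range_comp, AlgHom.coe_toLinearMap, Algebra.adjoin_image,
    adjoin_range_envι, Algebra.map_top, AlgHom.range_eq_top]
  exact RingQuot.mkAlgHom_surjective k _

theorem envUnitι_unit (c : L) : 𝓛.envUnitι c c = 1 := by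
  rw [envUnitι_apply, RingQuot.mkAlgHom_rel k (UnitRel.mk (𝓛 := 𝓛) (c := c)), map_one]

theorem envUnitι_rel (c : L) : 𝓛.IsEnvMap (E := 𝓛.EnvUnit c) (𝓛.envUnitι c) := by
  have h := IsEnvMap.comp (E := 𝓛.Env) (E' := 𝓛.EnvUnit c) 𝓛.envι_rel
    (RingQuot.mkAlgHom k (𝓛.UnitRel c))
  exact h

variable {𝓛} (h𝓛 : 𝓛.IsRegular) {f : L →ₗ[k] E}
  (hf : 𝓛.IsEnvMap f)
include h𝓛 hf

omit hf in
theorem IsRegular.counit_rel : 𝓛.IsEnvMap 𝓛.counit := h𝓛.counit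

/-- Colinearity of Υ carries the defining relations into T ⊗ A, so the coaction extends to an
algebra map. -/
theorem IsRegular.coact_rel : 𝓛.IsEnvMap (LinearMap.rTensor A f ∘ₗ 𝓛.coact) := by
  have h : LinearMap.mul' k (E ⊗[k] A) ∘ₗ
      TensorProduct.map (LinearMap.rTensor A f ∘ₗ 𝓛.coact) (LinearMap.rTensor A f ∘ₗ 𝓛.coact) =
      LinearMap.rTensor A (LinearMap.mul' k E ∘ₗ TensorProduct.map f f) ∘ₗ
        tensorCoactR 𝓛.coact 𝓛.coact := by
    ext x y
    simp only [TensorProduct.AlgebraTensorModule.curry_apply, LinearMap.restrictScalars_self,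
      TensorProduct.curry_apply, LinearMap.comp_apply, TensorProduct.map_tmul,
      LinearMap.mul'_apply, tensorCoactR_tmul, map_sw, LinearMap.rTensor_tmul]
    rw [eq_sw 𝓛.coact x, eq_sw 𝓛.coact y]
    simp only [map_sw, LinearMap.rTensor_tmul, sw_mul_const, const_mul_sw,
      Algebra.TensorProduct.tmul_mul_tmul]
    rw [sw_comm]
  rw [IsEnvMap, h, LinearMap.comp_assoc, h𝓛.colinear, ← LinearMap.comp_assoc, ← LinearMap.rTensor_comp, hf]

/-- The product of two coproducts in the braided square is f ⊗ f and multiplication applied to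
`comul₂`, by naturality of the braiding; Υ commutes with `comul₂`. -/
theorem IsRegular.comul_rel (hr : IsCoquasitriangular r) {X : RightComodule k A E}
    (hX : X.IsAlgebra) (hfX : Intertwines f (TensorProduct.map f LinearMap.id) 𝓛.coact X.coact) :
    𝓛.IsEnvMap ((BraidedSquare.of hr hX).toLinearMap ∘ₗ TensorProduct.map f f ∘ₗ 𝓛.comul) := by
  have h : LinearMap.mul' k (BraidedSquare hr hX) ∘ₗ TensorProduct.map
      ((BraidedSquare.of hr hX).toLinearMap ∘ₗ TensorProduct.map f f ∘ₗ 𝓛.comul)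
      ((BraidedSquare.of hr hX).toLinearMap ∘ₗ TensorProduct.map f f ∘ₗ 𝓛.comul) =
      (BraidedSquare.of hr hX).toLinearMap ∘ₗ
        TensorProduct.map (LinearMap.mul' k E ∘ₗ TensorProduct.map f f)
          (LinearMap.mul' k E ∘ₗ TensorProduct.map f f) ∘ₗ 𝓛.comul₂ := by
    refine TensorProduct.ext' fun x y => ?_
    simp only [LinearMap.comp_apply, TensorProduct.map_tmul, LinearMap.mul'_apply,
      LinearEquiv.coe_coe, BraidedSquare.of_mul]
    congr 1
    have h1 := (hfX.braidR r hfX).mid f f (𝓛.comul x ⊗ₜ 𝓛.comul y)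
    rw [TensorProduct.map_comp, LinearMap.comp_apply, comul₂, LinearMap.comp_apply,
      TensorProduct.map_tmul, h1]
    rfl
  rw [IsEnvMap, h, LinearMap.comp_assoc, LinearMap.comp_assoc, h𝓛.comul, ← LinearMap.comp_assoc 𝓛.comul₂,
    ← TensorProduct.map_comp, hf]

end BraidedLieAlgebra

end Enveloping

/-! ### Braided bialgebra structures on the enveloping algebras. -/

section EnvBialgebra

variable {k : Type*} {A : Type*} [Field k] [Ring A] [HopfAlgebra k A]
variable {r : A ⊗[k] A →ₗ[k] k} {L : Type*} [AddCommGroup L] [Module k L]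
variable {𝓛 : BraidedLieAlgebra r L} {T T' : Type*} [Ring T] [Algebra k T] [Ring T'] [Algebra k T']

/-- A braided bialgebra structure is determined by its values on generators. -/
theorem BraidedBialgebra.exists_extends (hr : IsCoquasitriangular r) {f : L →ₗ[k] T}
    (hgen : Algebra.adjoin k (Set.range f) = ⊤) (ρ : T →ₐ[k] T ⊗[k] A)
    (hρ : ∀ l, ρ (f l) = LinearMap.rTensor A f (𝓛.coact l)) (e : T →ₐ[k] k)
    (he : ∀ l, e (f l) = 𝓛.counit l)
    (hD : ∀ (X : RightComodule k A T) (hX : X.IsAlgebra),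
      Intertwines f (TensorProduct.map f LinearMap.id) 𝓛.coact X.coact →
      ∃ D : T →ₐ[k] BraidedSquare hr hX, ∀ l, D (f l) =
        BraidedSquare.of hr hX (TensorProduct.map f f (𝓛.comul l))) :
    ∃ 𝓑 : BraidedBialgebra r T, 𝓑.Extends 𝓛 f := by
  -- The algebra structure of the braided square depends on the coaction, so the coproduct can only
  -- be asked for once the coaction has been built from ρ.
  obtain ⟨D, hD⟩ := hD _ (RightComodule.ofGenerators_isAlgebra 𝓛 hgen ρ hρ) fun l => (hρ l).symm
  refine ⟨BraidedBialgebra.ofGenerators 𝓛 hr hgen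
    (RightComodule.ofGenerators_isAlgebra 𝓛 hgen ρ hρ) (fun l => (hρ l).symm) D
    ((BraidedSquare.of hr _).symm.toLinearMap ∘ₗ D.toLinearMap) (fun x => rfl)
    (fun l => (hD l).symm) e he, ⟨LinearMap.ext hρ, LinearMap.ext hD, LinearMap.ext he⟩⟩

theorem BraidedBialgebra.coact_mul (𝓑 : BraidedBialgebra r T) (x y : T) :
    𝓑.coact (x * y) = LinearMap.mul' k (T ⊗[k] A) (𝓑.coact x ⊗ₜ 𝓑.coact y) := by
  have h : 𝓑.coact (x * y) = LinearMap.rTensor A (LinearMap.mul' k T)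
    (tensorCoactR 𝓑.coact 𝓑.coact (x ⊗ₜ y)) := LinearMap.congr_fun 𝓑.mul_colinear (x ⊗ₜ y)
  rw [h, tensorCoactR_tmul]
  simp only [eq_sw 𝓑.coact, map_sw, LinearMap.rTensor_tmul, sw_tmul, tmul_sw,
    LinearMap.mul'_apply, Algebra.TensorProduct.tmul_mul_tmul]
  rw [sw_comm]

/-- Algebra maps that are compatible with the generators are bialgebra maps. -/
theorem BraidedBialgebra.isHom_of_extends {𝓑 : BraidedBialgebra r T} {𝓑' : BraidedBialgebra r T'}
    {f : L →ₗ[k] T} {f' : L →ₗ[k] T'} (hgen : Algebra.adjoin k (Set.range f) = ⊤)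
    (h : 𝓑.Extends 𝓛 f) (h' : 𝓑'.Extends 𝓛 f') (φ : T →ₐ[k] T') (hφ : ∀ l, φ (f l) = f' l) :
    𝓑.IsHom 𝓑' φ := by
  have hφ' : φ.toLinearMap ∘ₗ f = f' := LinearMap.ext hφ
  have hc : 𝓑'.coact ∘ₗ φ.toLinearMap = LinearMap.rTensor A φ.toLinearMap ∘ₗ 𝓑.coact := by
    refine eq_of_adjoin_eq_top hgen (LinearMap.mul' k (T' ⊗[k] A)) ?_ ?_ ?_ ?_
    · intro x y
      simp only [LinearMap.comp_apply, AlgHom.toLinearMap_apply, map_mul, 𝓑'.coact_mul]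
    · intro x y
      simp only [LinearMap.comp_apply, 𝓑.coact_mul]
      exact map_mul (Algebra.TensorProduct.map φ (AlgHom.id k A)) _ _
    · simp [𝓑.one_colinear, 𝓑'.one_colinear]
    · intro l
      have h1 : 𝓑'.coact (f' l) = _ := LinearMap.congr_fun h'.colinear l
      have h2 : 𝓑.coact (f l) = _ := LinearMap.congr_fun h.colinear l
      simp only [LinearMap.comp_apply, AlgHom.toLinearMap_apply, hφ, h1, h2]
      rw [← LinearMap.comp_apply (LinearMap.rTensor A φ.toLinearMap), ← LinearMap.rTensor_comp,
        hφ']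
  have hi : Intertwines φ.toLinearMap (TensorProduct.map φ.toLinearMap LinearMap.id) 𝓑.coact
    𝓑'.coact := fun x => (LinearMap.congr_fun hc x).symm
  have hm : Intertwines (TensorProduct.map φ.toLinearMap φ.toLinearMap) φ.toLinearMap
      (LinearMap.mul' k T) (LinearMap.mul' k T') := by
    intro t
    simp only [← LinearMap.comp_apply]
    congr 1
    exact TensorProduct.ext' fun x y => map_mul φ x y
  refine ⟨hc, ?_, ?_⟩
  · refine eq_of_adjoin_eq_top hgen (braidedMulR r 𝓑'.coact 𝓑'.coact (LinearMap.mul' k T')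
      (LinearMap.mul' k T')) ?_ ?_ ?_ ?_
    · intro x y
      simp only [LinearMap.comp_apply, AlgHom.toLinearMap_apply, map_mul]
      exact LinearMap.congr_fun 𝓑'.comul_mul (φ x ⊗ₜ φ y)
    · intro x y
      have h1 : 𝓑.comul (x * y) = _ := LinearMap.congr_fun 𝓑.comul_mul (x ⊗ₜ y)
      have h2 := hi.braidedMulR r hi hm hm (𝓑.comul x ⊗ₜ 𝓑.comul y)
      simp only [LinearMap.comp_apply, h1]
      exact h2
    · simp [𝓑.comul_one, 𝓑'.comul_one]
    · intro l
      have h1 : 𝓑'.comul (f' l) = _ := LinearMap.congr_fun h'.comul l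
      have h2 : 𝓑.comul (f l) = _ := LinearMap.congr_fun h.comul l
      simp only [LinearMap.comp_apply, AlgHom.toLinearMap_apply, hφ, h1, h2]
      rw [← LinearMap.comp_apply (TensorProduct.map φ.toLinearMap φ.toLinearMap),
        ← TensorProduct.map_comp, hφ']
  · refine eq_of_adjoin_eq_top hgen (LinearMap.mul' k k) ?_ ?_ ?_ ?_
    · intro x y
      simp only [LinearMap.comp_apply, AlgHom.toLinearMap_apply, map_mul, 𝓑'.counit_mul,
        LinearMap.mul'_apply]
    · intro x y
      rw [𝓑.counit_mul, LinearMap.mul'_apply]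
    · simp [𝓑.counit_one, 𝓑'.counit_one]
    · intro l
      have h1 : 𝓑'.counit (f' l) = _ := LinearMap.congr_fun h'.counit l
      have h2 : 𝓑.counit (f l) = _ := LinearMap.congr_fun h.counit l
      rw [LinearMap.comp_apply, AlgHom.toLinearMap_apply, hφ, h1, h2]

theorem BraidedBialgebra.Extends.comp {𝓑 : BraidedBialgebra r T} {f : L →ₗ[k] T}
    (h : 𝓑.Extends 𝓛 f) {N : Type*} [AddCommGroup N] [Module k N] {𝓝 : BraidedLieAlgebra r N}
    {ι : N →ₗ[k] L} (hι : 𝓝.IsHom 𝓛 ι) : 𝓑.Extends 𝓝 (f ∘ₗ ι) where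
  colinear := by
    rw [← LinearMap.comp_assoc, h.colinear, LinearMap.comp_assoc, hι.colinear,
      LinearMap.rTensor_comp, LinearMap.comp_assoc]
  comul := by
    rw [← LinearMap.comp_assoc, h.comul, LinearMap.comp_assoc, hι.comul,
      TensorProduct.map_comp, LinearMap.comp_assoc]
  counit := by rw [← LinearMap.comp_assoc, h.counit, hι.counit]

namespace BraidedLieAlgebra

variable (h𝓛 : 𝓛.IsRegular) (hr : IsCoquasitriangular r)
include h𝓛 hr

theorem IsRegular.exists_env : ∃ 𝓑 : BraidedBialgebra r 𝓛.Env, 𝓑.Extends 𝓛 𝓛.envι := by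
  refine BraidedBialgebra.exists_extends hr 𝓛.adjoin_range_envι
    (Env.lift _ (h𝓛.coact_rel 𝓛.envι_rel)) (Env.lift_envι _ _)
    (Env.lift 𝓛.counit h𝓛.counit_rel) (Env.lift_envι _ _) fun X hX hfX => ?_
  exact ⟨Env.lift _ (h𝓛.comul_rel 𝓛.envι_rel hr hX hfX), Env.lift_envι _ _⟩

/-- Stated for any algebra identified with the quotient, so that U(g) and the enveloping algebra of
a complementary subalgebra get their structures by one argument. Coinvariance, grouplikeness and
counit one of γ make the three structure maps respect γ = 1. -/
theorem IsRegular.exists_envUnit {γ : L} (hγ : 𝓛.IsUnit γ) (ψ : T ≃ₐ[k] 𝓛.EnvUnit γ)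
    {f : L →ₗ[k] T} (hf : ∀ l, ψ (f l) = 𝓛.envUnitι γ l)
    (hgen : Algebra.adjoin k (Set.range f) = ⊤)
    (hrel : 𝓛.IsEnvMap f) (hf1 : f γ = 1) :
    ∃ 𝓑 : BraidedBialgebra r T, 𝓑.Extends 𝓛 f := by
  refine BraidedBialgebra.exists_extends hr hgen
    ((EnvUnit.lift (LinearMap.rTensor A f ∘ₗ 𝓛.coact) (h𝓛.coact_rel hrel) ?_).comp ψ.toAlgHom)
    (fun l => ?_)
    ((EnvUnit.lift 𝓛.counit h𝓛.counit_rel hγ.counit).comp ψ.toAlgHom) (fun l => ?_)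
    fun X hX hfX => ⟨(EnvUnit.lift ((BraidedSquare.of hr hX).toLinearMap ∘ₗ
      TensorProduct.map f f ∘ₗ 𝓛.comul) (h𝓛.comul_rel hrel hr hX hfX) ?_).comp ψ.toAlgHom,
      fun l => ?_⟩
  · rw [LinearMap.comp_apply, hγ.colinear, LinearMap.rTensor_tmul, hf1]
    rfl
  · change EnvUnit.lift _ _ _ (ψ (f l)) = _
    rw [hf, EnvUnit.lift_envUnitι]
    rfl
  · change EnvUnit.lift _ _ _ (ψ (f l)) = _
    rw [hf, EnvUnit.lift_envUnitι]
  · rw [LinearMap.comp_apply, LinearMap.comp_apply, hγ.comul, TensorProduct.map_tmul, hf1]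
    rfl
  · change EnvUnit.lift _ _ _ (ψ (f l)) = _
    rw [hf, EnvUnit.lift_envUnitι]
    rfl

end BraidedLieAlgebra

end EnvBialgebra

/-! ### Presenting the quotient by γ = 1 on a complement of γ. -/

section Complement

variable {k : Type*} {A : Type*} [Field k] [Ring A] [HopfAlgebra k A]
variable {r : A ⊗[k] A →ₗ[k] k} {L N : Type*} [AddCommGroup L] [Module k L]
  [AddCommGroup N] [Module k N]
variable {𝓛 : BraidedLieAlgebra r L}

namespace BraidedLieAlgebra

theorem upsilon_tmul (𝓛 : BraidedLieAlgebra r L) (x y : L) :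
    𝓛.upsilon (x ⊗ₜ y) = sw 𝓛.comul x fun x1 x2 => sw 𝓛.coact x2 fun x20 x21 =>
      sw 𝓛.coact y fun y0 y1 => r (x21 ⊗ₜ y1) • (𝓛.bracket (x1 ⊗ₜ y0) ⊗ₜ[k] x20) := by
  simp only [upsilon, canonicalBraid, LinearMap.comp_apply, LinearMap.rTensor_tmul,
    LinearEquiv.coe_coe, eq_sw 𝓛.comul, sw_tmul, map_sw, mapEquiv_sw, TensorProduct.assoc_tmul,
    LinearMap.lTensor_tmul, braidR_tmul, tmul_sw, TensorProduct.tmul_smul, map_smul,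
    TensorProduct.assoc_symm_tmul]

/-- Together with `upsilon_tmul_unit`, this reduces the relations involving γ to its commuting with
the generators, which is void once γ = 1. -/
theorem upsilon_unit_tmul (hr : IsCoquasitriangular r) {γ : L} (hγ : 𝓛.IsUnit γ) (y : L) :
    𝓛.upsilon (γ ⊗ₜ y) = y ⊗ₜ γ := by
  rw [upsilon_tmul, sw_of_eq_tmul hγ.comul] <;> try fun_prop
  rw [sw_of_eq_tmul hγ.colinear] <;> try fun_prop
  simp only [hr.one_left, hγ.bracket_left]
  exact 𝓛.sw_counit y (fun y => y ⊗ₜ γ) (by fun_prop)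

theorem upsilon_tmul_unit (hr : IsCoquasitriangular r) {γ : L} (hγ : 𝓛.IsUnit γ) (x : L) :
    𝓛.upsilon (x ⊗ₜ γ) = γ ⊗ₜ x := by
  rw [upsilon_tmul]
  simp_rw [fun x1 x2 : L => sw_comm 𝓛.coact 𝓛.coact x2 γ fun x20 x21 y0 y1 =>
    r (x21 ⊗ₜ y1) • (𝓛.bracket (x1 ⊗ₜ y0) ⊗ₜ[k] x20)]
  rw [sw_comm, sw_of_eq_tmul hγ.colinear] <;> try fun_prop
  simp only [hr.one_right, hγ.bracket_right]
  simp_rw [fun x1 x2 : L => 𝓛.sw_counit x2 (fun y => (𝓛.counit x1 • γ) ⊗ₜ[k] y) (by fun_prop)]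
  have h : LinearMap.rTensor L 𝓛.counit (𝓛.comul x) = 1 ⊗ₜ x :=
    LinearMap.congr_fun 𝓛.rTensor_counit_comp_comul x
  have := congrArg (fun t => γ ⊗ₜ[k] TensorProduct.lid k L t) h
  simpa only [eq_sw 𝓛.comul x, map_sw, mapEquiv_sw, LinearMap.rTensor_tmul,
    TensorProduct.lid_tmul, tmul_sw, one_smul, TensorProduct.tmul_smul,
    ← TensorProduct.smul_tmul'] using this

/-- The subspace `N` is a complement of the line through `γ` in `L`. -/
structure _root_.BraidedLie.IsSplitting (γ : L) (ι : N →ₗ[k] L) (p : L →ₗ[k] N)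
    (c : L →ₗ[k] k) : Prop where
  decomp : ∀ x, ι (p x) + c x • γ = x
  proj : ∀ n, p (ι n) = n
  char : ∀ n, c (ι n) = 0
  proj_unit : p γ = 0
  char_unit : c γ = 1

/-- A quantum Lie algebra structure on a complement of the unit. -/
structure IsComplement (𝓛 : BraidedLieAlgebra r L) (γ : L) (ι : N →ₗ[k] L) (p : L →ₗ[k] N)
    (c : L →ₗ[k] k) (σ : N ⊗[k] N →ₗ[k] N ⊗[k] N) (br : N ⊗[k] N →ₗ[k] N) : Prop
    extends IsSplitting γ ι p c where
  upsilon : ∀ t, 𝓛.upsilon (TensorProduct.map ι ι t) =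
    TensorProduct.map ι ι (σ t) + ι (br t) ⊗ₜ γ

variable {γ : L} {ι : N →ₗ[k] L} {p : L →ₗ[k] N}
    {c : L →ₗ[k] k} {σ : N ⊗[k] N →ₗ[k] N ⊗[k] N} {br : N ⊗[k] N →ₗ[k] N}
    {T : Type*} [Ring T] [Algebra k T] {q : N →ₗ[k] T}

/-- With γ = 1, the term [x, y] ⊗ γ of Υ becomes the linear term of the quantum Lie relation. -/
theorem IsComplement.rel (h : 𝓛.IsComplement γ ι p c σ br) {f : L →ₗ[k] T}
    (hf : 𝓛.IsEnvMap f) (hf1 : f γ = 1) : IsQEnvMap σ br (f ∘ₗ ι) := fun t => by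
  have h1 := LinearMap.congr_fun hf (TensorProduct.map ι ι t)
  simp only [LinearMap.comp_apply, h.upsilon, map_add, TensorProduct.map_tmul, hf1,
    LinearMap.mul'_apply, mul_one] at h1
  simpa only [TensorProduct.map_comp, LinearMap.comp_apply] using h1.symm

/-- The extension of a map on a complement of the unit. -/
theorem IsComplement.extend_rel (hr : IsCoquasitriangular r) (hγ : 𝓛.IsUnit γ)
    (h : 𝓛.IsComplement γ ι p c σ br)
    (hq : IsQEnvMap σ br q)
    {f : L →ₗ[k] T} (hfι : f ∘ₗ ι = q) (hf1 : f γ = 1) :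
    𝓛.IsEnvMap f := by
  refine TensorProduct.ext' fun x y => ?_
  -- Expand over N ⊕ kγ. The three terms with γ hold because f γ = 1 commutes with everything; only
  -- the N ⊗ N term uses the relations of q.
  rw [← h.decomp x, ← h.decomp y]
  have e : 𝓛.upsilon (ι (p x) ⊗ₜ ι (p y)) = _ := h.upsilon (p x ⊗ₜ p y)
  have hι (n : N) : f (ι n) = q n := LinearMap.congr_fun hfι n
  have hq' := hq (p x ⊗ₜ p y)
  simp only [TensorProduct.map_tmul, LinearMap.mul'_apply] at hq'
  simp only [LinearMap.comp_apply, TensorProduct.add_tmul, TensorProduct.tmul_add, map_add,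
    TensorProduct.tmul_smul, ← TensorProduct.smul_tmul', map_smul, upsilon_unit_tmul hr hγ,
    upsilon_tmul_unit hr hγ, e, TensorProduct.map_tmul, LinearMap.mul'_apply, hf1, hι]
  rw [← LinearMap.comp_apply (TensorProduct.map f f), ← TensorProduct.map_comp, hfι, hq']
  simp only [mul_one, one_mul]

/-- An algebra presented by a quantum Lie algebra structure on a complement of the unit. -/
theorem IsComplement.exists_equiv (hr : IsCoquasitriangular r) (hγ : 𝓛.IsUnit γ)
    (h : 𝓛.IsComplement γ ι p c σ br)
    (hq : IsQEnvMap σ br q)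
    (hgen : Algebra.adjoin k (Set.range q) = ⊤) (φ : T →ₐ[k] 𝓛.EnvUnit γ)
    (hφ : ∀ n, φ (q n) = 𝓛.envUnitι γ (ι n)) :
    ∃ (ψ : T ≃ₐ[k] 𝓛.EnvUnit γ) (f : L →ₗ[k] T), (∀ n, ψ (q n) = 𝓛.envUnitι γ (ι n)) ∧
      (∀ l, ψ (f l) = 𝓛.envUnitι γ l) ∧ Algebra.adjoin k (Set.range f) = ⊤ ∧
      𝓛.IsEnvMap f ∧ f γ = 1 ∧ f ∘ₗ ι = q := by
  -- The only linear extension of q taking γ to 1. The universal property turns it into the inverse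
  -- of φ.
  let f : L →ₗ[k] T := q ∘ₗ p + c.smulRight 1
  have hfι : f ∘ₗ ι = q := LinearMap.ext fun n => by simp [f, h.proj, h.char]
  have hf1 : f γ = 1 := by simp [f, h.proj_unit, h.char_unit]
  have hf := h.extend_rel hr hγ hq hfι hf1
  let χ : 𝓛.EnvUnit γ →ₐ[k] T := EnvUnit.lift f hf hf1
  have hχ (l : L) : χ (𝓛.envUnitι γ l) = f l := EnvUnit.lift_envUnitι f hf hf1 l
  have hφf (l : L) : φ (f l) = 𝓛.envUnitι γ l := by
    conv_rhs => rw [← h.decomp l, map_add, map_smul, envUnitι_unit, ← hφ]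
    simp [f]
  let ψ : T ≃ₐ[k] 𝓛.EnvUnit γ := AlgEquiv.ofAlgHom φ χ
    (AlgHom.ext_of_adjoin_eq_top (𝓛.adjoin_range_envUnitι γ) (by
      rintro _ ⟨l, rfl⟩
      rw [AlgHom.comp_apply, hχ, hφf]
      rfl))
    (AlgHom.ext_of_adjoin_eq_top hgen (by
      rintro _ ⟨n, rfl⟩
      rw [AlgHom.comp_apply, hφ, hχ]
      exact LinearMap.congr_fun hfι n))
  refine ⟨ψ, f, hφ, hφf, ?_, hf, hf1, hfι⟩
  rw [eq_top_iff, ← hgen, ← hfι]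
  exact Algebra.adjoin_mono (by rw [LinearMap.coe_comp]; exact Set.range_comp_subset_range _ _)

end BraidedLieAlgebra
end Complement

/-! ### Complements of γ cut out by an element of `A`. -/

section Splitting

variable {k : Type*} {A : Type*} [Field k] [Ring A] [HopfAlgebra k A]
variable {r : A ⊗[k] A →ₗ[k] k} {L N : Type*} [AddCommGroup L] [Module k L]
  [AddCommGroup N] [Module k N]

local notation "Δ" => Coalgebra.comul (R := k)
local notation "ε" => Coalgebra.counit (R := k)
local notation "ad" => adL (k := k) (A := A)

variable {γ : L} {ι : N →ₗ[k] L} {p : L →ₗ[k] N} {c : L →ₗ[k] k}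
  {b : L →ₗ[k] Module.Dual k A} {u : A}

namespace IsSplitting

theorem injective (h : IsSplitting γ ι p c) : Function.Injective ι :=
  Function.LeftInverse.injective h.proj

theorem rTensor_proj {E : Type*} [AddCommGroup E] [Module k E] (h : IsSplitting γ ι p c)
    {w : L ⊗[k] E} (hw : LinearMap.rTensor E c w = 0) :
    TensorProduct.map ι LinearMap.id (LinearMap.rTensor E p w) = w := by
  have e (w : L ⊗[k] E) : TensorProduct.map ι LinearMap.id (LinearMap.rTensor E p w) +
      γ ⊗ₜ TensorProduct.lid k E (LinearMap.rTensor E c w) = w := by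
    induction w using TensorProduct.induction_on with
    | zero => simp
    | add x y hx hy =>
      conv_rhs => rw [← hx, ← hy]
      simp only [map_add, TensorProduct.tmul_add]
      abel
    | tmul m n =>
      conv_rhs => rw [← h.decomp m, TensorProduct.add_tmul, TensorProduct.smul_tmul]
      rfl
  have := e w
  rwa [hw, map_zero, TensorProduct.tmul_zero, add_zero] at this

/-- `ι ∘ p` is the transpose of a ↦ a − γ(a) u, so projecting both slots changes a pairing only by
terms with u in some slot, and these vanish. -/
theorem map_proj (h : IsSplitting γ ι p c) (hb : Function.Injective b) (hc : ∀ x, c x = b x u)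
    {w : L ⊗[k] L} (h1 : ∀ a, pairing b b w (u ⊗ₜ a) = 0)
    (h2 : ∀ a, pairing b b w (a ⊗ₜ u) = 0) :
    TensorProduct.map ι ι (TensorProduct.map p p w) = w := by
  have ht : Transposes b b (ι ∘ₗ p) (LinearMap.id - (b γ).smulRight u) := fun x a => by
    have hx : b x a = b (ι (p x)) a + c x * b γ a := by
      conv_lhs => rw [← h.decomp x]
      simp
    simp only [LinearMap.comp_apply, LinearMap.sub_apply, LinearMap.id_apply,
      LinearMap.smulRight_apply, map_sub, map_smul, hx, ← hc, smul_eq_mul]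
    ring
  apply pairing_injective hb hb
  refine TensorProduct.ext' fun a a' => ?_
  rw [← LinearMap.comp_apply (TensorProduct.map ι ι), ← TensorProduct.map_comp, ht.map ht]
  simp only [TensorProduct.map_tmul, LinearMap.sub_apply, LinearMap.id_apply,
    LinearMap.smulRight_apply, TensorProduct.sub_tmul, TensorProduct.tmul_sub, map_sub,
    TensorProduct.tmul_smul, ← TensorProduct.smul_tmul', map_smul, h1, h2, smul_zero, sub_zero]

theorem pairing_left (h : IsSplitting γ ι p c) (hc : ∀ x, c x = b x u) (t : N ⊗[k] N) (a : A) :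
    pairing b b (TensorProduct.map ι ι t) (u ⊗ₜ a) = 0 := by
  induction t using TensorProduct.induction_on with
  | zero => simp
  | add x y hx hy => simp only [map_add, LinearMap.add_apply, hx, hy, add_zero]
  | tmul m n => rw [TensorProduct.map_tmul, pairing_tmul, ← hc, h.char, zero_mul]

theorem pairing_right (h : IsSplitting γ ι p c) (hc : ∀ x, c x = b x u) (t : N ⊗[k] N) (a : A) :
    pairing b b (TensorProduct.map ι ι t) (a ⊗ₜ u) = 0 := by
  induction t using TensorProduct.induction_on with
  | zero => simp
  | add x y hx hy => simp only [map_add, LinearMap.add_apply, hx, hy, add_zero]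
  | tmul m n => rw [TensorProduct.map_tmul, pairing_tmul, ← hc, h.char, mul_zero]

variable {𝓛 : BraidedLieAlgebra r L}

theorem adBraid_one_right (a : A) : adBraid k A (a ⊗ₜ 1) = ad a := by
  rw [adBraid_tmul, eq_sw ad a]
  simp only [mul_one]

theorem adBraid_one_left (a : A) : adBraid k A (1 ⊗ₜ a) = a ⊗ₜ 1 := by
  rw [adBraid_tmul, sw_adL_one] <;> try fun_prop
  rw [one_mul]

/-- The quantum Lie algebra on the kernel of the counit of a unital braided Lie algebra. -/
theorem exists_isComplement (h : IsSplitting γ ι p c) (h𝓛 : 𝓛.IsDual b)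
    (hr : IsCoquasitriangular r) (hc : ∀ x, c x = b x 1) (hγ : b γ = ε) :
    ∃ σ br, 𝓛.IsComplement γ ι p c σ br ∧
      (∀ t a, b (ι (br t)) a = pairing b b (TensorProduct.map ι ι t) (ad a)) ∧
      ∀ t a a', pairing b b (TensorProduct.map ι ι (σ t)) (a ⊗ₜ a') =
        pairing b b (TensorProduct.map ι ι t) (adBraid k A (a ⊗ₜ a')) -
          pairing b b (TensorProduct.map ι ι t) (ad a) * ε a' := by
  let br : N ⊗[k] N →ₗ[k] N := p ∘ₗ 𝓛.bracket ∘ₗ TensorProduct.map ι ι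
  have hbr (t) : ι (br t) = 𝓛.bracket (TensorProduct.map ι ι t) := by
    have h0 : c (𝓛.bracket (TensorProduct.map ι ι t)) = 0 := by
      rw [hc, h𝓛.bracket, adL_one, h.pairing_left hc]
    have := h.decomp (𝓛.bracket (TensorProduct.map ι ι t))
    rwa [h0, zero_smul, add_zero] at this
  -- The future σ, before its values are seen to lie in N ⊗ N. As `adBraid` sends a ⊗ 1 to ad_L(a),
  -- Υ(x ⊗ y) pairs with a ⊗ 1 to [x, y](a), and the term [x, y] ⊗ γ removes this. In the other slot
  -- 1 ⊗ a goes to a ⊗ 1, against which N pairs to zero.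
  let w : N ⊗[k] N →ₗ[k] L ⊗[k] L := 𝓛.upsilon ∘ₗ TensorProduct.map ι ι -
    (TensorProduct.mk k L L).flip γ ∘ₗ ι ∘ₗ br
  have hw (t a a') : pairing b b (w t) (a ⊗ₜ a') =
      pairing b b (TensorProduct.map ι ι t) (adBraid k A (a ⊗ₜ a')) -
        pairing b b (TensorProduct.map ι ι t) (ad a) * ε a' := by
    simp only [w, LinearMap.sub_apply, LinearMap.comp_apply, map_sub, h𝓛.upsilon hr _ _,
      LinearMap.flip_apply, TensorProduct.mk_apply, pairing_tmul, hbr, h𝓛.bracket _ _, hγ]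
  have hp (t) : TensorProduct.map ι ι (TensorProduct.map p p (w t)) = w t := by
    refine h.map_proj h𝓛.injective hc (fun a => ?_) (fun a => ?_)
    · rw [hw, adBraid_one_left, adL_one, h.pairing_left hc, h.pairing_right hc, zero_mul, sub_zero]
    · rw [hw, adBraid_one_right, Bialgebra.counit_one, mul_one, sub_self]
  refine ⟨TensorProduct.map p p ∘ₗ w, br, { h with upsilon := fun t => ?_ }, fun t a => ?_,
    fun t a a' => ?_⟩
  · rw [LinearMap.comp_apply, hp]
    exact (sub_add_cancel _ _).symm
  · rw [hbr, h𝓛.bracket]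
  · rw [LinearMap.comp_apply, hp, hw]

/-- The braided Lie subalgebra orthogonal to a biinvariant central element. -/
theorem exists_isHom (h : IsSplitting γ ι p c) (h𝓛 : 𝓛.IsDual b) (hc : ∀ x, c x = b x u)
    (hu : ∀ x, LinearMap.lTensor A (b x) (ad u) = 1 ⊗ₜ b x u)
    (hl : ∀ x a, b x (uMul r (u ⊗ₜ a)) = ε a * b x u)
    (hr : ∀ x a, b x (uMul r (a ⊗ₜ u)) = ε a * b x u) :
    ∃ 𝓜 : BraidedLieAlgebra r N, 𝓜.IsHom 𝓛 ι ∧ 𝓛.IsComplement γ ι p c 𝓜.upsilon 0 := by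
  -- Contracting coaction, coproduct or bracket with u returns the value of a functional at u as a
  -- factor, which is zero on N; hence all three operations restrict to N.
  have hN (n) : b (ι n) u = 0 := by rw [← hc, h.char]
  have hcoact : Intertwines ι (TensorProduct.map ι LinearMap.id)
      (LinearMap.rTensor A p ∘ₗ 𝓛.coact ∘ₗ ι) 𝓛.coact := fun n => by
    refine h.rTensor_proj ((TensorProduct.lid k A).injective ?_)
    rw [show c = LinearMap.applyₗ u ∘ₗ b from LinearMap.ext hc]
    refine (h𝓛.coact (ι n) u).trans ?_
    rw [hu, hN, TensorProduct.tmul_zero, map_zero, map_zero]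
  have hcomul : Intertwines ι (TensorProduct.map ι ι)
      (TensorProduct.map p p ∘ₗ 𝓛.comul ∘ₗ ι) 𝓛.comul := fun n => by
    refine h.map_proj h𝓛.injective hc (fun a => ?_) (fun a => ?_)
    · rw [LinearMap.comp_apply, h𝓛.comul, hl, hN, mul_zero]
    · rw [LinearMap.comp_apply, h𝓛.comul, hr, hN, mul_zero]
  have hbr : Intertwines (TensorProduct.map ι ι) ι
      (p ∘ₗ 𝓛.bracket ∘ₗ TensorProduct.map ι ι) 𝓛.bracket := fun t => by
    have h0 : c (𝓛.bracket (TensorProduct.map ι ι t)) = 0 := by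
      rw [hc, h𝓛.bracket]
      induction t using TensorProduct.induction_on with
      | zero => simp
      | add x y hx hy => simp only [map_add, LinearMap.add_apply, hx, hy, add_zero]
      | tmul m n =>
        have e (x y : L) (t : A ⊗[k] A) : pairing b b (x ⊗ₜ y) t =
            b x (TensorProduct.rid k A (LinearMap.lTensor A (b y) t)) := by
          induction t using TensorProduct.induction_on with
          | zero => simp
          | add x y hx hy => simp only [map_add, hx, hy]
          | tmul a a' => simp [pairing_tmul, mul_comm]
        rw [TensorProduct.map_tmul, e, hu, hN, TensorProduct.tmul_zero, map_zero, map_zero]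
    have := h.decomp (𝓛.bracket (TensorProduct.map ι ι t))
    rwa [h0, zero_smul, add_zero] at this
  refine ⟨_, 𝓛.restrict_isHom ι h.injective _ _ _ hcoact hcomul hbr,
    { h with upsilon := fun t => ?_ }⟩
  -- As the inclusion respects all operations it carries one Υ to the other, so the bracket term of
  -- the complement is zero.
  rw [LinearMap.zero_apply, map_zero, TensorProduct.zero_tmul, add_zero]
  exact ((hbr.rTensor ι).comp ((Intertwines.assoc _ _ _).symm.comp
    (((hcoact.braidR r hcoact).lTensor ι).comp
      ((Intertwines.assoc _ _ _).comp (hcomul.rTensor ι)))) t).symm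

end IsSplitting

namespace IsCrossedQuotient

variable {V : Type*} [AddCommGroup V] [Module k V] {π : A →ₗ[k] V}

/-- Coinvariance of the class of u gives c ▷ u ≡ ε(c) u modulo the kernel, and left multiplication
acts on that class by ε. -/
theorem uMul_invariant (hπ : IsCrossedQuotient π)
    (hr : IsCoquasitriangular r) (hu : LinearMap.lTensor A π (ad u) = 1 ⊗ₜ π u)
    (hmul : ∀ a, π (a * u) = ε a • π u) (a : A) :
    π (uMul r (a ⊗ₜ u)) = ε a • π u := by
  have hact (c : A) : π (cqtAct r ad (c ⊗ₜ u)) = ε c • π u := by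
    rw [cqtAct_tmul, map_sw]
    simp only [map_smul]
    rw [sw_eq_lTensor ad π u (fun e y => r (e ⊗ₜ c) • y) (by fun_prop) (by fun_prop), hu,
      liftLin_tmul, hr.one_left]
  have hmul' (a c : A) : π (a * cqtAct r ad (c ⊗ₜ u)) = ε c • ε a • π u := by
    have := hπ.mul a (cqtAct r ad (c ⊗ₜ u) - ε c • u) (by rw [map_sub, hact, map_smul, sub_self])
    rw [mul_sub, map_sub, sub_eq_zero, mul_smul_comm, map_smul, hmul] at this
    exact this
  rw [uMul_tmul, map_sw]
  simp only [hmul', HopfAlgebra.counit_antipode]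
  exact sw_counit_right a (fun a => ε a • π u) (by fun_prop)

/-- As in `uMul_left`, the flipped formula moves u to the right, where both hypotheses apply. -/
theorem invariant_uMul (hπ : IsCrossedQuotient π)
    (hr : IsCoquasitriangular r) (hu : LinearMap.lTensor A π (ad u) = 1 ⊗ₜ π u)
    (hmul : ∀ a, π (a * u) = ε a • π u) (a : A) :
    π (uMul r (u ⊗ₜ a)) = ε a • π u := by
  obtain ⟨s, hs⟩ := π.exists_rightInverse_of_surjective (LinearMap.range_eq_top.mpr hπ.surjective)
  have hmul' (b x : A) : π (b * x) = π (b * s (π x)) := by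
    rw [← sub_eq_zero, ← map_sub, ← mul_sub]
    apply hπ.mul
    rw [map_sub, ← LinearMap.comp_apply, hs, LinearMap.id_apply, sub_self]
  rw [hr.uMul_eq]
  simp only [map_sw, map_smul]
  refine (sw_congr fun c y => sw_congr fun b1 b2 =>
    congrArg (r (b1 ⊗ₜ c) • ·) (hmul' _ _)).trans ?_
  rw [sw_eq_lTensor ad π u (fun c y => sw Δ a fun b1 b2 => r (b1 ⊗ₜ c) • π (b2 * s y))
    (by fun_prop) (by fun_prop), hu, liftLin_tmul]
  simp only [hr.one_right, ← hmul', hmul]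
  exact sw_counit_left a (fun a => ε a • π u) (by fun_prop)

end IsCrossedQuotient

end Splitting

/-! ### Comparison of the enveloping algebras. -/

section Enveloping

variable {k : Type*} {A : Type*} [Field k] [Ring A] [HopfAlgebra k A]
variable {r : A ⊗[k] A →ₗ[k] k} {L N : Type*} [AddCommGroup L] [Module k L]
  [AddCommGroup N] [Module k N]
variable {γ : L} {ι : N →ₗ[k] L} {p : L →ₗ[k] N} {c : L →ₗ[k] k}
  {b : L →ₗ[k] Module.Dual k A} {𝓛 : BraidedLieAlgebra r L}

theorem exists_isSplitting (hι : Function.Injective ι)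
    (hr : LinearMap.range ι = LinearMap.ker c) (hγ : c γ = 1) : ∃ p, IsSplitting γ ι p c := by
  have hmem (x : L) : (LinearMap.id - c.smulRight γ : L →ₗ[k] L) x ∈ LinearMap.range ι := by
    rw [hr, LinearMap.mem_ker]
    simp [hγ]
  have hc (n) : c (ι n) = 0 := LinearMap.mem_ker.mp (hr ▸ ⟨n, rfl⟩ : ι n ∈ LinearMap.ker c)
  let e := LinearEquiv.ofInjective ι hι
  let p : L →ₗ[k] N := e.symm.toLinearMap ∘ₗ LinearMap.codRestrict _ _ hmem
  have hp (x) : ι (p x) = x - c x • γ := congrArg Subtype.val (e.apply_symm_apply ⟨_, hmem x⟩)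
  refine ⟨p, fun x => ?_, fun n => hι ?_, hc, hι ?_, hγ⟩
  · rw [hp, sub_add_cancel]
  · rw [hp, hc, zero_smul, sub_zero]
  · rw [hp, hγ, one_smul, sub_self, map_zero]

theorem adBraid_tmul_eq_rTensor (a a' : A) : adBraid k A (a ⊗ₜ a') =
    LinearMap.rTensor A (LinearMap.mulRight k a') (adL a) := by
  rw [adBraid_tmul, eq_sw adL a, map_sw]
  rfl

/-- A braided enveloping algebra is that of a quantum Lie algebra with zero bracket, so the tangent
space and the inner subalgebra fall under the same presentation lemma. -/
theorem isQEnvMap_zero_iff {T : Type*} [Ring T] [Algebra k T] {q : L →ₗ[k] T} :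
    IsQEnvMap 𝓛.upsilon 0 q ↔ 𝓛.IsEnvMap q := by
  simp only [IsQEnvMap, BraidedLieAlgebra.IsEnvMap, LinearMap.zero_apply, map_zero, add_zero,
    LinearMap.ext_iff, LinearMap.comp_apply, eq_comm]

namespace BraidedLieAlgebra.IsDual

/-- The bialgebra presented by a quantum Lie algebra structure on a complement of the unit. -/
theorem exists_extends (h𝓛 : 𝓛.IsDual b) (hr : IsCoquasitriangular r) (hγ : 𝓛.IsUnit γ)
    {σ : N ⊗[k] N →ₗ[k] N ⊗[k] N} {br : N ⊗[k] N →ₗ[k] N} (h : 𝓛.IsComplement γ ι p c σ br)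
    {T : Type*} [Ring T] [Algebra k T] {q : N →ₗ[k] T}
    (hq : IsQEnvMap σ br q)
    (hgen : Algebra.adjoin k (Set.range q) = ⊤) {φ : T →ₐ[k] 𝓛.EnvUnit γ}
    (hφ : ∀ n, φ (q n) = 𝓛.envUnitι γ (ι n)) :
    ∃ (𝓤 : BraidedBialgebra r T) (ψ : T ≃ₐ[k] 𝓛.EnvUnit γ) (f : L →ₗ[k] T),
      (∀ n, ψ (q n) = 𝓛.envUnitι γ (ι n)) ∧ (∀ l, ψ (f l) = 𝓛.envUnitι γ l) ∧
      f ∘ₗ ι = q ∧ Algebra.adjoin k (Set.range f) = ⊤ ∧ 𝓤.Extends 𝓛 f := by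
  obtain ⟨ψ, f, hψ, hf, hgen, hfrel, hf1, hfι⟩ := h.exists_equiv hr hγ hq hgen φ hφ
  obtain ⟨𝓤, h𝓤⟩ := (h𝓛.isRegular hr).exists_envUnit hr hγ ψ hf hgen hfrel hf1
  exact ⟨𝓤, ψ, f, hψ, hf, hfι, hgen, h𝓤⟩

/-- The enveloping algebra of a unital braided Lie algebra, and its quotient by the unit. -/
theorem exists_env (h𝓛 : 𝓛.IsDual b) (hr : IsCoquasitriangular r) (hγ : 𝓛.IsUnit γ) :
    ∃ (𝓑 : BraidedBialgebra r 𝓛.Env) (𝓠 : BraidedBialgebra r (𝓛.EnvUnit γ)),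
      𝓑.Extends 𝓛 𝓛.envι ∧ 𝓠.Extends 𝓛 (𝓛.envUnitι γ) ∧
      𝓑.IsHom 𝓠 (RingQuot.mkAlgHom k (𝓛.UnitRel γ)) := by
  obtain ⟨𝓑, h𝓑⟩ := (h𝓛.isRegular hr).exists_env hr
  obtain ⟨𝓠, h𝓠⟩ := (h𝓛.isRegular hr).exists_envUnit hr hγ AlgEquiv.refl (fun l => rfl)
    (𝓛.adjoin_range_envUnitι γ) (𝓛.envUnitι_rel γ) (𝓛.envUnitι_unit γ)
  exact ⟨𝓑, 𝓠, h𝓑, h𝓠,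
    BraidedBialgebra.isHom_of_extends 𝓛.adjoin_range_envι h𝓑 h𝓠 _ fun l => rfl⟩

theorem exists_qenv (h𝓛 : 𝓛.IsDual b) (hr : IsCoquasitriangular r) (hγ : 𝓛.IsUnit γ)
    {σ : N ⊗[k] N →ₗ[k] N ⊗[k] N} {br : N ⊗[k] N →ₗ[k] N} (h : 𝓛.IsComplement γ ι p c σ br)
    {𝓠 : BraidedBialgebra r (𝓛.EnvUnit γ)} (h𝓠 : 𝓠.Extends 𝓛 (𝓛.envUnitι γ)) :
    ∃ (𝓤 : BraidedBialgebra r (QEnv σ br)) (ψ : QEnv σ br ≃ₐ[k] 𝓛.EnvUnit γ)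
      (f : L →ₗ[k] QEnv σ br), 𝓤.IsHom 𝓠 ψ.toAlgHom ∧
      (∀ x, ψ (qenvι σ br x) = 𝓛.envUnitι γ (ι x)) ∧
      𝓤.Extends 𝓛 f ∧ ∀ l, ψ (f l) = 𝓛.envUnitι γ l := by
  have hrel := h.rel (𝓛.envUnitι_rel γ) (𝓛.envUnitι_unit γ)
  obtain ⟨𝓤, ψ, f, hψ, hf, -, hgen, h𝓤⟩ := h𝓛.exists_extends hr hγ h
    (qenvι_rel (σ := σ) (br := br)) adjoin_range_qenvι (QEnv.lift_qenvι _ hrel)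
  exact ⟨𝓤, ψ, f, BraidedBialgebra.isHom_of_extends hgen h𝓤 h𝓠 _ hf, hψ, h𝓤, hf⟩

/-- The enveloping algebra of a braided Lie subalgebra complementing the unit. -/
theorem exists_env_equiv (h𝓛 : 𝓛.IsDual b) (hr : IsCoquasitriangular r) (hγ : 𝓛.IsUnit γ)
    {𝓜 : BraidedLieAlgebra r N} (hι : 𝓜.IsHom 𝓛 ι) (h : 𝓛.IsComplement γ ι p c 𝓜.upsilon 0)
    {T : Type*} [Ring T] [Algebra k T] {𝓤 : BraidedBialgebra r T} {ψ : T ≃ₐ[k] 𝓛.EnvUnit γ}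
    {f : L →ₗ[k] T} (h𝓤 : 𝓤.Extends 𝓛 f) (hf : ∀ l, ψ (f l) = 𝓛.envUnitι γ l) :
    ∃ (𝓑 : BraidedBialgebra r 𝓜.Env) (φ : 𝓜.Env ≃ₐ[k] T),
      𝓑.Extends 𝓜 𝓜.envι ∧ 𝓑.IsHom 𝓤 φ.toAlgHom ∧
      ∀ x, ψ (φ (𝓜.envι x)) = 𝓛.envUnitι γ (ι x) := by
  have hq : IsQEnvMap (E := 𝓜.Env) 𝓜.upsilon 0 𝓜.envι := isQEnvMap_zero_iff.mpr 𝓜.envι_rel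
  have hrel : 𝓜.IsEnvMap (E := 𝓛.EnvUnit γ) (𝓛.envUnitι γ ∘ₗ ι) :=
    isQEnvMap_zero_iff.mp (h.rel (𝓛.envUnitι_rel γ) (𝓛.envUnitι_unit γ))
  obtain ⟨𝓑, χ, g, hχ, hg, hgι, hgen, h𝓑⟩ := h𝓛.exists_extends hr hγ h hq 𝓜.adjoin_range_envι
    (Env.lift_envι _ hrel)
  refine ⟨𝓑, χ.trans ψ.symm, hgι ▸ h𝓑.comp hι, BraidedBialgebra.isHom_of_extends hgen h𝓑 h𝓤 _
    fun l => ?_, fun x => ?_⟩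
  · change ψ.symm (χ (g l)) = f l
    rw [hg, ← hf, ψ.symm_apply_apply]
  · change ψ (ψ.symm (χ _)) = _
    rw [ψ.apply_symm_apply, hχ]

end BraidedLieAlgebra.IsDual

end Enveloping

/-! ### Inner calculi: the element Θ − θ and its orthogonal. -/

namespace BiData

variable {k : Type*} {A : Type*} [Field k] [Ring A] [HopfAlgebra k A]
variable {Γ : Type*} [AddCommGroup Γ] [Module k Γ] {X : BiData k A Γ} {d : A →ₗ[k] Γ}

local notation "Δ" => Coalgebra.comul (R := k)
local notation "ε" => Coalgebra.counit (R := k)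
local notation "ad" => adL (k := k) (A := A)

theorem ext_isBiinvariant {θ : Γ} (hθ : X.IsBiinvariant θ) :
    (X.ext d).IsBiinvariant (-θ, 1) := by
  have e : ((-θ, 1) : Γ × A) = -LinearMap.inl k Γ A θ + ((0 : Γ), (1 : A)) := by simp
  constructor
  · rw [e, map_add, map_neg, ← IsBicovariantFODC.ext_lco_inl, hθ.1, IsBicovariantFODC.ext_lco_unit,
      TensorProduct.map_tmul, TensorProduct.tmul_add, TensorProduct.tmul_neg, LinearMap.id_apply]
  · rw [e, map_add, map_neg, ← IsBicovariantFODC.ext_rco_inl, hθ.2, IsBicovariantFODC.ext_rco_unit,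
      TensorProduct.map_tmul, TensorProduct.add_tmul, TensorProduct.neg_tmul, LinearMap.id_apply]

namespace IsBicovariantFODC

variable (hd : X.IsBicovariantFODC d)
include hd

/-- The pair `(-θ, 1)` is Θ − θ, and a(Θ − θ) = da + Θa − aθ = (Θ − θ)a: innerness of `d` is
centrality of Θ − θ. -/
theorem ext_lact_eq_ract {θ : Γ} (hθ : ∀ a, d a = X.lact (a ⊗ₜ θ) - X.ract (θ ⊗ₜ a)) (a : A) :
    (X.ext d).lact (a ⊗ₜ ((-θ, 1) : Γ × A)) = (X.ext d).ract (((-θ, 1) : Γ × A) ⊗ₜ a) := by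
  rw [ext_lact_tmul, ext_ract_tmul]
  simp only [hd.ract_one, hθ a, TensorProduct.tmul_neg, TensorProduct.neg_tmul, map_neg, mul_one,
    one_mul]
  rw [neg_add_eq_sub, sub_sub_cancel_left]

/-- For an inner calculus, `Θ - θ` is the class of an element of `A` that behaves like the unit. -/
theorem exists_omegaR_eq {θ : Γ} (hθ : X.IsBiinvariant θ)
    (hin : ∀ a, d a = X.lact (a ⊗ₜ θ) - X.ract (θ ⊗ₜ a)) :
    ∃ u : A, X.extOmega d u = (-θ, 1) ∧ ε u = 1 ∧
      LinearMap.lTensor A hd.omegaR (ad u) = 1 ⊗ₜ hd.omegaR u ∧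
      ∀ a, hd.omegaR (a * u) = ε a • hd.omegaR u := by
  have hη := X.ext_isBiinvariant (d := d) hθ
  -- Θ − θ is right invariant, hence in the image of the Maurer-Cartan map; its Θ-component 1 gives
  -- ε(u) = 1.
  obtain ⟨u, hu⟩ := hd.omegaR_surjective ⟨(-θ, 1), mem_rightInv.mpr hη.2⟩
  have hu' : X.extOmega d u = (-θ, 1) := congrArg Subtype.val hu
  refine ⟨u, hu', ?_, ?_, fun a => Subtype.ext ?_⟩
  · have := congrArg (Coalgebra.counit (R := k)) (extOmega_snd (X := X) (d := d) u)
    rw [hu', map_smul, Bialgebra.counit_one, smul_eq_mul, mul_one] at this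
    exact this.symm
  · apply Module.Flat.lTensor_preserves_injective_linearMap (M := A) _
      (X.extCotangent d).subtype_injective
    rw [hd.lTensor_subtype_omegaR, hu', hη.1, LinearMap.lTensor_tmul, Submodule.subtype_apply,
      hd.coe_omegaR, hu']
  · rw [Submodule.coe_smul, hd.coe_omegaR, hd.coe_omegaR, hd.extOmega_mul, hu', adAct_tmul]
    have hH := hd.ext_isHopfBimodule
    -- By centrality a₁ (Θ − θ) S(a₂) = (Θ − θ) a₁ S(a₂).
    simp only [hd.ext_lact_eq_ract hin, ← hH.ract_mul]
    rw [sw_antipode_right a (fun z => (X.ext d).ract (((-θ, 1) : Γ × A) ⊗ₜ z)) (by fun_prop),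
      hH.ract_one]

/-- The bilinear form on the extended bimodule and the extended tangent space. -/
theorem exists_bilinearForm : ∃ β : (Γ × A) →ₗ[k] X.extTangent d →ₗ[k] k,
    ∀ (a b : A) (x : X.extTangent d), β ((X.ext d).ract (X.extOmega d a ⊗ₜ b)) x =
      (x : Module.Dual k A) a * ε b := by
  obtain ⟨s, hs⟩ := hd.omegaR.exists_rightInverse_of_surjective
    (LinearMap.range_eq_top.mpr hd.omegaR_surjective)
  have hmem (w : Γ × A) : (X.ext d).rightProj w ∈ X.extCotangent d := by
    obtain ⟨a, ha⟩ := hd.rightProj_mem_range w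
    exact ha ▸ hd.extOmega_mem a
  -- The form evaluates X on a preimage of the right-invariant projection. The section `s` only
  -- picks representatives, and X vanishes on the ideal.
  refine ⟨LinearMap.lcomp k k (X.extTangent d).subtype ∘ₗ LinearMap.applyₗ ∘ₗ s ∘ₗ
    (X.ext d).rightProj.codRestrict _ hmem, fun a b x => ?_⟩
  have h1 : (X.ext d).rightProj.codRestrict _ hmem ((X.ext d).ract (X.extOmega d a ⊗ₜ b)) =
      ε b • hd.omegaR a := Subtype.ext
    (hd.ext_isHopfBimodule.rightProj_ract (mem_rightInv.mp (hd.extOmega_mem a)) b)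
  have h2 : (x : Module.Dual k A) (s (hd.omegaR a)) = (x : Module.Dual k A) a := by
    rw [← sub_eq_zero, ← map_sub]
    refine mem_extTangent.mp x.2 _ ((hd.omegaR_eq_zero_iff _).mp ?_)
    rw [map_sub, ← LinearMap.comp_apply, hs, LinearMap.id_apply, sub_self]
  change (x : Module.Dual k A) (s _) = _
  rw [h1, map_smul, map_smul, h2, smul_eq_mul, mul_comm]

/-- The complement of the unit defined by a biinvariant central element. -/
theorem exists_isHom_isComplement {r : A ⊗[k] A →ₗ[k] k} (hr : IsCoquasitriangular r)
    {L N : Type*} [AddCommGroup L] [Module k L] [AddCommGroup N] [Module k N]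
    {𝓛 : BraidedLieAlgebra r L} {b : L →ₗ[k] Module.Dual k A} (h𝓛 : 𝓛.IsDual b)
    (hL : LinearMap.range b = X.extTangent d) {γ : L} (hγ : b γ = Coalgebra.counit)
    {ι : N →ₗ[k] L} (hι : Function.Injective ι) {u : A}
    (hιu : LinearMap.range ι = LinearMap.ker (LinearMap.applyₗ u ∘ₗ b)) (hu : ε u = 1)
    (hu1 : LinearMap.lTensor A hd.omegaR (ad u) = 1 ⊗ₜ hd.omegaR u)
    (hu2 : ∀ a, hd.omegaR (a * u) = ε a • hd.omegaR u) :
    ∃ (𝓜 : BraidedLieAlgebra r N) (p : L →ₗ[k] N) (c : L →ₗ[k] k),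
      𝓜.IsHom 𝓛 ι ∧ 𝓛.IsComplement γ ι p c 𝓜.upsilon 0 := by
  obtain ⟨p, hp⟩ := exists_isSplitting hι hιu
    (show (LinearMap.applyₗ u ∘ₗ b) γ = 1 by simp [hγ, hu])
  have hπ := hd.isCrossedQuotient
  have e1 (x : L) : LinearMap.lTensor A (b x) (ad u) = 1 ⊗ₜ b x u := by
    obtain ⟨y, hy⟩ := hd.exists_comp_omegaR hL x
    rw [hy, LinearMap.lTensor_comp, LinearMap.comp_apply, hu1, LinearMap.lTensor_tmul]
    rfl
  have e2 (x : L) (a : A) : b x (uMul r (u ⊗ₜ a)) = ε a * b x u := by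
    obtain ⟨y, hy⟩ := hd.exists_comp_omegaR hL x
    rw [hy, LinearMap.comp_apply, hπ.invariant_uMul hr hu1 hu2, map_smul]
    rfl
  have e3 (x : L) (a : A) : b x (uMul r (a ⊗ₜ u)) = ε a * b x u := by
    obtain ⟨y, hy⟩ := hd.exists_comp_omegaR hL x
    rw [hy, LinearMap.comp_apply, hπ.uMul_invariant hr hu1 hu2, map_smul]
    rfl
  obtain ⟨𝓜, h1, h2⟩ := hp.exists_isHom h𝓛 (fun x => rfl) e1 e2 e3
  exact ⟨𝓜, p, _, h1, h2⟩

omit hd in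
theorem range_tangentIncl : LinearMap.range (X.tangentIncl d) =
    LinearMap.ker (LinearMap.applyₗ (1 : A) ∘ₗ (X.extTangent d).subtype) := by
  ext x
  rw [LinearMap.mem_range, LinearMap.mem_ker]
  constructor
  · rintro ⟨y, rfl⟩
    exact y.2.2
  · exact fun h => ⟨⟨x, x.2, h⟩, rfl⟩

/-- With b = 1 the form against the Maurer-Cartan element of u is evaluation at u, which turns the
orthogonal into the kernel used for splittings. -/
theorem range_orthIncl {β : (Γ × A) →ₗ[k] X.extTangent d →ₗ[k] k}
    (hβ : ∀ (a b : A) (x : X.extTangent d), β ((X.ext d).ract (X.extOmega d a ⊗ₜ b)) x =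
      (x : Module.Dual k A) a * ε b) (u : A) :
    LinearMap.range (X.orthIncl β (X.extOmega d u)) =
      LinearMap.ker (LinearMap.applyₗ u ∘ₗ (X.extTangent d).subtype) := by
  have hu (x : X.extTangent d) : β (X.extOmega d u) x = (x : Module.Dual k A) u := by
    rw [← hd.ext_isHopfBimodule.ract_one (X.extOmega d u), hβ, Bialgebra.counit_one, mul_one]
  ext x
  rw [LinearMap.mem_range, LinearMap.mem_ker]
  constructor
  · rintro ⟨⟨_, y, hy, rfl⟩, rfl⟩
    exact (hu y).symm.trans hy
  · exact fun h => ⟨⟨x, x, (hu x).trans h, rfl⟩, rfl⟩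

end IsBicovariantFODC
end BiData
end BraidedLie

/-! ### The tangent space as a complement of ε. -/

namespace BraidedLie.BiData.IsBicovariantFODC

variable {k : Type*} {A : Type*} [Field k] [Ring A] [HopfAlgebra k A]
variable {Γ : Type*} [AddCommGroup Γ] [Module k Γ] {X : BiData k A Γ} {d : A →ₗ[k] Γ}

theorem pairing_map_tangentIncl (t : X.tangent d ⊗[k] X.tangent d) :
    pairing (M := X.extTangent d) (N := X.extTangent d) (X.extTangent d).subtype
      (X.extTangent d).subtype
      (TensorProduct.map (X.tangentIncl d) (X.tangentIncl d) t) = pair₂ (X.tangent d) t := by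
  have h : TensorProduct.map (X.extTangent d).subtype (X.extTangent d).subtype ∘ₗ
      TensorProduct.map (X.tangentIncl d) (X.tangentIncl d) =
      TensorProduct.map (X.tangent d).subtype (X.tangent d).subtype := by
    rw [← TensorProduct.map_comp]
    rfl
  exact congrArg (TensorProduct.dualDistrib k A A) (LinearMap.congr_fun h t)

theorem exists_tangent_isSplitting (γ : X.extTangent d)
    (hγ : (γ : Module.Dual k A) = Coalgebra.counit) :
    ∃ p, IsSplitting (L := X.extTangent d) (N := X.tangent d) γ (X.tangentIncl d) p
      (LinearMap.applyₗ (1 : A) ∘ₗ (X.extTangent d).subtype) :=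
  exists_isSplitting (L := X.extTangent d) (N := X.tangent d) (Submodule.inclusion_injective _)
    range_tangentIncl (by simp [hγ])

end BraidedLie.BiData.IsBicovariantFODC

end

/-! ### Assembly of the main theorem. -/

theorem mainTheorem1 {k : Type*} {A : Type*} {Γ : Type*} [Field k] [Ring A] [HopfAlgebra k A]
    (r : A ⊗[k] A →ₗ[k] k) (hr : BraidedLie.IsCoquasitriangular r)
    [AddCommGroup Γ] [Module k Γ] (X : BraidedLie.BiData k A Γ) (d : A →ₗ[k] Γ)
    (hd : X.IsBicovariantFODC d) :
    -- (i) the extended cotangent space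
    (∃ (C : BraidedLie.BraidedLieCoalgebra r (X.extCotangent d))
        (ε : X.extCotangent d →ₗ[k] k)
        (e : (A ⧸ X.ideal d) ≃ₗ[k] X.extCotangent d),
      C.IsCounit ε ∧
      -- the coaction is that of the extended bimodule
      (∀ v : X.extCotangent d,
        LinearMap.lTensor A (X.extCotangent d).subtype (C.coact v) = (X.ext d).lco v) ∧
      -- `e` is the isomorphism of crossed modules induced by the Maurer-Cartan map
      (∀ a : A, (e (Submodule.Quotient.mk a) : Γ × A) = X.extOmega d a) ∧
      (∀ a b : A, (e (Submodule.Quotient.mk (a * b)) : Γ × A) =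
        (X.ext d).adAct (a ⊗ₜ[k] (e (Submodule.Quotient.mk b) : Γ × A))) ∧
      (∀ a : A, C.coact (e (Submodule.Quotient.mk a)) =
        LinearMap.lTensor A (e.toLinearMap ∘ₗ (X.ideal d).mkQ) (BraidedLie.adL a)) ∧
      -- and the structure is the one induced from the braided group of `A`
      (∀ a b : A, C.mul (e (Submodule.Quotient.mk a) ⊗ₜ e (Submodule.Quotient.mk b)) =
        e (Submodule.Quotient.mk (BraidedLie.uMul r (a ⊗ₜ b)))) ∧
      C.one = e (Submodule.Quotient.mk 1) ∧
      (∀ a : A, C.cobracket (e (Submodule.Quotient.mk a)) =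
        TensorProduct.map (e.toLinearMap ∘ₗ (X.ideal d).mkQ) (e.toLinearMap ∘ₗ (X.ideal d).mkQ)
          (BraidedLie.adL a)) ∧
      (∀ a : A, ε (e (Submodule.Quotient.mk a)) = Coalgebra.counit (R := k) a)) ∧
    -- (ii) the extended tangent space of a finite dimensional calculus
    (FiniteDimensional k X.rightInv →
      ∃ (𝓛 : BraidedLie.BraidedLieAlgebra r (X.extTangent d)) (γ : X.extTangent d)
        (σ : X.tangent d ⊗[k] X.tangent d →ₗ[k] X.tangent d ⊗[k] X.tangent d)
        (br : X.tangent d ⊗[k] X.tangent d →ₗ[k] X.tangent d)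
        (𝓑 : BraidedLie.BraidedBialgebra r 𝓛.Env)
        (𝓠 : BraidedLie.BraidedBialgebra r (𝓛.EnvUnit γ))
        (𝓤 : BraidedLie.BraidedBialgebra r (BraidedLie.QEnv (k := k) (g := X.tangent d) σ br))
        (ψ : BraidedLie.QEnv (k := k) (g := X.tangent d) σ br ≃ₐ[k] 𝓛.EnvUnit γ),
      X.IsDualStructure r d 𝓛 ∧
      (γ : Module.Dual k A) = Coalgebra.counit ∧ 𝓛.IsUnit γ ∧
      X.IsTangentBraiding d σ ∧ X.IsTangentBracket d br ∧
      𝓑.Extends 𝓛 𝓛.envι ∧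
      𝓑.IsHom 𝓠 (RingQuot.mkAlgHom k (𝓛.UnitRel γ)) ∧
      𝓤.IsHom 𝓠 ψ.toAlgHom ∧
      (∀ x : X.tangent d, ψ (BraidedLie.qenvι (k := k) (g := X.tangent d) σ br x) =
        RingQuot.mkAlgHom k (𝓛.UnitRel γ) (𝓛.envι (X.tangentIncl d x))) ∧
      -- (iii) inner calculi
      (∀ θ : Γ, X.IsBiinvariant θ →
        (∀ a : A, d a = X.lact (a ⊗ₜ θ) - X.ract (θ ⊗ₜ a)) →
        ∃ β : (Γ × A) →ₗ[k] X.extTangent d →ₗ[k] k,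
          (∀ (a b : A) (x : X.extTangent d),
            β ((X.ext d).ract (X.extOmega d a ⊗ₜ b)) x =
              (x : Module.Dual k A) a * Coalgebra.counit (R := k) b) ∧
          -- the braided Lie subalgebra is the orthogonal of `Θ - θ`
          ∃ (𝓜 : BraidedLie.BraidedLieAlgebra r (X.orth β (-θ, 1)))
            (𝓑M : BraidedLie.BraidedBialgebra r 𝓜.Env)
            (φ : 𝓜.Env ≃ₐ[k] BraidedLie.QEnv (k := k) (g := X.tangent d) σ br),
            𝓜.IsHom 𝓛 (X.orthIncl β (-θ, 1)) ∧
            𝓑M.Extends 𝓜 𝓜.envι ∧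
            𝓑M.IsHom 𝓤 φ.toAlgHom ∧
            (∀ x : X.orth β (-θ, 1), ψ (φ (𝓜.envι x)) =
              RingQuot.mkAlgHom k (𝓛.UnitRel γ) (𝓛.envι (X.orthIncl β (-θ, 1) x))))) := by
  refine ⟨hd.extCotangent_braidedLieCoalgebra r hr, fun hfin => ?_⟩
  obtain ⟨𝓛, γ, h𝓛, hγε, hγ⟩ := hd.exists_braidedLieAlgebra (L := X.extTangent d)
    (b := (X.extTangent d).subtype) (X.extTangent d).range_subtype hr
    (X.extTangent d).subtype_injective
  -- The complement given by evaluation at 1 is the tangent space; its bracket term gives U(g).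
  obtain ⟨p, hp⟩ := BraidedLie.BiData.IsBicovariantFODC.exists_tangent_isSplitting γ hγε
  obtain ⟨σ, br, hσ, hbr, hbraid⟩ := hp.exists_isComplement h𝓛 hr (fun _ => rfl) hγε
  obtain ⟨𝓑, 𝓠, h𝓑, h𝓠, hmk⟩ := h𝓛.exists_env hr hγ
  obtain ⟨𝓤, ψ, f, hψ, hψι, h𝓤, hf⟩ := h𝓛.exists_qenv hr hγ hσ h𝓠
  refine ⟨𝓛, γ, σ, br, 𝓑, 𝓠, 𝓤, ψ, ⟨h𝓛.coact, h𝓛.comul, h𝓛.counit, h𝓛.bracket⟩, hγε, hγ,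
    fun t a b => ?_, fun t a => ?_, h𝓑, hmk, hψ, hψι, fun θ hθ hin => ?_⟩
  · have h := hbraid t a b
    rw [BraidedLie.adBraid_tmul_eq_rTensor] at h
    have h1 := BraidedLie.BiData.IsBicovariantFODC.pairing_map_tangentIncl t
    have h2 := BraidedLie.BiData.IsBicovariantFODC.pairing_map_tangentIncl (σ t)
    rw [← h1, ← h2]
    exact h
  · rw [← BraidedLie.BiData.IsBicovariantFODC.pairing_map_tangentIncl t]
    exact hbr t a
  obtain ⟨β, hβ⟩ := hd.exists_bilinearForm
  -- A second complement of γ, with u in place of 1; ε(u) = 1 makes it complementary and its bracket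
  -- term is zero.
  obtain ⟨u, hu, huε, hu1, hu2⟩ := hd.exists_omegaR_eq hθ hin
  obtain ⟨𝓜, pM, c, hι, hM⟩ := hd.exists_isHom_isComplement hr (L := X.extTangent d)
    (N := X.orth β (-θ, 1)) h𝓛 (X.extTangent d).range_subtype hγε (ι := X.orthIncl β (-θ, 1))
    (Submodule.inclusion_injective _) (hu ▸ hd.range_orthIncl hβ u) huε hu1 hu2
  obtain ⟨𝓑M, φ, h𝓑M, hφ, hφι⟩ := h𝓛.exists_env_equiv hr hγ hι hM h𝓤 hf
  exact ⟨β, hβ, 𝓜, 𝓑M, φ, hι, h𝓑M, hφ, hφι⟩
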